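/- Conventions. A quantum circuit with $k$ input and $l$ output (qu)bits is a sequence of one- and two-qubit unitary gates on some number $m \ge k, l$ of qubits; the input is placed in the first $k$ qubits, the others start in $|0\rangle$, and the output is in the first $l$ qubits (measured in the classical basis when the output is classical). Its size is the number of its gates. Fix a finite set $\mathcal G$ of one- and two-qubit unitary gates containing $H$, $T$ and CNOT. A \emph{uniform family} is a family $(C_n)_n$ of circuits over $\mathcal G$ whose descriptions are produced from $1^n$ by a classical machine in time polynomial in $n$ (so $C_n$ has polynomial size). Adversaries are non-uniform circuits over all one- and two-qubit unitary gates. Write $a\cdot x$ for the inner product modulo $2$ of $a,x\in\{0,1\}^n$. All random strings are uniformly distributed. A family $f=(f_n)$ of permutations of $\{0,1\}^n$ is a \emph{quantum one-way permutation} if (i) a uniform family of circuits computes $f_n(x)$ from $x$ (exactly), and (ii) for all constants $c,d$ and all sufficiently large $n$, no circuit $C$ of size at most $n^d$ satisfies $\Pr_a[C(f_n(a))=a]\ge n^{-c}$. Theorem. Let $f$ be a quantum one-way permutation. Then there is a bit commitment scheme, and there is a qubit commitment scheme, that is correct, efficient, perfectly binding and computationally concealing, namely the following ones. (1) Bit commitment.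 To commit to $z\in\{0,1\}$, Alice chooses random $a,x\in\{0,1\}^n$ and sends $(f(a),\,x,\,z\oplus a\cdot x)$. To decommit she sends $a$. On $(b,x,c)$ and $a$, Bob accepts if $f(a)=b$, and takes $c\oplus a\cdot x$ as the bit. Correct: honest Bob always accepts and obtains $z$. Efficient: both parties' computations are performed exactly by uniform families of quantum circuits over $\mathcal G$. Perfectly binding: for every $(b,x,c)$, all openings that Bob accepts yield the same bit. Computationally concealing: for all constants $c,d$ and all sufficiently large $n$, no quantum circuit of size at most $n^d$, given the commitment to a uniformly random bit $z$, outputs $z$ with probability at least $\frac12+n^{-c}$. (2) Qubit commitment. To commit to a qubit $|\psi\rangle$, Alice chooses random $a_1,a_2,x_1,x_2\in\{0,1\}^n$ and sends the qubit $|\psi'\rangle=X^{a_1\cdot x_1}Z^{a_2\cdot x_2}|\psi\rangle$ ($X,Z$ the Pauli matrices) and $f(a_1),f(a_2),x_1,x_2$. To decommit she sends $a_1,a_2$. On $(|\psi'\rangle,b_1,b_2,x_1,x_2)$ and $(a_1,a_2)$, Bob accepts if $f(a_1)=b_1$ and $f(a_2)=b_2$, and takes $Z^{a_2\cdot x_2}X^{a_1\cdot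 x_1}|\psi'\rangle$ as the qubit. Correct: honest Bob always accepts and obtains $|\psi\rangle$. Efficient: as in (1). Perfectly binding: for every $b_1,b_2,x_1,x_2$, all openings that Bob accepts make him apply the same unitary to the qubit he holds. Computationally concealing: for all constants $c,d$, all sufficiently large $n$ and every pure qubit state $|\psi\rangle$, no quantum circuit of size at most $n^d$ distinguishes, with advantage at least $n^{-c}$, what Bob receives in the commitment phase from the same classical data together with a qubit in the totally mixed state $\frac12 I$. -/

import Mathlib

open Filter

noncomputable section

/-! ### Bit strings -/

/-- Bit strings of length `n`. -/
abbrev BitString (n : ℕ) : Type := Fin n → Bool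

/-- The first part of a concatenated string. -/
def BitString.fst {k l : ℕ} (w : BitString (k + l)) : BitString k := fun i => w (Fin.castAdd l i)

/-- The second part of a concatenated string. -/
def BitString.snd {k l : ℕ} (w : BitString (k + l)) : BitString l := fun i => w (Fin.natAdd k i)

/-- The inner product `y · x` modulo two. -/
def innerMod2 {n : ℕ} (y x : BitString n) : Bool :=
  decide (Odd (Finset.univ.filter fun i => y i = true ∧ x i = true).card)

/-- The average of `g` over a uniformly random string of length `n`. -/
def uniformAvg {n : ℕ} (g : BitString n → ℝ) : ℝ := (∑ x, g x) / 2 ^ n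

/-! ### Quantum circuits -/

/-- A set of gates on one and two qubits. The basis of one qubit is indexed by `Bool`. -/
structure GateSet where
  One : Type
  Two : Type
  one : One → Matrix.unitaryGroup Bool ℂ
  two : Two → Matrix.unitaryGroup (Bool × Bool) ℂ

/-- All unitary gates on one and two qubits. -/
def allGates : GateSet where
  One := Matrix.unitaryGroup Bool ℂ
  Two := Matrix.unitaryGroup (Bool × Bool) ℂ
  one := id
  two := id

/-- The Hadamard matrix. -/
def hadamardMatrix : Matrix Bool Bool ℂ :=
  Matrix.of fun x y => (if x && y then -1 else 1) / (Real.sqrt 2 : ℂ)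

/-- The matrix `diag (1, exp (iπ/4))`. -/
def tMatrix : Matrix Bool Bool ℂ :=
  Matrix.diagonal fun x => if x then Complex.exp (Real.pi / 4 * Complex.I) else 1

/-- The controlled-NOT matrix; the first qubit is the control. -/
def cnotMatrix : Matrix (Bool × Bool) (Bool × Bool) ℂ :=
  Matrix.of fun x y => if x = (y.1, xor y.1 y.2) then 1 else 0

/-- The gate set contains the standard universal gates `H`, `T` and `CNOT`. -/
structure GateSet.ContainsCliffordT (𝒢 : GateSet) : Prop where
  hadamard : ∃ a, (𝒢.one a : Matrix Bool Bool ℂ) = hadamardMatrix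
  t : ∃ a, (𝒢.one a : Matrix Bool Bool ℂ) = tMatrix
  cnot : ∃ b, (𝒢.two b : Matrix (Bool × Bool) (Bool × Bool) ℂ) = cnotMatrix

/-- A gate of `𝒢` together with the qubits (of `m`) it acts on. -/
inductive Gate (𝒢 : GateSet) (m : ℕ) : Type
  | one (a : 𝒢.One) (i : Fin m) : Gate 𝒢 m
  | two (b : 𝒢.Two) (i j : Fin m) (hij : i ≠ j) : Gate 𝒢 m

/-- State vectors of `m` qubits, by their amplitudes in the classical basis. -/
abbrev QState (m : ℕ) : Type := BitString m → ℂ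

/-- The action of a gate on a state vector. -/
def Gate.apply {𝒢 : GateSet} {m : ℕ} : Gate 𝒢 m → QState m → QState m
  | .one a i, ψ => fun x =>
      ∑ b : Bool, (𝒢.one a : Matrix Bool Bool ℂ) (x i) b * ψ (Function.update x i b)
  | .two g i j _, ψ => fun x =>
      ∑ b : Bool, ∑ c : Bool,
        (𝒢.two g : Matrix (Bool × Bool) (Bool × Bool) ℂ) (x i, x j) (b, c) *
          ψ (Function.update (Function.update x i b) j c)

/-- A quantum circuit on `width` qubits. The input is on the first `inp` qubits, the others start
in `|0⟩`; the output is on the first `out` qubits, the others are discarded. -/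
structure QCircuit (𝒢 : GateSet) (inp out : ℕ) where
  width : ℕ
  inp_le : inp ≤ width
  out_le : out ≤ width
  gates : List (Gate 𝒢 width)

/-- The string `y` followed by the string `w`. -/
def joinBits {k m : ℕ} (y : BitString k) (w : BitString (m - k)) : BitString m :=
  fun i => if h : (i : ℕ) < k then y ⟨i, h⟩ else w ⟨i - k, by omega⟩

namespace QCircuit

variable {𝒢 : GateSet} {inp out : ℕ}

/-- The number of gates. -/
def size (C : QCircuit 𝒢 inp out) : ℕ := C.gates.length

/-- The state `|φ⟩|0…0⟩`. -/
def initial (C : QCircuit 𝒢 inp out) (φ : QState inp) : QState C.width := fun z =>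
  if ∀ i : Fin C.width, inp ≤ (i : ℕ) → z i = false then φ fun i => z (Fin.castLE C.inp_le i)
  else 0

/-- The state `C |φ⟩|0…0⟩`. -/
def final (C : QCircuit 𝒢 inp out) (φ : QState inp) : QState C.width :=
  C.gates.foldl (fun ψ g => g.apply ψ) (C.initial φ)

/-- The density matrix of the output qubits (the partial trace over all the others). -/
def outState (C : QCircuit 𝒢 inp out) (φ : QState inp) :
    Matrix (BitString out) (BitString out) ℂ :=
  Matrix.of fun y y' => ∑ w : BitString (C.width - out),
    C.final φ (joinBits y w) * star (C.final φ (joinBits y' w))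

/-- The probability that measuring the output qubits in the classical basis yields `y`. -/
def prob (C : QCircuit 𝒢 inp out) (φ : QState inp) (y : BitString out) : ℝ :=
  ∑ w : BitString (C.width - out), ‖C.final φ (joinBits y w)‖ ^ 2

end QCircuit

/-- The classical basis state `|x⟩`. -/
def ket {n : ℕ} (x : BitString n) : QState n := Pi.single x 1

/-- The state `|ψ⟩|y⟩` of one qubit followed by a classical string. -/
def qubitKet {k : ℕ} (ψ : Bool → ℂ) (y : BitString k) : QState (k + 1) := fun z =>
  ψ (z 0) * ket y (fun i => z i.succ)

/-- On every classical input `x` the measured output is `g x` with certainty. -/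
def QCircuit.Computes {𝒢 : GateSet} {inp out : ℕ} (C : QCircuit 𝒢 inp out)
    (g : BitString inp → BitString out) : Prop :=
  ∀ x, C.prob (ket x) (g x) = 1

/-- On a qubit in any state `ψ` and a classical string `x`, the output qubits are exactly in the
pure state consisting of the qubit `U x ψ` and the classical string `g x`. -/
def QCircuit.ComputesOnQubit {𝒢 : GateSet} {k l : ℕ} (C : QCircuit 𝒢 (k + 1) (l + 1))
    (U : BitString k → Matrix.unitaryGroup Bool ℂ) (g : BitString k → BitString l) : Prop :=
  ∀ (x : BitString k) (ψ : Bool → ℂ),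
    C.outState (qubitKet ψ x) =
      Matrix.vecMulVec (qubitKet ((U x : Matrix Bool Bool ℂ).mulVec ψ) (g x))
        (star (qubitKet ((U x : Matrix Bool Bool ℂ).mulVec ψ) (g x)))

/-! ### Classical polynomial time: multi-stack machines with a step count -/

/-- Programs of a machine with `k` stacks over the alphabet `S`. The tests in `ite` and `loop` look
at the top symbol of a stack (`none` if it is empty). -/
inductive StackProgram (k : ℕ) (S : Type) : Type
  | push (i : Fin k) (s : S) : StackProgram k S
  | pop (i : Fin k) : StackProgram k S
  | move (i j : Fin k) : StackProgram k S
  | seq (p q : StackProgram k S) : StackProgram k S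
  | ite (i : Fin k) (t : Option S → Bool) (p q : StackProgram k S) : StackProgram k S
  | loop (i : Fin k) (t : Option S → Bool) (p : StackProgram k S) : StackProgram k S

/-- `P.Runs σ τ n`: started with the stacks `σ`, the program halts with the stacks `τ` after exactly
`n` elementary steps (a push, a pop, a move of a top symbol, or a test). Lists start at the top. -/
inductive StackProgram.Runs {k : ℕ} {S : Type} :
    StackProgram k S → (Fin k → List S) → (Fin k → List S) → ℕ → Prop
  | push (i : Fin k) (s : S) (σ : Fin k → List S) :
      Runs (.push i s) σ (Function.update σ i (s :: σ i)) 1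
  | pop (i : Fin k) (σ : Fin k → List S) :
      Runs (.pop i) σ (Function.update σ i (σ i).tail) 1
  | move_nil (i j : Fin k) (σ : Fin k → List S) (h : σ i = []) :
      Runs (.move i j) σ σ 1
  | move_cons (i j : Fin k) (σ τ : Fin k → List S) (s : S) (l : List S) (h : σ i = s :: l)
      (hτ : τ = Function.update σ i l) :
      Runs (.move i j) σ (Function.update τ j (s :: τ j)) 1
  | seq (p q : StackProgram k S) (σ τ υ : Fin k → List S) (m n : ℕ)
      (hp : Runs p σ τ m) (hq : Runs q τ υ n) : Runs (.seq p q) σ υ (m + n)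
  | ite_true (i : Fin k) (t : Option S → Bool) (p q : StackProgram k S) (σ τ : Fin k → List S)
      (n : ℕ) (h : t (σ i).head? = true) (hp : Runs p σ τ n) : Runs (.ite i t p q) σ τ (n + 1)
  | ite_false (i : Fin k) (t : Option S → Bool) (p q : StackProgram k S) (σ τ : Fin k → List S)
      (n : ℕ) (h : t (σ i).head? = false) (hq : Runs q σ τ n) : Runs (.ite i t p q) σ τ (n + 1)
  | loop_stop (i : Fin k) (t : Option S → Bool) (p : StackProgram k S) (σ : Fin k → List S)
      (h : t (σ i).head? = false) : Runs (.loop i t p) σ σ 1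
  | loop_step (i : Fin k) (t : Option S → Bool) (p : StackProgram k S)
      (σ τ υ : Fin k → List S) (m n : ℕ) (h : t (σ i).head? = true)
      (hp : Runs p σ τ m) (hl : Runs (.loop i t p) τ υ n) : Runs (.loop i t p) σ υ (m + n + 1)

/-- Some program, given `n` copies of `mark` on stack `0` (and nothing else), halts with `g n` on
stack `0` within a number of steps that is polynomial in `n`. -/
def PolyTimeFromUnary {S : Type} (mark : S) (g : ℕ → List S) : Prop :=
  ∃ (k : ℕ) (P : StackProgram (k + 1) S) (q : Polynomial ℕ), ∀ n : ℕ,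
    ∃ (τ : Fin (k + 1) → List S) (t : ℕ),
      P.Runs (fun i => if i = 0 then List.replicate n mark else []) τ t ∧
        τ 0 = g n ∧ t ≤ q.eval n

/-! ### Uniform families of quantum circuits -/

/-- The symbols in which circuits over `𝒢` are described. -/
inductive CircuitSymbol (𝒢 : GateSet) : Type
  | one (a : 𝒢.One) : CircuitSymbol 𝒢
  | two (b : 𝒢.Two) : CircuitSymbol 𝒢
  | tick : CircuitSymbol 𝒢
  | sep : CircuitSymbol 𝒢

/-- The description of a gate: its name, and the qubits it acts on, in unary. -/
def Gate.describe {𝒢 : GateSet} {m : ℕ} : Gate 𝒢 m → List (CircuitSymbol 𝒢)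
  | .one a i => .one a :: List.replicate i .tick
  | .two b i j _ => .two b :: (List.replicate i .tick ++ .sep :: List.replicate j .tick)

/-- The description of a circuit: the number of its qubits, in unary, and the list of its gates. -/
def QCircuit.describe {𝒢 : GateSet} {inp out : ℕ} (C : QCircuit 𝒢 inp out) :
    List (CircuitSymbol 𝒢) :=
  List.replicate C.width .tick ++ C.gates.flatMap Gate.describe

/-- A uniform family of circuits of polynomial size: the description of the `n`-th circuit is
written by a classical machine in time polynomial in `n`. As the description has at least as many
symbols as the circuit has qubits and gates, both numbers are polynomially bounded. -/
def IsUniformFamily {𝒢 : GateSet} {inp out : ℕ → ℕ} (C : ∀ n, QCircuit 𝒢 (inp n) (out n)) : Prop :=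
  PolyTimeFromUnary CircuitSymbol.tick fun n => (C n).describe

/-- A family of functions computed by a uniform family of quantum circuits of polynomial size. -/
def EfficientlyComputable (𝒢 : GateSet) {inp out : ℕ → ℕ}
    (g : ∀ n, BitString (inp n) → BitString (out n)) : Prop :=
  ∃ C : ∀ n, QCircuit 𝒢 (inp n) (out n), IsUniformFamily C ∧ ∀ n, (C n).Computes (g n)

/-- The same for operations on a qubit and a classical string. -/
def EfficientlyComputableOnQubit (𝒢 : GateSet) {k l : ℕ → ℕ}
    (U : ∀ n, BitString (k n) → Matrix.unitaryGroup Bool ℂ)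
    (g : ∀ n, BitString (k n) → BitString (l n)) : Prop :=
  ∃ C : ∀ n, QCircuit 𝒢 (k n + 1) (l n + 1), IsUniformFamily C ∧
    ∀ n, (C n).ComputesOnQubit (U n) (g n)

/-! ### Quantum one-way permutations -/

/-- There is no quantum circuit `C` of size at most `T` such that `Pr_a [C (f a) = a] ≥ δ`. -/
def HardToInvert {n : ℕ} (f : Equiv.Perm (BitString n)) (δ : ℝ) (T : ℕ) : Prop :=
  ¬ ∃ C : QCircuit allGates n n, C.size ≤ T ∧ δ ≤ uniformAvg fun a => C.prob (ket (f a)) a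

/-- Quantum one-way permutations. -/
structure IsQuantumOneWayPermutation (𝒢 : GateSet) (f : ∀ n, Equiv.Perm (BitString n)) : Prop where
  easy : EfficientlyComputable 𝒢 fun n => (f n : BitString n → BitString n)
  hard : ∀ c d : ℕ, ∀ᶠ n : ℕ in atTop, HardToInvert (f n) (1 / (n : ℝ) ^ c) (n ^ d)

/-! ### Bit commitment -/

/-- Bit commitment schemes with one message from Alice to Bob in each phase. Alice commits to `z`,
using uniformly random bits `r`, by sending `commit n z r`, and decommits by sending
`opening n z r`. Given the commitment and an opening, Bob accepts if `accept` holds, and then takes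
`value` as the bit. -/
structure BitCommitment where
  randLen : ℕ → ℕ
  comLen : ℕ → ℕ
  openLen : ℕ → ℕ
  commit : ∀ n, Bool → BitString (randLen n) → BitString (comLen n)
  opening : ∀ n, Bool → BitString (randLen n) → BitString (openLen n)
  accept : ∀ n, BitString (comLen n) → BitString (openLen n) → Bool
  value : ∀ n, BitString (comLen n) → BitString (openLen n) → Bool

namespace BitCommitment

/-- If both parties are honest, then Bob accepts and obtains the committed bit. -/
def IsCorrect (S : BitCommitment) : Prop :=
  ∀ n z r, S.accept n (S.commit n z r) (S.opening n z r) = true ∧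
    S.value n (S.commit n z r) (S.opening n z r) = z

/-- The honest parties run uniform families of quantum circuits of polynomial size. -/
def IsEfficient (S : BitCommitment) (𝒢 : GateSet) : Prop :=
  EfficientlyComputable 𝒢 (inp := fun n => S.randLen n + 1) (out := S.comLen)
      (fun n w => S.commit n (w.snd 0) w.fst) ∧
    EfficientlyComputable 𝒢 (inp := fun n => S.randLen n + 1) (out := S.openLen)
      (fun n w => S.opening n (w.snd 0) w.fst) ∧
    EfficientlyComputable 𝒢 (inp := fun n => S.comLen n + S.openLen n) (out := fun _ => 2)
      (fun n w => ![S.accept n w.fst w.snd, S.value n w.fst w.snd])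

/-- No commitment whatsoever can be opened to two different bits. -/
def IsPerfectlyBinding (S : BitCommitment) : Prop :=
  ∀ n com o o', S.accept n com o = true → S.accept n com o' = true →
    S.value n com o = S.value n com o'

/-- No circuit of polynomial size predicts a random committed bit from its commitment with
probability `1/2 + 1/poly`. -/
def IsComputationallyConcealing (S : BitCommitment) : Prop :=
  ∀ c d : ℕ, ∀ᶠ n : ℕ in atTop, ¬ ∃ C : QCircuit allGates (S.comLen n) 1, C.size ≤ n ^ d ∧
    1 / 2 + 1 / (n : ℝ) ^ c ≤
      (∑ z : Bool, uniformAvg fun r => C.prob (ket (S.commit n z r)) ![z]) / 2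

end BitCommitment

/-- The commitment to `z`, with random `a` and `x`, is `(f a, x, z ⊕ a · x)`; it is opened by
sending `a`. -/
def glBitCommitment (f : ∀ n, Equiv.Perm (BitString n)) : BitCommitment where
  randLen n := n + n
  comLen n := n + n + 1
  openLen n := n
  commit n z r :=
    Fin.append (Fin.append (f n r.fst) r.snd) ![xor z (innerMod2 r.fst r.snd)]
  opening _ _ r := r.fst
  accept n com a := decide (f n a = com.fst.fst)
  value _ com a := xor (com.snd 0) (innerMod2 a com.fst.snd)

/-! ### Qubit commitment -/

/-- Qubit commitment schemes with one message from Alice to Bob in each phase, in which all but the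
committed qubit is classical. To commit to a qubit in the state `ψ`, using uniformly random bits
`r`, Alice sends the qubit `enc n r ψ` and the classical string `commit n r`; she decommits by
sending `opening n r`. Given the commitment and an opening, Bob accepts if `accept` holds, and then
applies `dec` to the qubit he was sent. -/
structure QubitCommitment where
  randLen : ℕ → ℕ
  comLen : ℕ → ℕ
  openLen : ℕ → ℕ
  enc : ∀ n, BitString (randLen n) → Matrix.unitaryGroup Bool ℂ
  commit : ∀ n, BitString (randLen n) → BitString (comLen n)
  opening : ∀ n, BitString (randLen n) → BitString (openLen n)
  accept : ∀ n, BitString (comLen n) → BitString (openLen n) → Bool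
  dec : ∀ n, BitString (comLen n) → BitString (openLen n) → Matrix.unitaryGroup Bool ℂ

namespace QubitCommitment

/-- If both parties are honest, then Bob accepts and obtains the committed qubit. -/
def IsCorrect (S : QubitCommitment) : Prop :=
  ∀ n r, S.accept n (S.commit n r) (S.opening n r) = true ∧
    S.dec n (S.commit n r) (S.opening n r) * S.enc n r = 1

/-- The honest parties run uniform families of quantum circuits of polynomial size. -/
def IsEfficient (S : QubitCommitment) (𝒢 : GateSet) : Prop :=
  EfficientlyComputableOnQubit 𝒢 (k := S.randLen) (l := S.comLen) S.enc S.commit ∧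
    EfficientlyComputable 𝒢 (inp := S.randLen) (out := S.openLen) S.opening ∧
    EfficientlyComputableOnQubit 𝒢 (k := fun n => S.comLen n + S.openLen n) (l := fun _ => 1)
      (fun n w => S.dec n w.fst w.snd) (fun n w => ![S.accept n w.fst w.snd])

/-- Whatever was sent in the commitment phase, all openings that Bob accepts make him apply the same
operation to the qubit he holds; so the qubit he obtains is determined in the commitment phase. -/
def IsPerfectlyBinding (S : QubitCommitment) : Prop :=
  ∀ n com o o', S.accept n com o = true → S.accept n com o' = true →
    S.dec n com o = S.dec n com o'

/-- Whatever the committed state `ψ`, no circuit of polynomial size distinguishes, with advantage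
`1/poly`, what Bob receives in the commitment phase from the same data with the qubit replaced by
one in the totally mixed state (a uniformly random basis state). -/
def IsComputationallyConcealing (S : QubitCommitment) : Prop :=
  ∀ c d : ℕ, ∀ᶠ n : ℕ in atTop, ∀ ψ : Bool → ℂ, ∑ b, ‖ψ b‖ ^ 2 = 1 →
    ¬ ∃ C : QCircuit allGates (S.comLen n + 1) 1, C.size ≤ n ^ d ∧
      1 / (n : ℝ) ^ c ≤
        |(uniformAvg fun r =>
            C.prob (qubitKet ((S.enc n r : Matrix Bool Bool ℂ).mulVec ψ) (S.commit n r)) ![true]) -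
          uniformAvg fun r =>
            (∑ b : Bool, C.prob (qubitKet (Pi.single b 1) (S.commit n r)) ![true]) / 2|

end QubitCommitment

/-- The Pauli matrix `X`. -/
def pauliX : Matrix.unitaryGroup Bool ℂ :=
  ⟨Matrix.of fun x y => if x = y then 0 else 1, by
    rw [Matrix.mem_unitaryGroup_iff]
    ext x y
    cases x <;> cases y <;> simp [Matrix.mul_apply, Matrix.star_apply]⟩

/-- The Pauli matrix `Z`. -/
def pauliZ : Matrix.unitaryGroup Bool ℂ :=
  ⟨Matrix.diagonal fun x => if x then -1 else 1, by
    rw [Matrix.mem_unitaryGroup_iff]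
    ext x y
    cases x <;> cases y <;> simp [Matrix.mul_apply, Matrix.star_apply, Matrix.diagonal]⟩

/-- With random `((a₁, a₂), (x₁, x₂))`, the commitment to `ψ` consists of the qubit
`X ^ (a₁ · x₁) Z ^ (a₂ · x₂) ψ` and of `((f a₁, f a₂), (x₁, x₂))`; it is opened by sending
`(a₁, a₂)`. -/
def glQubitCommitment (f : ∀ n, Equiv.Perm (BitString n)) : QubitCommitment where
  randLen n := (n + n) + (n + n)
  comLen n := (n + n) + (n + n)
  openLen n := n + n
  enc _ r :=
    pauliX ^ (innerMod2 r.fst.fst r.snd.fst).toNat * pauliZ ^ (innerMod2 r.fst.snd r.snd.snd).toNat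
  commit n r := Fin.append (Fin.append (f n r.fst.fst) (f n r.fst.snd)) r.snd
  opening _ r := r.fst
  accept n com o := decide (f n o.fst = com.fst.fst ∧ f n o.snd = com.fst.snd)
  dec _ com o :=
    pauliZ ^ (innerMod2 o.snd com.snd.snd).toNat * pauliX ^ (innerMod2 o.fst com.snd.fst).toNat

end

/-! Correctness and binding are immediate: `X` and `Z` are involutions, and since `f n` is injective
at most one opening is accepted.

Concealment rests on the quantum Goldreich–Levin reduction `exists_circuit_bias_sq_le_prob`. Let L
be a circuit with inputs b and x, and let β(b, x) be the mean of (-1)^output. Prepare a uniform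
superposition of all x, run L on a copy of x, apply Z to the output qubit, and undo everything. The
amplitude with which a appears in the register of x, all else being restored, is the average over x
of (-1)^(a·x) β(b, x). So a is found from b with probability at least the square of this average,
whatever garbage L produces. With b = f(a), convexity of the square turns a correlation δ into an
inversion probability δ². This is `abs_avg_bias_lt`: the bias of a small circuit has correlation
less than δ with (-1)^(a·x), even if the rest of its input is fixed arbitrarily, because those bits
can be hard-wired by negations.

For the bit, fix the masked bit c. Guessing z = c ⊕ a·x means guessing a·x, so the advantage is a
signed combination of two such correlations. For the qubit, the totally mixed state is the average
of the four states X^c Z^d ψ (`sum_prob_pauliState`). The true pair of exponents is compared with a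
random pair in two moves: first the exponent of X is randomized, then that of Z. The difference
becomes a combination of six correlations whose coefficients have absolute values adding up to 1.
The state X^c Z^d ψ costs one gate of the adversary.

Efficiency asks for exact circuits over the given gate set. Toffoli, CCZ, negation and exchange are
exact words in H, T and CNOT (`CliffordT.actAll_ccz`), and around a circuit for f they suffice for
all parties. Since a given circuit may leave arbitrary garbage, only supports of states are tracked
(`Triple`); by `QCircuit.computes_iff` this is all that certainty of the output requires. On a
committed qubit the Pauli operators act before the classical part, which then runs on disjoint
wires, so the garbage factors off.

Uniformity is proved for an explicit stack machine. The new circuits are given by finite symbolic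
lists of parts, whose gates sit at positions linear in the size, the width of the given circuit and
a loop counter. `PolyTimeFromUnary.stages` runs the given machine and prints from its output the
description of the new circuit. -/

noncomputable section

open StackProgram.Runs (loop_stop)

/-! ### Restriction and padding of bit strings -/

/-- The first `m` bits of a sequence of bits. -/
def takeBits (m : ℕ) (x : ℕ → Bool) : BitString m := fun i => x i

/-- A bit string, followed by zeros. -/
def padBits {m : ℕ} (y : BitString m) : ℕ → Bool := fun i => if h : i < m then y ⟨i, h⟩ else false

/-- The sequence `z` with the `m` bits from position `s` on replaced by `y`. -/
def glueBits {m : ℕ} (s : ℕ) (z : ℕ → Bool) (y : BitString m) : ℕ → Bool :=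
  fun i => if h : s ≤ i ∧ i - s < m then y ⟨i - s, h.2⟩ else z i

/-- The `m` bits from position `s` on. -/
def sliceBits (m s : ℕ) (z : ℕ → Bool) : BitString m := fun i => z (s + i)

theorem takeBits_padBits {m : ℕ} (y : BitString m) : takeBits m (padBits y) = y := by
  funext i; simp [takeBits, padBits]

theorem padBits_of_lt {m : ℕ} (y : BitString m) {i : ℕ} (h : i < m) : padBits y i = y ⟨i, h⟩ := by
  simp [padBits, h]

theorem padBits_of_le {m : ℕ} (y : BitString m) {i : ℕ} (h : m ≤ i) : padBits y i = false := by
  simp [padBits, Nat.not_lt.2 h]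

theorem glueBits_sliceBits (m s : ℕ) (z : ℕ → Bool) : glueBits s z (sliceBits m s z) = z := by
  funext i
  unfold glueBits sliceBits
  split_ifs with h
  · congr 1
    simp only
    omega
  · rfl

theorem sliceBits_glueBits {m : ℕ} (s : ℕ) (z : ℕ → Bool) (y : BitString m) :
    sliceBits m s (glueBits s z y) = y := by
  funext i
  simp [glueBits, sliceBits]

theorem glueBits_of_lt {m : ℕ} {s i : ℕ} (z : ℕ → Bool) (y : BitString m) (h : i < s) :
    glueBits s z y i = z i := by
  unfold glueBits
  rw [dif_neg (by omega)]

theorem glueBits_of_ge {m : ℕ} {s i : ℕ} (z : ℕ → Bool) (y : BitString m) (h : s + m ≤ i) :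
    glueBits s z y i = z i := by
  unfold glueBits
  rw [dif_neg (by omega)]

theorem glueBits_add {m : ℕ} (s : ℕ) (z : ℕ → Bool) (y : BitString m) {i : ℕ} (h : i < m) :
    glueBits s z y (s + i) = y ⟨i, h⟩ := by
  unfold glueBits
  rw [dif_pos (by omega)]
  congr 1
  simp

theorem glueBits_update {m : ℕ} (s : ℕ) (z : ℕ → Bool) (y : BitString m) (i : Fin m) (b : Bool) :
    glueBits s z (Function.update y i b) = Function.update (glueBits s z y) (s + i) b := by
  funext j
  by_cases hj : j = s + i
  · subst hj
    simp [glueBits]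
  · rw [Function.update_of_ne hj]
    unfold glueBits
    split_ifs with h
    · rw [Function.update_of_ne]
      intro e
      apply hj
      have := congrArg Fin.val e
      simp only at this
      omega
    · rfl

theorem takeBits_update (m : ℕ) (x : ℕ → Bool) (i : Fin m) (b : Bool) :
    takeBits m (Function.update x i b) = Function.update (takeBits m x) i b := by
  funext j
  by_cases hj : j = i
  · subst hj; simp [takeBits]
  · have : (j : ℕ) ≠ i := fun e => hj (Fin.ext e)
    simp [takeBits, Function.update_of_ne hj, Function.update_of_ne this]

/-- Splitting a string into its first `k` bits and the others. -/
def joinEquiv {k m : ℕ} (h : k ≤ m) : BitString k × BitString (m - k) ≃ BitString m where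
  toFun p := joinBits p.1 p.2
  invFun z := (fun i => z (Fin.castLE h i), fun i => z ⟨k + i, by omega⟩)
  left_inv p := by
    ext i
    · simp [joinBits]
    · simp [joinBits]
  right_inv z := by
    funext i
    simp only [joinBits]
    split_ifs with hi
    · rfl
    · congr 1
      ext
      simp only
      omega

theorem joinBits_castLE {k m : ℕ} (h : k ≤ m) (y : BitString k) (w : BitString (m - k)) :
    (fun i => joinBits y w (Fin.castLE h i)) = y :=
  congrArg Prod.fst ((joinEquiv h).left_inv (y, w))

theorem sum_joinBits {M : Type*} [AddCommMonoid M] {k m : ℕ} (h : k ≤ m) (F : BitString m → M) :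
    ∑ y : BitString k, ∑ w : BitString (m - k), F (joinBits y w) = ∑ z, F z := by
  rw [← (joinEquiv h).sum_comp, Fintype.sum_prod_type]
  rfl

/-! ### Gates preserve inner products -/

/-- For each `z` the two updates are `z` itself and `z` with bit `i` flipped, and flipping is a
bijection. This allows a sum over all strings to be grouped into the pairs on which a one-qubit gate
acts. -/
theorem sum_sum_update {m : ℕ} {M : Type*} [AddCommMonoid M] (i : Fin m) (F : BitString m → M) :
    ∑ z : BitString m, ∑ b : Bool, F (Function.update z i b) = 2 • ∑ z, F z := by
  have hflip : ∑ z : BitString m, F (Function.update z i (!z i)) = ∑ z, F z := by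
    have hinv : Function.Involutive fun z : BitString m => Function.update z i (!z i) := by
      intro z; simp
    exact Equiv.sum_comp hinv.toPerm F
  rw [two_nsmul]
  nth_rewrite 2 [← hflip]
  rw [← Finset.sum_add_distrib]
  refine Finset.sum_congr rfl fun z _ => ?_
  cases hz : z i
  · rw [Fintype.sum_bool, add_comm, ← hz, Function.update_eq_self, hz]; rfl
  · rw [Fintype.sum_bool, ← hz, Function.update_eq_self, hz]; rfl

theorem unitary_inner {ι : Type} [Fintype ι] [DecidableEq ι] (U : Matrix.unitaryGroup ι ℂ)
    (u v : ι → ℂ) :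
    ∑ p, star (∑ q, (U : Matrix ι ι ℂ) p q * u q) * (∑ q, (U : Matrix ι ι ℂ) p q * v q) =
      ∑ q, star (u q) * v q := by
  have h : star (U : Matrix ι ι ℂ) * (U : Matrix ι ι ℂ) = 1 := Matrix.mem_unitaryGroup_iff'.1 U.2
  have key : dotProduct (star ((U : Matrix ι ι ℂ).mulVec u)) ((U : Matrix ι ι ℂ).mulVec v) =
      dotProduct (star u) v := by
    rw [Matrix.star_mulVec, Matrix.dotProduct_mulVec, Matrix.vecMul_vecMul,
      ← Matrix.star_eq_conjTranspose, h, Matrix.vecMul_one]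
  exact key

/-- After multiplication by 2 or 4 both sides become sums over blocks of amplitudes that differ only
at the qubits of the gate; on each block the claim is `unitary_inner`. -/
theorem Gate.inner_apply {𝒢 : GateSet} {m : ℕ} (g : Gate 𝒢 m) (ψ φ : QState m) :
    ∑ z, star (g.apply ψ z) * g.apply φ z = ∑ z, star (ψ z) * φ z := by
  cases g with
  | one a i =>
    have h2 : (2 : ℂ) ≠ 0 := two_ne_zero
    apply mul_left_cancel₀ h2
    have e := sum_sum_update i fun z => star ((Gate.one a i).apply ψ z) * (Gate.one a i).apply φ z
    have e' := sum_sum_update i fun z => star (ψ z) * φ z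
    rw [two_nsmul, ← two_mul] at e e'
    rw [← e, ← e']
    refine Finset.sum_congr rfl fun z _ => ?_
    refine Eq.trans ?_ (unitary_inner (𝒢.one a) (fun b => ψ (Function.update z i b))
      fun b => φ (Function.update z i b))
    simp only [Gate.apply, Function.update_self, Function.update_idem]
  | two a i j hij =>
    have h2 : (2 : ℂ) ≠ 0 := two_ne_zero
    have four (F : BitString m → ℂ) : ∑ z, ∑ p : Bool × Bool,
        F (Function.update (Function.update z i p.1) j p.2) = 2 * (2 * ∑ z, F z) := by
      have e := sum_sum_update i fun z => ∑ c, F (Function.update z j c)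
      have e' := sum_sum_update j F
      rw [two_nsmul, ← two_mul] at e e'
      rw [← e', ← e]
      simp [Fintype.sum_prod_type]
    apply mul_left_cancel₀ h2
    apply mul_left_cancel₀ h2
    rw [← four, ← four]
    refine Finset.sum_congr rfl fun z _ => ?_
    refine Eq.trans ?_ (unitary_inner (𝒢.two a)
      (fun p => ψ (Function.update (Function.update z i p.1) j p.2))
      fun p => φ (Function.update (Function.update z i p.1) j p.2))
    refine Finset.sum_congr rfl fun p _ => ?_
    have hu (b c : Bool) : Function.update (Function.update (Function.update (Function.update z i p.1)
        j p.2) i b) j c = Function.update (Function.update z i b) j c := by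
      funext k
      simp only [Function.update_apply]
      split_ifs <;> rfl
    have hi : Function.update (Function.update z i p.1) j p.2 i = p.1 := by simp [hij]
    simp only [Gate.apply, Fintype.sum_prod_type, hu, hi, Function.update_self]

/-- The action of a list of gates. -/
def runGates {𝒢 : GateSet} {m : ℕ} (l : List (Gate 𝒢 m)) (ψ : QState m) : QState m :=
  l.foldl (fun ψ g => g.apply ψ) ψ

theorem inner_runGates {𝒢 : GateSet} {m : ℕ} (l : List (Gate 𝒢 m)) (ψ φ : QState m) :
    ∑ z, star (runGates l ψ z) * runGates l φ z = ∑ z, star (ψ z) * φ z := by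
  induction l generalizing ψ φ with
  | nil => rfl
  | cons g l ih => exact (ih _ _).trans (g.inner_apply ψ φ)

theorem normSq_runGates {𝒢 : GateSet} {m : ℕ} (l : List (Gate 𝒢 m)) (ψ : QState m) :
    ∑ z, ‖runGates l ψ z‖ ^ 2 = ∑ z, ‖ψ z‖ ^ 2 := by
  have h := inner_runGates l ψ ψ
  have e (x : ℂ) : star x * x = ((‖x‖ ^ 2 : ℝ) : ℂ) := by
    rw [Complex.star_def, Complex.conj_mul']
    push_cast
    rfl
  simp only [e] at h
  exact_mod_cast h

theorem Gate.apply_sum {𝒢 : GateSet} {m : ℕ} (g : Gate 𝒢 m) {ι : Type*} (s : Finset ι) (c : ι → ℂ)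
    (ψ : ι → QState m) :
    g.apply (fun z => ∑ k ∈ s, c k * ψ k z) = fun z => ∑ k ∈ s, c k * g.apply (ψ k) z := by
  cases g with
  | one a i =>
    funext z
    simp only [Gate.apply, Finset.mul_sum]
    rw [Finset.sum_comm]
    refine Finset.sum_congr rfl fun k _ => Finset.sum_congr rfl fun b _ => by ring
  | two a i j hij =>
    funext z
    simp only [Gate.apply, Finset.mul_sum, Finset.sum_comm (s := Finset.univ (α := Bool)) (t := s)]
    refine Finset.sum_congr rfl fun k _ => Finset.sum_congr rfl fun b _ =>
      Finset.sum_congr rfl fun b' _ => by ring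

theorem runGates_sum {𝒢 : GateSet} {m : ℕ} (l : List (Gate 𝒢 m)) {ι : Type*} (s : Finset ι)
    (c : ι → ℂ) (ψ : ι → QState m) :
    runGates l (fun z => ∑ k ∈ s, c k * ψ k z) = fun z => ∑ k ∈ s, c k * runGates l (ψ k) z := by
  induction l generalizing ψ with
  | nil => rfl
  | cons g l ih =>
    change runGates l (g.apply _) = _
    rw [g.apply_sum, ih]
    rfl

theorem runGates_mul {𝒢 : GateSet} {m : ℕ} (l : List (Gate 𝒢 m)) (c : ℂ) (ψ : QState m) :
    runGates l (fun z => c * ψ z) = fun z => c * runGates l ψ z := by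
  simpa using runGates_sum l {()} (fun _ => c) (fun _ => ψ)

/-! ### Norms and measurement probabilities of circuits -/

namespace QCircuit

variable {𝒢 : GateSet} {inp out : ℕ} (C : QCircuit 𝒢 inp out)

theorem final_eq (φ : QState inp) : C.final φ = runGates C.gates (C.initial φ) := rfl

theorem normSq_initial (φ : QState inp) : ∑ z, ‖C.initial φ z‖ ^ 2 = ∑ y, ‖φ y‖ ^ 2 := by
  rw [← sum_joinBits C.inp_le]
  refine Finset.sum_congr rfl fun y _ => ?_
  rw [Finset.sum_eq_single (fun _ => false)]
  · rw [initial, if_pos, joinBits_castLE C.inp_le]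
    intro i hi
    simp [joinBits, Nat.not_lt.2 hi]
  · intro w _ hw
    rw [initial, if_neg]
    · simp
    · intro h
      apply hw
      funext i
      have := h ⟨inp + i, by omega⟩ (by simp)
      simpa [joinBits] using this
  · simp

theorem normSq_final (φ : QState inp) : ∑ z, ‖C.final φ z‖ ^ 2 = ∑ y, ‖φ y‖ ^ 2 := by
  rw [final_eq, normSq_runGates, normSq_initial]

theorem normSq_ket {k : ℕ} (x : BitString k) : ∑ y, ‖ket x y‖ ^ 2 = (1 : ℝ) := by
  rw [Finset.sum_eq_single x]
  · simp [ket]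
  · intro y _ hy; simp [ket, hy]
  · simp

theorem sum_prob (φ : QState inp) : ∑ y, C.prob φ y = ∑ y, ‖φ y‖ ^ 2 := by
  rw [← C.normSq_final, ← sum_joinBits C.out_le]
  rfl

theorem prob_nonneg (φ : QState inp) (y : BitString out) : 0 ≤ C.prob φ y :=
  Finset.sum_nonneg fun _ _ => by positivity

/-- The probabilities of the outputs are nonnegative and add up to 1, so certainty of one output
means that every amplitude with another output vanishes. In this form exact computation is a
statement about supports and composes without any norms. -/
theorem computes_iff (g : BitString inp → BitString out) :
    C.Computes g ↔
      ∀ x z, C.final (ket x) z ≠ 0 → (fun i => z (Fin.castLE C.out_le i)) = g x := by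
  refine forall_congr' fun x => ?_
  have hs := C.sum_prob (ket x)
  rw [normSq_ket] at hs
  rw [← Finset.add_sum_erase _ _ (Finset.mem_univ (g x))] at hs
  constructor
  · intro h z hz
    by_contra hne
    rw [h, add_eq_left, Finset.sum_eq_zero_iff_of_nonneg fun _ _ => C.prob_nonneg _ _] at hs
    have h0 := hs _ (Finset.mem_erase.2 ⟨hne, Finset.mem_univ _⟩)
    rw [prob, Finset.sum_eq_zero_iff_of_nonneg fun _ _ => by positivity] at h0
    have h1 := h0 ((joinEquiv C.out_le).symm z).2 (Finset.mem_univ _)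
    have e : joinBits (fun i => z (Fin.castLE C.out_le i)) ((joinEquiv C.out_le).symm z).2 = z :=
      (joinEquiv C.out_le).right_inv z
    rw [e] at h1
    exact hz (by simpa using h1)
  · intro h
    rw [← hs, left_eq_add]
    refine Finset.sum_eq_zero fun y hy => Finset.sum_eq_zero fun w _ => ?_
    by_contra hne
    have := h (joinBits y w) (by intro h0; simp [h0] at hne)
    rw [joinBits_castLE] at this
    exact (Finset.mem_erase.1 hy).1 this

end QCircuit

/-! ### Gates on an infinite row of qubits -/

/-- Gates on qubits that are labelled by elements of `P`. -/
inductive PGate (𝒢 : GateSet) (P : Type) : Type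
  | one (a : 𝒢.One) (i : P) : PGate 𝒢 P
  | two (b : 𝒢.Two) (i j : P) : PGate 𝒢 P

namespace PGate

variable {𝒢 : GateSet} {P Q : Type}

/-- Relabelling the qubits. -/
def map (e : P → Q) : PGate 𝒢 P → PGate 𝒢 Q
  | one a i => one a (e i)
  | two b i j => two b (e i) (e j)

/-- The action on amplitudes of infinite sequences of bits. -/
def act : PGate 𝒢 ℕ → ((ℕ → Bool) → ℂ) → (ℕ → Bool) → ℂ
  | one a i, Ψ => fun x =>
      ∑ b : Bool, (𝒢.one a : Matrix Bool Bool ℂ) (x i) b * Ψ (Function.update x i b)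
  | two g i j, Ψ => fun x =>
      ∑ b : Bool, ∑ c : Bool,
        (𝒢.two g : Matrix (Bool × Bool) (Bool × Bool) ℂ) (x i, x j) (b, c) *
          Ψ (Function.update (Function.update x i b) j c)

/-- The gate acts on the first `m` qubits. -/
def Valid (m : ℕ) : PGate 𝒢 ℕ → Prop
  | one _ i => i < m
  | two _ i j => i < m ∧ j < m ∧ i ≠ j

/-- The gate as a gate on `m` qubits. -/
def toGate (m : ℕ) : (g : PGate 𝒢 ℕ) → g.Valid m → Gate 𝒢 m
  | one a i, h => .one a ⟨i, h⟩
  | two b i j, h => .two b ⟨i, h.1⟩ ⟨j, h.2.1⟩ (by simpa using h.2.2)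

end PGate

/-- The action of a list of gates on amplitudes of infinite sequences of bits. -/
def actAll {𝒢 : GateSet} (l : List (PGate 𝒢 ℕ)) (Ψ : (ℕ → Bool) → ℂ) : (ℕ → Bool) → ℂ :=
  l.foldl (fun Ψ g => g.act Ψ) Ψ

section actAll
variable {𝒢 : GateSet}

@[simp] theorem actAll_nil (Ψ : (ℕ → Bool) → ℂ) : actAll ([] : List (PGate 𝒢 ℕ)) Ψ = Ψ := rfl

theorem actAll_cons (g : PGate 𝒢 ℕ) (l : List (PGate 𝒢 ℕ)) (Ψ : (ℕ → Bool) → ℂ) :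
    actAll (g :: l) Ψ = actAll l (g.act Ψ) := rfl

theorem actAll_append (l l' : List (PGate 𝒢 ℕ)) (Ψ : (ℕ → Bool) → ℂ) :
    actAll (l ++ l') Ψ = actAll l' (actAll l Ψ) := by
  simp [actAll, List.foldl_append]

/-- On infinite rows positions are plain natural numbers, so circuits can be concatenated and
shifted without casts between finite types. This translates the result back to `m` qubits. -/
theorem runGates_toGate {m : ℕ} (l : List (PGate 𝒢 ℕ)) (hl : ∀ g ∈ l, g.Valid m) (ψ : QState m)
    (x : ℕ → Bool) :
    runGates (l.pmap (PGate.toGate m) hl) ψ (takeBits m x) =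
      actAll l (fun x => ψ (takeBits m x)) x := by
  induction l generalizing ψ with
  | nil => rfl
  | cons g l ih =>
    have e : (fun x => (g.toGate m (hl g (by simp))).apply ψ (takeBits m x)) =
        g.act fun x => ψ (takeBits m x) := by
      funext x
      cases g with
      | one a i =>
        simp only [PGate.toGate, Gate.apply, PGate.act, ← takeBits_update]
        rfl
      | two a i j =>
        simp only [PGate.toGate, Gate.apply, PGate.act, ← takeBits_update]
        rfl
    rw [actAll_cons, ← e, ← ih]
    rfl
end actAll

/-- The gate acting on qubits shifted by `s`. -/
def Gate.wire {𝒢 : GateSet} {m : ℕ} (s : ℕ) : Gate 𝒢 m → PGate 𝒢 ℕ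
  | .one a i => .one a (s + i)
  | .two b i j _ => .two b (s + i) (s + j)

theorem Gate.valid_wire {𝒢 : GateSet} {m : ℕ} (s M : ℕ) (h : s + m ≤ M) (g : Gate 𝒢 m) :
    (g.wire s).Valid M := by
  cases g with
  | one a i => exact lt_of_lt_of_le (by simp) h
  | two b i j hij =>
    refine ⟨lt_of_lt_of_le (by simp) h, lt_of_lt_of_le (by simp) h, ?_⟩
    intro e
    exact hij (Fin.ext (Nat.add_left_cancel e))

/-- The bits of `z` outside the block are spectators: for each fixed `z` the shifted gates act on
the slice of `Ψ` as they would on `m` qubits alone. -/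
theorem actAll_wire {𝒢 : GateSet} {m : ℕ} (s : ℕ) (l : List (Gate 𝒢 m)) (Ψ : (ℕ → Bool) → ℂ)
    (z : ℕ → Bool) (y : BitString m) :
    actAll (l.map (Gate.wire s)) Ψ (glueBits s z y) =
      runGates l (fun y => Ψ (glueBits s z y)) y := by
  induction l generalizing Ψ with
  | nil => rfl
  | cons g l ih =>
    rw [List.map_cons, actAll_cons, ih]
    have hv (i : Fin m) (y : BitString m) : glueBits s z y (s + i) = y i :=
      congrFun (sliceBits_glueBits s z y) i
    have e : (fun y => (g.wire s).act Ψ (glueBits s z y)) =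
        g.apply fun y => Ψ (glueBits s z y) := by
      funext y
      cases g with
      | one a i => simp only [Gate.wire, PGate.act, Gate.apply, glueBits_update, hv]
      | two a i j hij => simp only [Gate.wire, PGate.act, Gate.apply, glueBits_update, hv]
    rw [e]
    rfl

/-- The circuit on `width` qubits with the given gates. -/
def QCircuit.ofWires {𝒢 : GateSet} {inp out : ℕ} (width : ℕ) (inp_le : inp ≤ width)
    (out_le : out ≤ width) (l : List (PGate 𝒢 ℕ)) (hl : ∀ g ∈ l, g.Valid width) :
    QCircuit 𝒢 inp out where
  width := width
  inp_le := inp_le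
  out_le := out_le
  gates := l.pmap (PGate.toGate width) hl

theorem QCircuit.initial_takeBits {𝒢 : GateSet} {inp out : ℕ} (C : QCircuit 𝒢 inp out)
    (φ : QState inp) (x : ℕ → Bool) :
    C.initial φ (takeBits C.width x) =
      if ∀ i, inp ≤ i → i < C.width → x i = false then φ (takeBits inp x) else 0 := by
  unfold initial
  congr 1
  exact propext ⟨fun h i hi hw => h ⟨i, hw⟩ hi, fun h i hi => h i hi i.2⟩

theorem QCircuit.initial_ket_takeBits {𝒢 : GateSet} {inp out : ℕ} (C : QCircuit 𝒢 inp out)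
    (v : BitString inp) (x : ℕ → Bool) [Decidable (∀ i < C.width, x i = padBits v i)] :
    C.initial (ket v) (takeBits C.width x) = if ∀ i < C.width, x i = padBits v i then 1 else 0 := by
  rw [initial_takeBits]
  by_cases h : ∀ i < C.width, x i = padBits v i
  · rw [if_pos h, if_pos]
    · have : takeBits inp x = v := by
        funext i
        have := h i (lt_of_lt_of_le i.2 C.inp_le)
        rw [padBits_of_lt v i.2] at this
        exact this
      simp [this, ket]
    · intro i hi hw
      rw [h i hw, padBits_of_le v hi]
  · rw [if_neg h]
    split_ifs with h'
    · have : takeBits inp x ≠ v := by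
        intro e
        apply h
        intro i hi
        by_cases hk : i < inp
        · rw [padBits_of_lt v hk, ← e]; rfl
        · rw [padBits_of_le v (not_lt.1 hk), h' i (not_lt.1 hk) hi]
      simp [ket, this]
    · rfl

theorem QCircuit.final_ofWires {𝒢 : GateSet} {inp out : ℕ} (W : ℕ) (h₁ : inp ≤ W) (h₂ : out ≤ W)
    (l : List (PGate 𝒢 ℕ)) (hl : ∀ g ∈ l, g.Valid W) (φ : QState inp) (x : ℕ → Bool) :
    (ofWires W h₁ h₂ l hl).final φ (takeBits W x) =
      actAll l (fun x => (ofWires W h₁ h₂ l hl : QCircuit 𝒢 inp out).initial φ (takeBits W x)) x :=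
  runGates_toGate l hl _ x

/-! ### Supports -/

/-- The gates `l` take states supported in `A` to states supported in `B`. -/
def Triple {𝒢 : GateSet} (A : (ℕ → Bool) → Prop) (l : List (PGate 𝒢 ℕ)) (B : (ℕ → Bool) → Prop) :
    Prop :=
  ∀ Ψ : (ℕ → Bool) → ℂ, (∀ z, Ψ z ≠ 0 → A z) → ∀ z, actAll l Ψ z ≠ 0 → B z

theorem Triple.append {𝒢 : GateSet} {A B D : (ℕ → Bool) → Prop} {l l' : List (PGate 𝒢 ℕ)}
    (h : Triple A l B) (h' : Triple B l' D) : Triple A (l ++ l') D := by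
  intro Ψ hΨ
  rw [actAll_append]
  exact h' _ (h Ψ hΨ)

theorem Triple.weaken {𝒢 : GateSet} {A B D : (ℕ → Bool) → Prop} {l : List (PGate 𝒢 ℕ)}
    (h : Triple A l B) (h' : ∀ z, B z → D z) : Triple A l D :=
  fun Ψ hΨ z hz => h' z (h Ψ hΨ z hz)

/-- The gates `l` act on basis states as the bijection `F`. -/
def Realizes {𝒢 : GateSet} (l : List (PGate 𝒢 ℕ)) (F : (ℕ → Bool) → ℕ → Bool) : Prop :=
  ∃ G : (ℕ → Bool) → ℕ → Bool, (∀ z, F (G z) = z) ∧ ∀ Ψ z, actAll l Ψ z = Ψ (G z)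

theorem Realizes.nil {𝒢 : GateSet} : Realizes ([] : List (PGate 𝒢 ℕ)) id :=
  ⟨id, fun _ => rfl, fun _ _ => rfl⟩

theorem Realizes.append {𝒢 : GateSet} {l l' : List (PGate 𝒢 ℕ)} {F F' : (ℕ → Bool) → ℕ → Bool}
    (h : Realizes l F) (h' : Realizes l' F') : Realizes (l ++ l') (F' ∘ F) := by
  obtain ⟨G, hG, e⟩ := h
  obtain ⟨G', hG', e'⟩ := h'
  refine ⟨G ∘ G', fun z => by simp [hG, hG'], fun Ψ z => ?_⟩
  rw [actAll_append, e', e]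
  rfl

/-- Amplitudes are pulled back along `G`; the identity `F (G z) = z` identifies `G z` as a preimage
in the old support. -/
theorem Realizes.triple {𝒢 : GateSet} {l : List (PGate 𝒢 ℕ)} {F : (ℕ → Bool) → ℕ → Bool}
    (h : Realizes l F) (A : (ℕ → Bool) → Prop) : Triple A l fun z => ∃ z₀, A z₀ ∧ z = F z₀ := by
  obtain ⟨G, hG, e⟩ := h
  intro Ψ hΨ z hz
  rw [e] at hz
  exact ⟨G z, hΨ _ hz, (hG z).symm⟩

theorem QCircuit.computes_ofWires {𝒢 : GateSet} {inp out : ℕ} (W : ℕ) (h₁ : inp ≤ W)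
    (h₂ : out ≤ W) (l : List (PGate 𝒢 ℕ)) (hl : ∀ g ∈ l, g.Valid W)
    (g : BitString inp → BitString out)
    (h : ∀ v : BitString inp, Triple (fun z => ∀ i < W, z i = padBits v i) l
      fun z => ∀ i : Fin out, z i = g v i) :
    (ofWires W h₁ h₂ l hl).Computes g := by
  classical
  rw [computes_iff]
  intro v z hz
  change BitString W at z
  rw [← takeBits_padBits z, final_ofWires] at hz
  have := h v _ (fun x hx => ?_) _ hz
  · funext i
    rw [← this i]
    exact (padBits_of_lt z (lt_of_lt_of_le i.2 h₂)).symm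
  · change (ofWires W h₁ h₂ l hl : QCircuit 𝒢 inp out).initial (ket v)
      (takeBits (ofWires W h₁ h₂ l hl : QCircuit 𝒢 inp out).width x) ≠ 0 at hx
    rw [initial_ket_takeBits] at hx
    by_contra hne
    exact hx (if_neg hne)

/-- Running a circuit for `g` on the block of qubits from `s` on. -/
theorem QCircuit.Computes.triple_wire {𝒢 : GateSet} {inp out : ℕ} {C : QCircuit 𝒢 inp out}
    {g : BitString inp → BitString out} (hC : C.Computes g) (s : ℕ) (A : (ℕ → Bool) → Prop)
    (hA : ∀ z, A z → ∀ i, inp ≤ i → i < C.width → z (s + i) = false) :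
    Triple A (C.gates.map (Gate.wire s)) fun z => ∃ z₀, A z₀ ∧
      (∀ i, i < s ∨ s + C.width ≤ i → z i = z₀ i) ∧ sliceBits out s z = g (sliceBits inp s z₀) := by
  classical
  rw [computes_iff] at hC
  intro Ψ hΨ z hz
  rw [← glueBits_sliceBits C.width s z, actAll_wire] at hz
  set φ : QState C.width := fun y => Ψ (glueBits s z y) with hφ
  -- By `hA` the workspace part of every string in the support is zero, so the slice of `Ψ` on the
  -- block is a combination of the initial states of `C` on classical inputs.
  have hφ0 : φ = fun y => ∑ a : BitString inp,
      φ (takeBits C.width (padBits a)) * C.initial (ket a) y := by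
    funext y
    have hy := takeBits_padBits y
    by_cases h0 : ∀ i, inp ≤ i → i < C.width → padBits y i = false
    · rw [Finset.sum_eq_single (takeBits inp (padBits y))]
      · have hk : ∀ i < C.width, padBits y i = padBits (takeBits inp (padBits y)) i := by
          intro i hi
          by_cases hk : i < inp
          · rw [padBits_of_lt _ hk]; rfl
          · rw [padBits_of_le _ (not_lt.1 hk), h0 i (not_lt.1 hk) hi]
        have e1 : takeBits C.width (padBits (takeBits inp (padBits y))) = y := by
          rw [← hy]
          funext i
          simp only [takeBits]
          rw [hy, ← hk i i.2]
        have e2 := C.initial_ket_takeBits (takeBits inp (padBits y)) (padBits y)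
        rw [hy, if_pos hk] at e2
        rw [e1, e2, mul_one]
      · intro a _ ha
        have e2 := C.initial_ket_takeBits a (padBits y)
        rw [hy, if_neg] at e2
        · rw [e2, mul_zero]
        · intro h
          apply ha
          funext i
          have := h i (lt_of_lt_of_le i.2 C.inp_le)
          rw [padBits_of_lt a i.2] at this
          exact this.symm
      · simp
    · rw [Finset.sum_eq_zero]
      · by_contra hne
        apply h0
        intro i hi hw
        have := hA _ (hΨ _ hne) i hi hw
        rw [glueBits_add s z y hw] at this
        rw [padBits_of_lt y hw, this]
      · intro a _
        have e2 := C.initial_takeBits (ket a) (padBits y)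
        rw [hy, if_neg h0] at e2
        rw [e2, mul_zero]
  rw [hφ0, runGates_sum] at hz
  -- By linearity the final amplitude is a sum over classical inputs `a`; if it is nonzero, one
  -- input both occurs in the old support and leads to the given output.
  obtain ⟨a, _, ha⟩ := Finset.exists_ne_zero_of_sum_ne_zero hz
  have ha1 := left_ne_zero_of_mul ha
  have ha2 := hC a _ (right_ne_zero_of_mul ha)
  refine ⟨_, hΨ _ ha1, ?_, ?_⟩
  · rintro i (hi | hi)
    · rw [glueBits_of_lt _ _ hi]
    · rw [glueBits_of_ge _ _ hi]
  · have e : sliceBits inp s (glueBits s z (takeBits C.width (padBits a))) = a := by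
      funext i
      simp only [sliceBits]
      rw [glueBits_add s z _ (lt_of_lt_of_le i.2 C.inp_le)]
      exact padBits_of_lt a i.2
    rw [e, ← ha2]
    rfl

/-! ### Gadgets made of `H`, `T` and `CNOT` -/

/-- Names of the gates `H`, `T` and `CNOT` in the gate set `𝒢`. -/
structure CliffordT (𝒢 : GateSet) where
  H : 𝒢.One
  T : 𝒢.One
  CX : 𝒢.Two
  hH : (𝒢.one H : Matrix Bool Bool ℂ) = hadamardMatrix
  hT : (𝒢.one T : Matrix Bool Bool ℂ) = tMatrix
  hCX : (𝒢.two CX : Matrix (Bool × Bool) (Bool × Bool) ℂ) = cnotMatrix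

theorem GateSet.ContainsCliffordT.nonempty {𝒢 : GateSet} (h : 𝒢.ContainsCliffordT) :
    Nonempty (CliffordT 𝒢) := by
  obtain ⟨⟨H, hH⟩, ⟨T, hT⟩, ⟨CX, hCX⟩⟩ := h
  exact ⟨⟨H, T, CX, hH, hT, hCX⟩⟩

namespace CliffordT

variable {𝒢 : GateSet} (K : CliffordT 𝒢) {P Q : Type}

/-- The same gates among all the gates. -/
def all : CliffordT allGates where
  H := 𝒢.one K.H
  T := 𝒢.one K.T
  CX := 𝒢.two K.CX
  hH := K.hH
  hT := K.hT
  hCX := K.hCX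

/-- The phase `exp (iπ/4)`. -/
def omega : ℂ := Complex.exp (Real.pi / 4 * Complex.I)

theorem omega_pow_four : omega ^ 4 = -1 := by
  rw [omega, ← Complex.exp_nat_mul, ← Complex.exp_pi_mul_I]
  congr 1
  push_cast
  ring

theorem act_H (i : ℕ) (Ψ : (ℕ → Bool) → ℂ) (z : ℕ → Bool) :
    (PGate.one K.H i).act Ψ z = (Ψ (Function.update z i false) +
      (if z i then -1 else 1) * Ψ (Function.update z i true)) / (Real.sqrt 2 : ℂ) := by
  simp only [PGate.act, K.hH, Fintype.sum_bool, hadamardMatrix, Matrix.of_apply]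
  cases z i <;> simp <;> ring

theorem act_T (i : ℕ) (Ψ : (ℕ → Bool) → ℂ) (z : ℕ → Bool) :
    (PGate.one K.T i).act Ψ z = (if z i then omega else 1) * Ψ z := by
  have e : Function.update z i (z i) = z := Function.update_eq_self i z
  simp only [PGate.act, K.hT, Fintype.sum_bool, tMatrix, Matrix.diagonal_apply, omega]
  cases h : z i <;> rw [h] at e <;> simp [e]

theorem act_CX (i j : ℕ) (Ψ : (ℕ → Bool) → ℂ) (z : ℕ → Bool) :
    (PGate.two K.CX i j).act Ψ z = Ψ (Function.update z j (xor (z i) (z j))) := by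
  have e : Function.update z i (z i) = z := Function.update_eq_self i z
  simp only [PGate.act, K.hCX, Fintype.sum_bool, cnotMatrix, Matrix.of_apply]
  cases h : z i <;> cases h' : z j <;> rw [h] at e <;> simp [e]

/-- `CNOT`. -/
def cx (i j : P) : List (PGate 𝒢 P) := [.two K.CX i j]

/-- The phase `omega ^ k`. -/
def phase (k : ℕ) (i : P) : List (PGate 𝒢 P) := List.replicate k (.one K.T i)

/-- The Hadamard gate. -/
def had (i : P) : List (PGate 𝒢 P) := [.one K.H i]

/-- The doubly controlled phase `-1`. -/
def ccz (i j l : P) : List (PGate 𝒢 P) :=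
  K.phase 1 i ++ K.phase 1 j ++ K.phase 1 l ++
    (K.cx i j ++ K.phase 7 j ++ K.cx i j) ++ (K.cx j l ++ K.phase 7 l ++ K.cx j l) ++
    (K.cx i l ++ K.phase 7 l ++ K.cx i l) ++
    (K.cx i l ++ K.cx j l ++ K.phase 1 l ++ K.cx j l ++ K.cx i l)

/-- The Toffoli gate. -/
def toffoli (i j l : P) : List (PGate 𝒢 P) := K.had l ++ K.ccz i j l ++ K.had l

/-- Negation. -/
def neg (i : P) : List (PGate 𝒢 P) := K.had i ++ K.phase 4 i ++ K.had i

/-- The exchange of two qubits. -/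
def swap (i j : P) : List (PGate 𝒢 P) := K.cx i j ++ K.cx j i ++ K.cx i j

section map
variable (e : P → Q)

@[simp] theorem map_cx (i j : P) : (K.cx i j).map (PGate.map e) = K.cx (e i) (e j) := rfl
@[simp] theorem map_phase (k : ℕ) (i : P) :
    (K.phase k i).map (PGate.map e) = K.phase k (e i) := by simp [phase, PGate.map]
@[simp] theorem map_had (i : P) : (K.had i).map (PGate.map e) = K.had (e i) := rfl
@[simp] theorem map_ccz (i j l : P) :
    (K.ccz i j l).map (PGate.map e) = K.ccz (e i) (e j) (e l) := by simp [ccz]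
@[simp] theorem map_toffoli (i j l : P) :
    (K.toffoli i j l).map (PGate.map e) = K.toffoli (e i) (e j) (e l) := by simp [toffoli]
@[simp] theorem map_neg (i : P) : (K.neg i).map (PGate.map e) = K.neg (e i) := by simp [neg]
@[simp] theorem map_swap (i j : P) :
    (K.swap i j).map (PGate.map e) = K.swap (e i) (e j) := by simp [swap]

end map

/-! Validity -/

section valid
variable {m i j l : ℕ}

theorem valid_cx (hi : i < m) (hj : j < m) (hij : i ≠ j) : ∀ g ∈ K.cx i j, g.Valid m := by
  simp [cx, PGate.Valid, *]

theorem valid_phase (k : ℕ) (hi : i < m) : ∀ g ∈ K.phase k i, g.Valid m := by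
  intro g hg
  rw [List.eq_of_mem_replicate hg]
  exact hi

theorem valid_had (hi : i < m) : ∀ g ∈ K.had i, g.Valid m := by
  simp [had, PGate.Valid, *]

theorem valid_append {l₁ l₂ : List (PGate 𝒢 ℕ)} (h₁ : ∀ g ∈ l₁, g.Valid m)
    (h₂ : ∀ g ∈ l₂, g.Valid m) : ∀ g ∈ l₁ ++ l₂, g.Valid m :=
  List.forall_mem_append.2 ⟨h₁, h₂⟩

theorem valid_ccz (hi : i < m) (hj : j < m) (hl : l < m) (hij : i ≠ j) (hil : i ≠ l) (hjl : j ≠ l) :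
    ∀ g ∈ K.ccz i j l, g.Valid m := by
  unfold ccz
  repeat' apply valid_append
  all_goals first
    | exact K.valid_phase _ ‹_›
    | exact K.valid_cx ‹_› ‹_› ‹_›

theorem valid_toffoli (hi : i < m) (hj : j < m) (hl : l < m) (hij : i ≠ j) (hil : i ≠ l)
    (hjl : j ≠ l) : ∀ g ∈ K.toffoli i j l, g.Valid m :=
  valid_append (valid_append (K.valid_had hl) (K.valid_ccz hi hj hl hij hil hjl)) (K.valid_had hl)

theorem valid_neg (hi : i < m) : ∀ g ∈ K.neg i, g.Valid m :=
  valid_append (valid_append (K.valid_had hi) (K.valid_phase 4 hi)) (K.valid_had hi)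

theorem valid_swap (hi : i < m) (hj : j < m) (hij : i ≠ j) : ∀ g ∈ K.swap i j, g.Valid m :=
  valid_append (valid_append (K.valid_cx hi hj hij) (K.valid_cx hj hi hij.symm))
    (K.valid_cx hi hj hij)

end valid

/-! Actions -/

theorem actAll_cx (i j : ℕ) (Ψ : (ℕ → Bool) → ℂ) (z : ℕ → Bool) :
    actAll (K.cx i j) Ψ z = Ψ (Function.update z j (xor (z i) (z j))) :=
  K.act_CX i j Ψ z

theorem actAll_had (i : ℕ) (Ψ : (ℕ → Bool) → ℂ) (z : ℕ → Bool) :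
    actAll (K.had i) Ψ z = (Ψ (Function.update z i false) +
      (if z i then -1 else 1) * Ψ (Function.update z i true)) / (Real.sqrt 2 : ℂ) :=
  K.act_H i Ψ z

theorem actAll_phase (k i : ℕ) (Ψ : (ℕ → Bool) → ℂ) (z : ℕ → Bool) :
    actAll (K.phase k i) Ψ z = (if z i then omega ^ k else 1) * Ψ z := by
  induction k generalizing Ψ with
  | zero => simp [phase]
  | succ k ih =>
    change actAll (K.phase k i) ((PGate.one K.T i).act Ψ) z = _
    rw [ih, K.act_T]
    split_ifs <;> ring

/-- The first CNOT writes the parity of the two bits into qubit `j`, the phase gates act on that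
parity, and the second CNOT restores the bit. -/
theorem actAll_phase_two {i j : ℕ} (hij : i ≠ j) (k : ℕ) (Ψ : (ℕ → Bool) → ℂ) (z : ℕ → Bool) :
    actAll (K.cx i j ++ K.phase k j ++ K.cx i j) Ψ z =
      (if xor (z i) (z j) then omega ^ k else 1) * Ψ z := by
  rw [actAll_append, actAll_append, K.actAll_cx i j, K.actAll_phase, K.actAll_cx i j]
  simp [hij]

theorem actAll_phase_three {i j l : ℕ} (hil : i ≠ l) (hjl : j ≠ l) (k : ℕ)
    (Ψ : (ℕ → Bool) → ℂ) (z : ℕ → Bool) :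
    actAll (K.cx i l ++ K.cx j l ++ K.phase k l ++ K.cx j l ++ K.cx i l) Ψ z =
      (if xor (z j) (xor (z i) (z l)) then omega ^ k else 1) * Ψ z := by
  simp only [actAll_append, K.actAll_cx i l, K.actAll_cx j l, K.actAll_phase]
  simp [hil, hjl]

/-- This is the identity 4xyz = x + y + z - (x⊕y) - (y⊕z) - (x⊕z) + (x⊕y⊕z) for bits, read as
exponents of `omega`. As `omega` has eighth power 1, the coefficient -1 is realized by seven T
gates. -/
theorem actAll_ccz {i j l : ℕ} (hij : i ≠ j) (hil : i ≠ l) (hjl : j ≠ l) (Ψ : (ℕ → Bool) → ℂ)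
    (z : ℕ → Bool) :
    actAll (K.ccz i j l) Ψ z = (if z i && z j && z l then -1 else 1) * Ψ z := by
  rw [ccz, actAll_append, K.actAll_phase_three hil hjl, actAll_append, K.actAll_phase_two hil,
    actAll_append, K.actAll_phase_two hjl, actAll_append, K.actAll_phase_two hij, actAll_append,
    K.actAll_phase, actAll_append, K.actAll_phase, K.actAll_phase]
  simp only [← mul_assoc]
  congr 1
  -- The total exponent is 0 if no bit is set, 16 if one or two are set, and 4 if all three are.
  have h8 : omega ^ 8 = 1 := by
    rw [show (8 : ℕ) = 4 * 2 from rfl, pow_mul, omega_pow_four]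
    norm_num
  have h16 : omega ^ 16 = 1 := by
    rw [show (16 : ℕ) = 8 * 2 from rfl, pow_mul, h8, one_pow]
  have h4 := omega_pow_four
  cases z i <;> cases z j <;> cases z l <;> simp <;> ring_nf <;> simp [h4, h16]

theorem sqrt_two_mul_self : (Real.sqrt 2 : ℂ) * (Real.sqrt 2 : ℂ) = 2 := by
  rw [← Complex.ofReal_mul, Real.mul_self_sqrt (by norm_num)]
  norm_num

/-- Conjugation by H turns a controlled Z on the target into a controlled X. -/
theorem actAll_toffoli {i j l : ℕ} (hij : i ≠ j) (hil : i ≠ l) (hjl : j ≠ l)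
    (Ψ : (ℕ → Bool) → ℂ) (z : ℕ → Bool) :
    actAll (K.toffoli i j l) Ψ z = Ψ (Function.update z l (xor (z l) (z i && z j))) := by
  rw [toffoli, actAll_append, K.actAll_had, actAll_append]
  simp only [K.actAll_ccz hij hil hjl, K.actAll_had, ne_eq, hil, hjl, not_false_eq_true,
    Function.update_of_ne, Function.update_self, Function.update_idem, Bool.and_false, Bool.and_true,
    Bool.false_eq_true, if_false, one_mul, if_true]
  have h2 := sqrt_two_mul_self
  have h0 : (Real.sqrt 2 : ℂ) ≠ 0 := by
    intro h; rw [h] at h2; norm_num at h2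
  rw [div_eq_iff h0]
  have h3 : (Real.sqrt 2 : ℂ) ^ 2 = 2 := by rw [sq, h2]
  cases z i <;> cases z j <;> cases z l <;> simp <;> field_simp <;> rw [h3] <;> ring

/-- The fourth power of T is Z, and HZH = X. -/
theorem actAll_neg (i : ℕ) (Ψ : (ℕ → Bool) → ℂ) (z : ℕ → Bool) :
    actAll (K.neg i) Ψ z = Ψ (Function.update z i (!z i)) := by
  rw [neg, actAll_append, K.actAll_had, actAll_append]
  simp only [K.actAll_phase, K.actAll_had, Function.update_self, Function.update_idem,
    Bool.false_eq_true, if_false, one_mul, if_true, omega_pow_four]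
  have h2 := sqrt_two_mul_self
  have h0 : (Real.sqrt 2 : ℂ) ≠ 0 := by
    intro h; rw [h] at h2; norm_num at h2
  rw [div_eq_iff h0]
  have h3 : (Real.sqrt 2 : ℂ) ^ 2 = 2 := by rw [sq, h2]
  cases z i <;> simp <;> field_simp <;> rw [h3] <;> ring

theorem actAll_swap {i j : ℕ} (hij : i ≠ j) (Ψ : (ℕ → Bool) → ℂ) (z : ℕ → Bool) :
    actAll (K.swap i j) Ψ z = Ψ (Function.update (Function.update z i (z j)) j (z i)) := by
  rw [swap, actAll_append, K.actAll_cx i j, actAll_append, K.actAll_cx j i, K.actAll_cx i j]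
  congr 1
  funext k
  by_cases hki : k = i
  · subst hki
    simp only [ne_eq, hij, not_false_eq_true, Function.update_of_ne, Function.update_self]
    cases z k <;> cases z j <;> rfl
  · by_cases hkj : k = j
    · subst hkj
      simp [hij, hij.symm]
    · simp [hki, hkj]

/-! Actions on basis states -/

theorem realizes_of_involutive {l : List (PGate 𝒢 ℕ)} {F : (ℕ → Bool) → ℕ → Bool}
    (hF : Function.Involutive F) (h : ∀ Ψ z, actAll l Ψ z = Ψ (F z)) : Realizes l F :=
  ⟨F, hF, h⟩

theorem realizes_cx {i j : ℕ} (hij : i ≠ j) :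
    Realizes (K.cx i j) fun z => Function.update z j (xor (z i) (z j)) :=
  realizes_of_involutive (fun z => by simp [hij]) (K.actAll_cx i j)

theorem realizes_toffoli {i j l : ℕ} (hij : i ≠ j) (hil : i ≠ l) (hjl : j ≠ l) :
    Realizes (K.toffoli i j l) fun z => Function.update z l (xor (z l) (z i && z j)) :=
  realizes_of_involutive (fun z => by simp [hil, hjl]) (K.actAll_toffoli hij hil hjl)

theorem realizes_neg (i : ℕ) : Realizes (K.neg i) fun z => Function.update z i (!z i) :=
  realizes_of_involutive (fun z => by simp) (K.actAll_neg i)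

theorem realizes_swap {i j : ℕ} (hij : i ≠ j) :
    Realizes (K.swap i j) fun z => Function.update (Function.update z i (z j)) j (z i) :=
  realizes_of_involutive (fun z => by
    funext k
    by_cases hki : k = i
    · subst hki; simp [hij]
    · by_cases hkj : k = j
      · subst hkj; simp [hij]
      · simp [hki, hkj]) (K.actAll_swap hij)

/-! Loops of gadgets -/

/-- `z (t) ⊕= ∑ j < m, z (p + j) z (q + j)`. -/
def dotLoop (m p q t : ℕ) : List (PGate 𝒢 ℕ) :=
  (List.range m).flatMap fun j => K.toffoli (p + j) (q + j) t

/-- The phase `-1` to the power `z (t) * ∑ j < m, z (p + j) z (q + j)`. -/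
def dotPhaseLoop (m p q t : ℕ) : List (PGate 𝒢 ℕ) :=
  (List.range m).flatMap fun j => K.ccz (p + j) (q + j) t

/-- The exchange of `m` qubits from `p` on with those from `q` on. -/
def swapLoop (m p q : ℕ) : List (PGate 𝒢 ℕ) :=
  (List.range m).flatMap fun j => K.swap (p + j) (q + j)

/-- The comparison of `m` qubits from `p` on with those from `q` on. The qubit `t` is the
starting value and the result is in the qubit `t + m`. -/
def cmpLoop (m p q t : ℕ) : List (PGate 𝒢 ℕ) :=
  (List.range m).flatMap fun j =>
    K.cx (q + j) (p + j) ++ K.neg (p + j) ++ K.toffoli (p + j) (t + j) (t + j + 1)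

/-- The parity of a count becomes a running sum modulo 2, which is what a loop of Toffoli gates
accumulates. -/
theorem _root_.innerMod2_eq {n : ℕ} (y x : BitString n) :
    innerMod2 y x = (List.finRange n).foldl (fun b i => xor b (y i && x i)) false := by
  have key (l : List (Fin n)) (hl : l.Nodup) : l.foldl (fun b i => xor b (y i && x i)) false =
      decide (Odd (l.toFinset.filter fun i => y i = true ∧ x i = true).card) := by
    induction l using List.reverseRecOn with
    | nil => simp
    | append_singleton l a ih =>
      rw [List.nodup_append] at hl
      rw [List.foldl_append, ih hl.1]
      have ha : a ∉ l := fun h => hl.2.2 a h a (by simp) rfl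
      have e : (l ++ [a]).toFinset = insert a l.toFinset := by
        ext; simp
      rw [e, Finset.filter_insert]
      by_cases h : y a = true ∧ x a = true
      · rw [if_pos h, Finset.card_insert_of_notMem (by simp [ha])]
        simp [h.1, h.2, Nat.odd_add_one, -Nat.not_odd_iff_even]
      · rw [if_neg h]
        have : (y a && x a) = false := by simpa using h
        simp [this]
  rw [key _ (List.nodup_finRange n)]
  unfold innerMod2
  congr 3
  ext; simp

/-- The inner product of `m` bits from `p` on with those from `q` on. -/
def dotBits (z : ℕ → Bool) (m p q : ℕ) : Bool :=
  (List.range m).foldl (fun b j => xor b (z (p + j) && z (q + j))) false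

theorem dotBits_succ (z : ℕ → Bool) (m p q : ℕ) :
    dotBits z (m + 1) p q = xor (dotBits z m p q) (z (p + m) && z (q + m)) := by
  simp [dotBits, List.range_succ]

theorem dotBits_congr {z z' : ℕ → Bool} {m p q : ℕ} (hp : ∀ j < m, z (p + j) = z' (p + j))
    (hq : ∀ j < m, z (q + j) = z' (q + j)) : dotBits z m p q = dotBits z' m p q := by
  induction m with
  | zero => rfl
  | succ m ih =>
    rw [dotBits_succ, dotBits_succ, ih (fun j hj => hp j (by omega)) fun j hj => hq j (by omega),
      hp m (by omega), hq m (by omega)]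

theorem innerMod2_sliceBits (z : ℕ → Bool) (n p q : ℕ) :
    innerMod2 (sliceBits n p z) (sliceBits n q z) = dotBits z n p q := by
  rw [innerMod2_eq]
  simp only [dotBits, sliceBits]
  rw [← List.map_coe_finRange_eq_range, List.foldl_map]

theorem actAll_dotLoop {m p q t : ℕ} (hpq : p + m ≤ q ∨ q + m ≤ p) (hp : t < p ∨ p + m ≤ t)
    (hq : t < q ∨ q + m ≤ t) (Ψ : (ℕ → Bool) → ℂ) (z : ℕ → Bool) :
    actAll (K.dotLoop m p q t) Ψ z = Ψ (Function.update z t (xor (z t) (dotBits z m p q))) := by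
  induction m generalizing Ψ z with
  | zero => simp [dotLoop, dotBits]
  | succ m ih =>
    have e : K.dotLoop (m + 1) p q t = K.dotLoop m p q t ++ K.toffoli (p + m) (q + m) t := by
      simp [dotLoop, List.range_succ]
    rw [e, actAll_append, K.actAll_toffoli (by omega) (by omega) (by omega),
      ih (by omega) (by omega) (by omega), dotBits_succ]
    rw [dotBits_congr (z' := z) (fun j _ => by rw [Function.update_of_ne (by omega)])
      (fun j _ => by rw [Function.update_of_ne (by omega)])]
    rw [Function.update_idem, Function.update_self, Bool.xor_assoc,
      Bool.xor_comm (dotBits z m p q)]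

theorem realizes_dotLoop {m p q t : ℕ} (hpq : p + m ≤ q ∨ q + m ≤ p) (hp : t < p ∨ p + m ≤ t)
    (hq : t < q ∨ q + m ≤ t) :
    Realizes (K.dotLoop m p q t) fun z => Function.update z t (xor (z t) (dotBits z m p q)) := by
  refine realizes_of_involutive (fun z => ?_) (K.actAll_dotLoop hpq hp hq)
  simp only [Function.update_self, Function.update_idem]
  rw [dotBits_congr (z := Function.update z t _) (z' := z) (fun j _ => by rw [Function.update_of_ne (by omega)])
      (fun j _ => by rw [Function.update_of_ne (by omega)])]
  cases h : z t <;> cases dotBits z m p q <;> simp [← h]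

/-- Each CCZ contributes the sign of one product z(p + j) z(q + j), controlled by `t`, so the
product of all signs is Z on qubit `t` to the power of the inner product. -/
theorem actAll_dotPhaseLoop {m p q t : ℕ} (hpq : p + m ≤ q ∨ q + m ≤ p) (hp : t < p ∨ p + m ≤ t)
    (hq : t < q ∨ q + m ≤ t) (Ψ : (ℕ → Bool) → ℂ) (z : ℕ → Bool) :
    actAll (K.dotPhaseLoop m p q t) Ψ z = (if dotBits z m p q && z t then -1 else 1) * Ψ z := by
  induction m with
  | zero => simp [dotPhaseLoop, dotBits]
  | succ m ih =>
    have e : K.dotPhaseLoop (m + 1) p q t = K.dotPhaseLoop m p q t ++ K.ccz (p + m) (q + m) t := by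
      simp [dotPhaseLoop, List.range_succ]
    rw [e, actAll_append, K.actAll_ccz (by omega) (by omega) (by omega),
      ih (by omega) (by omega) (by omega), dotBits_succ, ← mul_assoc]
    congr 1
    cases dotBits z m p q <;> cases z t <;> cases z (p + m) <;> cases z (q + m) <;> simp

theorem realizes_swapLoop {m p q : ℕ} (h : p + m ≤ q) :
    ∃ F, Realizes (K.swapLoop m p q) F ∧ (∀ z, ∀ j < m, F z (p + j) = z (q + j)) ∧
      (∀ z, ∀ j < m, F z (q + j) = z (p + j)) ∧
      ∀ z i, i < p ∨ (p + m ≤ i ∧ i < q) ∨ q + m ≤ i → F z i = z i := by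
  induction m with
  | zero => exact ⟨id, Realizes.nil, by simp, by simp, by simp⟩
  | succ m ih =>
    obtain ⟨F, hF, hp, hq, hr⟩ := ih (by omega)
    have e : K.swapLoop (m + 1) p q = K.swapLoop m p q ++ K.swap (p + m) (q + m) := by
      simp [swapLoop, List.range_succ]
    refine ⟨_, e ▸ hF.append (K.realizes_swap (i := p + m) (j := q + m) (by omega)), ?_, ?_, ?_⟩
    · intro z j hj
      simp only [Function.comp_apply]
      rw [Function.update_of_ne (by omega)]
      by_cases hjm : j = m
      · subst hjm
        rw [Function.update_self, hr z _ (by omega)]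
      · rw [Function.update_of_ne (by omega), hp z j (by omega)]
    · intro z j hj
      simp only [Function.comp_apply]
      by_cases hjm : j = m
      · subst hjm
        rw [Function.update_self, hr z _ (by omega)]
      · rw [Function.update_of_ne (by omega), Function.update_of_ne (by omega), hq z j (by omega)]
    · intro z i hi
      simp only [Function.comp_apply]
      rw [Function.update_of_ne (by omega), Function.update_of_ne (by omega), hr z i (by omega)]

/-- The round for `j` overwrites qubit `p + j` by the truth value of equality of the two bits, and
the Toffoli gate puts its conjunction with the result so far into the next fresh qubit. The block at
`p` and the chain after `t` are spoiled; all other qubits are unchanged. Starting from an arbitrary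
bit at `t` allows two comparisons to be chained. -/
theorem realizes_cmpLoop {m p q t : ℕ} (hpq : p + m ≤ q) (hqt : q + m ≤ t) :
    ∃ F, Realizes (K.cmpLoop m p q t) F ∧
      (∀ z i, ¬ (p ≤ i ∧ i < p + m) → ¬ (t < i ∧ i ≤ t + m) → F z i = z i) ∧
      ∀ z, (∀ j < m, z (t + j + 1) = false) →
        F z (t + m) = (z t && decide (∀ j < m, z (q + j) = z (p + j))) := by
  induction m with
  | zero => exact ⟨id, Realizes.nil, by simp, by simp⟩
  | succ m ih =>
    obtain ⟨F, hF, hr, ht⟩ := ih (by omega) (by omega)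
    have e : K.cmpLoop (m + 1) p q t = K.cmpLoop m p q t ++ (K.cx (q + m) (p + m) ++
        K.neg (p + m) ++ K.toffoli (p + m) (t + m) (t + m + 1)) := by
      simp [cmpLoop, List.range_succ]
    refine ⟨_, e ▸ hF.append (((K.realizes_cx (i := q + m) (j := p + m) (by omega)).append
      (K.realizes_neg (p + m))).append (K.realizes_toffoli (i := p + m) (j := t + m)
        (l := t + m + 1) (by omega) (by omega) (by omega))), ?_, ?_⟩
    · intro z i h1 h2
      simp only [Function.comp_apply]
      rw [Function.update_of_ne (by omega), Function.update_of_ne (by omega),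
        Function.update_of_ne (by omega), hr z i (by omega) (by omega)]
    · intro z h0
      simp only [Function.comp_apply]
      rw [← add_assoc, Function.update_self]
      rw [Function.update_of_ne (a := t + m + 1) (by omega),
        Function.update_of_ne (a := t + m + 1) (by omega), hr z _ (by omega) (by omega),
        h0 m (by omega), Function.update_of_ne (a := t + m) (by omega),
        Function.update_of_ne (a := t + m) (by omega), Function.update_self, Function.update_self,
        hr z _ (by omega) (by omega), hr z _ (by omega) (by omega), ht z fun j hj => h0 j (by omega)]
      have e2 : decide (∀ j < m + 1, z (q + j) = z (p + j)) =
          (decide (∀ j < m, z (q + j) = z (p + j)) && decide (z (q + m) = z (p + m))) := by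
        rw [← Bool.decide_and]
        exact decide_eq_decide.2 Nat.forall_lt_succ_right
      rw [e2]
      cases z (q + m) <;> cases z (p + m) <;> cases z t <;> simp

section valid
variable {W m p q t : ℕ}

theorem valid_loop {f : ℕ → List (PGate 𝒢 ℕ)} (h : ∀ j < m, ∀ g ∈ f j, g.Valid W) :
    ∀ g ∈ (List.range m).flatMap f, g.Valid W := by
  intro g hg
  obtain ⟨j, hj, hg⟩ := List.mem_flatMap.1 hg
  exact h j (List.mem_range.1 hj) g hg

theorem valid_dotLoop (hpW : p + m ≤ W) (hqW : q + m ≤ W) (htW : t < W)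
    (hpq : p + m ≤ q ∨ q + m ≤ p)
    (hp : t < p ∨ p + m ≤ t) (hq : t < q ∨ q + m ≤ t) : ∀ g ∈ K.dotLoop m p q t, g.Valid W :=
  valid_loop fun j hj => K.valid_toffoli (by omega) (by omega) (by omega) (by omega) (by omega)
    (by omega)

theorem valid_dotPhaseLoop (hpW : p + m ≤ W) (hqW : q + m ≤ W) (htW : t < W)
    (hpq : p + m ≤ q ∨ q + m ≤ p)
    (hp : t < p ∨ p + m ≤ t) (hq : t < q ∨ q + m ≤ t) :
    ∀ g ∈ K.dotPhaseLoop m p q t, g.Valid W :=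
  valid_loop fun j hj => K.valid_ccz (by omega) (by omega) (by omega) (by omega) (by omega)
    (by omega)

theorem valid_swapLoop (hpW : p + m ≤ W) (hqW : q + m ≤ W) (hpq : p + m ≤ q) :
    ∀ g ∈ K.swapLoop m p q, g.Valid W :=
  valid_loop fun j hj => K.valid_swap (by omega) (by omega) (by omega)

theorem valid_cmpLoop (hpq : p + m ≤ q) (hqt : q + m ≤ t) (htW : t + m < W) :
    ∀ g ∈ K.cmpLoop m p q t, g.Valid W :=
  valid_loop fun j hj => valid_append (valid_append (K.valid_cx (by omega) (by omega) (by omega))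
    (K.valid_neg (by omega))) (K.valid_toffoli (by omega) (by omega) (by omega) (by omega)
      (by omega) (by omega))

end valid

/-! Applying a circuit to `m` of the qubits -/

/-- Applying the circuit `C` to `m` qubits from `p` on, with the qubits from `s` on as workspace. -/
def applyAt {inp out : ℕ} (C : QCircuit 𝒢 inp out) (m p s : ℕ) : List (PGate 𝒢 ℕ) :=
  K.swapLoop m p s ++ C.gates.map (Gate.wire s) ++ K.swapLoop m p s

/-- The exchange brings the argument to the start of a clean workspace, where `C` runs, and the
second exchange brings the value back. The rest of the workspace may hold garbage, about which
nothing is claimed, so each application uses a workspace of its own. -/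
theorem triple_applyAt {n : ℕ} {C : QCircuit 𝒢 n n} {f : BitString n → BitString n}
    (hC : C.Computes f) {p s : ℕ} (hps : p + n ≤ s) (A : (ℕ → Bool) → Prop)
    (hA : ∀ z, A z → ∀ i, s ≤ i → i < s + C.width → z i = false) :
    Triple A (K.applyAt C n p s) fun z => ∃ z₀, A z₀ ∧
      (∀ i, i < p ∨ (p + n ≤ i ∧ i < s) ∨ s + C.width ≤ i → z i = z₀ i) ∧
      sliceBits n p z = f (sliceBits n p z₀) := by
  obtain ⟨F, hF, hFp, hFq, hFr⟩ := K.realizes_swapLoop hps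
  have hnw := C.inp_le
  refine (((hF.triple A).append (hC.triple_wire s _ ?_)).append (hF.triple _)).weaken ?_
  · rintro z ⟨z₀, h₀, rfl⟩ i hi hiw
    rw [hFr z₀ _ (by omega)]
    exact hA z₀ h₀ _ (by omega) (by omega)
  · rintro z ⟨z₂, ⟨z₁, ⟨z₀, h₀, rfl⟩, hr, hf⟩, rfl⟩
    refine ⟨z₀, h₀, ?_, ?_⟩
    · intro i hi
      rw [hFr z₂ i (by omega), hr i (by omega), hFr z₀ i (by omega)]
    · have e1 : sliceBits n p (F z₂) = sliceBits n s z₂ := by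
        funext j; exact hFp z₂ j j.2
      have e2 : sliceBits n s (F z₀) = sliceBits n p z₀ := by
        funext j; exact hFq z₀ j j.2
      rw [e1, hf, e2]

theorem valid_applyAt {inp out : ℕ} (C : QCircuit 𝒢 inp out) {m p s W : ℕ} (hps : p + m ≤ s)
    (hmw : m ≤ C.width) (hW : s + C.width ≤ W) : ∀ g ∈ K.applyAt C m p s, g.Valid W := by
  refine valid_append (valid_append (K.valid_swapLoop (by omega) (by omega) hps) ?_)
    (K.valid_swapLoop (by omega) (by omega) hps)
  intro g hg
  obtain ⟨g', _, rfl⟩ := List.mem_map.1 hg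
  exact g'.valid_wire s W hW

end CliffordT

/-! ### Programming the stack machines -/

namespace StackProgram

/-- The same program on other stacks. -/
def map {k K : ℕ} {S : Type} (e : Fin k → Fin K) : StackProgram k S → StackProgram K S
  | push i s => push (e i) s
  | pop i => pop (e i)
  | move i j => move (e i) (e j)
  | seq p q => seq (p.map e) (q.map e)
  | ite i t p q => ite (e i) t (p.map e) (q.map e)
  | loop i t p => loop (e i) t (p.map e)

/-- Started with the stacks `s`, which are labelled by the elements of `ι`, the program `p` halts
with the stacks `s'` after at most `T` steps. -/
def Does {ι : Type} {K : ℕ} {S : Type} (E : ι ≃ Fin K) (p : StackProgram K S) (s s' : ι → List S)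
    (T : ℕ) : Prop :=
  ∃ t ≤ T, p.Runs (s ∘ E.symm) (s' ∘ E.symm) t

section
variable {ι : Type} {K : ℕ} {S : Type} {E : ι ≃ Fin K}

theorem Does.mono {p : StackProgram K S} {s s' : ι → List S} {T T' : ℕ} (h : Does E p s s' T)
    (hT : T ≤ T') : Does E p s s' T' := by
  obtain ⟨t, ht, hr⟩ := h
  exact ⟨t, ht.trans hT, hr⟩

theorem Does.seq {p q : StackProgram K S} {s s' s'' : ι → List S} {T T' : ℕ} (hp : Does E p s s' T)
    (hq : Does E q s' s'' T') : Does E (.seq p q) s s'' (T + T') := by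
  obtain ⟨t, ht, hr⟩ := hp
  obtain ⟨t', ht', hr'⟩ := hq
  exact ⟨t + t', by omega, .seq _ _ _ _ _ _ _ hr hr'⟩

theorem does_ite_true {p q : StackProgram K S} {s s' : ι → List S} {T : ℕ} {i : ι}
    {t : Option S → Bool} (h : t (s i).head? = true) (hp : Does E p s s' T) :
    Does E (.ite (E i) t p q) s s' (T + 1) := by
  obtain ⟨u, hu, hr⟩ := hp
  exact ⟨u + 1, by omega, .ite_true _ _ _ _ _ _ _ (by simpa using h) hr⟩

theorem does_ite_false {p q : StackProgram K S} {s s' : ι → List S} {T : ℕ} {i : ι}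
    {t : Option S → Bool} (h : t (s i).head? = false) (hq : Does E q s s' T) :
    Does E (.ite (E i) t p q) s s' (T + 1) := by
  obtain ⟨u, hu, hr⟩ := hq
  exact ⟨u + 1, by omega, .ite_false _ _ _ _ _ _ _ (by simpa using h) hr⟩

/-- The stacks after `c` rounds are prescribed as a sequence, so each use only checks a single
round. A round costs its body and one test, and the final test accounts for the last step. -/
theorem does_loop {i : ι} {t : Option S → Bool} {p : StackProgram K S} {T : ℕ} (m : ℕ)
    (s : ℕ → ι → List S) (h : ∀ c < m, t (s c i).head? = true ∧ Does E p (s c) (s (c + 1)) T)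
    (hm : t (s m i).head? = false) : Does E (.loop (E i) t p) (s 0) (s m) (m * (T + 1) + 1) := by
  induction m generalizing s with
  | zero => exact ⟨1, by omega, loop_stop _ _ _ _ (by simpa using hm)⟩
  | succ m ih =>
    obtain ⟨u, hu, hr⟩ := (h 0 (by omega)).2
    obtain ⟨u', hu', hr'⟩ := ih (fun c => s (c + 1)) (fun c hc => h (c + 1) (by omega)) hm
    refine ⟨u + u' + 1, ?_, .loop_step _ _ _ _ _ _ _ _ ?_ hr hr'⟩
    · rw [Nat.succ_mul]; omega
    · simpa using (h 0 (by omega)).1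

/-- The program that does nothing. -/
def skip (i : Fin K) : StackProgram K S := .loop i (fun _ => false) (.pop i)

theorem does_skip (i : ι) (s : ι → List S) : Does E (skip (E i)) s s 1 :=
  ⟨1, le_rfl, loop_stop _ _ _ _ rfl⟩

theorem Does.cast {p : StackProgram K S} {s s' s'' : ι → List S} {T T' : ℕ} (h : Does E p s s' T)
    (hs : s' = s'') (hT : T ≤ T') : Does E p s s'' T' :=
  hs ▸ h.mono hT

theorem exists_drop_eq_cons {l : List S} {c : ℕ} (hc : c < l.length) :
    ∃ a, l.drop c = a :: l.drop (c + 1) ∧ l.take (c + 1) = l.take c ++ [a] :=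
  ⟨l[c], List.drop_eq_getElem_cons hc, by rw [← List.take_concat_get hc]; simp⟩

variable [DecidableEq ι]

theorem update_comp_symm (s : ι → List S) (i : ι) (v : List S) :
    Function.update (s ∘ E.symm) (E i) v = Function.update s i v ∘ E.symm := by
  funext j
  simp only [Function.update_apply, Function.comp_apply, Equiv.symm_apply_eq]

theorem does_push (i : ι) (x : S) (s : ι → List S) :
    Does E (.push (E i) x) s (Function.update s i (x :: s i)) 1 := by
  refine ⟨1, le_rfl, ?_⟩
  have := Runs.push (E i) x (s ∘ E.symm)
  rwa [update_comp_symm, Function.comp_apply, E.symm_apply_apply] at this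

theorem does_pop (i : ι) (s : ι → List S) :
    Does E (.pop (E i)) s (Function.update s i (s i).tail) 1 := by
  refine ⟨1, le_rfl, ?_⟩
  have := Runs.pop (E i) (s ∘ E.symm)
  rwa [update_comp_symm, Function.comp_apply, E.symm_apply_apply] at this

theorem does_move {i j : ι} (hij : i ≠ j) (s : ι → List S) (x : S) (l : List S) (h : s i = x :: l) :
    Does E (.move (E i) (E j)) s (Function.update (Function.update s i l) j (x :: s j)) 1 := by
  refine ⟨1, le_rfl, ?_⟩
  have := Runs.move_cons (E i) (E j) (s ∘ E.symm) (Function.update s i l ∘ E.symm) x l (by simp [h])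
    (by rw [update_comp_symm])
  rwa [update_comp_symm, Function.comp_apply, E.symm_apply_apply,
    Function.update_of_ne hij.symm] at this

/-- Moving everything from one stack to another one. -/
def moveAll (i j : Fin K) : StackProgram K S := .loop i Option.isSome (.move i j)

theorem does_moveAll {i j : ι} (hij : i ≠ j) (s : ι → List S) :
    Does E (moveAll (E i) (E j)) s
      (Function.update (Function.update s i []) j ((s i).reverse ++ s j)) ((s i).length * 2 + 1) := by
  have h := does_loop (E := E) (i := i) (t := Option.isSome) (p := .move (E i) (E j)) (T := 1)
    (s i).length (fun c => Function.update (Function.update s i ((s i).drop c)) j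
      (((s i).take c).reverse ++ s j)) ?_ ?_
  · simpa [moveAll] using h
  · intro c hc
    obtain ⟨a, hd, ht⟩ := exists_drop_eq_cons hc
    refine ⟨by simp [hij, hd], ?_⟩
    have := does_move (E := E) hij (Function.update (Function.update s i ((s i).drop c)) j
      (((s i).take c).reverse ++ s j)) a ((s i).drop (c + 1)) (by simp [hij, hd])
    refine this.cast ?_ le_rfl
    funext k
    by_cases hj : k = j
    · subst hj; simp [ht]
    · by_cases hi : k = i
      · subst hi; simp [hij]
      · simp [hi, hj]
  · simp [hij]

/-- Emptying a stack. -/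
def clear (i : Fin K) : StackProgram K S := .loop i Option.isSome (.pop i)

theorem does_clear (i : ι) (s : ι → List S) :
    Does E (clear (E i)) s (Function.update s i []) ((s i).length * 2 + 1) := by
  have h := does_loop (E := E) (i := i) (t := Option.isSome) (p := .pop (E i)) (T := 1)
    (s i).length (fun c => Function.update s i ((s i).drop c)) ?_ ?_
  · simpa [clear] using h
  · intro c hc
    obtain ⟨a, hd, -⟩ := exists_drop_eq_cons hc
    refine ⟨by simp [hd], ?_⟩
    have := does_pop (E := E) i (Function.update s i ((s i).drop c))
    simpa using this
  · simp

/-- Writing a copy of the numeral on stack `i` on top of stack `y`, with the help of stack `u`. -/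
def copy (x : S) (i u y : Fin K) : StackProgram K S :=
  .seq (.loop i Option.isSome (.seq (.move i u) (.push y x))) (moveAll u i)

/-- A stack can only be read destructively, so the marks are moved to the empty stack `u` while a
copy is written, and then moved back: three steps and two steps per mark. -/
theorem does_copy {x : S} {i u y : ι} (hiu : i ≠ u) (hiy : i ≠ y) (huy : u ≠ y) (s : ι → List S)
    (a : ℕ) (hi : s i = List.replicate a x) (hu : s u = []) :
    Does E (copy x (E i) (E u) (E y)) s (Function.update s y (List.replicate a x ++ s y))
      (5 * a + 2) := by
  have h1 := does_loop (E := E) (i := i) (t := Option.isSome)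
    (p := .seq (.move (E i) (E u)) (.push (E y) x)) (T := 2) a
    (fun c => Function.update (Function.update (Function.update s i (List.replicate (a - c) x)) u
      (List.replicate c x)) y (List.replicate c x ++ s y)) ?_ ?_
  · have h2 := does_moveAll (E := E) hiu.symm (Function.update (Function.update
      (Function.update s i (List.replicate (a - a) x)) u
      (List.replicate a x)) y (List.replicate a x ++ s y))
    have e1 : (Function.update (Function.update (Function.update s i (List.replicate (a - 0) x)) u
      (List.replicate 0 x)) y (List.replicate 0 x ++ s y)) = s := by
      funext k
      simp only [Function.update_apply]
      split_ifs with h h' h''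
      · subst h; rfl
      · subst h'; simp [hu]
      · subst h''; simp [hi]
      · rfl
    rw [e1] at h1
    refine (h1.seq h2).cast ?_ ?_
    · funext k
      simp only [Function.update_apply]
      split_ifs <;> simp_all
    · simp [huy]; omega
  · intro c hc
    obtain ⟨b, hb⟩ : ∃ b, a - c = b + 1 := ⟨a - c - 1, by omega⟩
    have hb' : a - (c + 1) = b := by omega
    refine ⟨by simp [hiy, hiu, hb, List.replicate_succ], ?_⟩
    have m1 := does_move (E := E) hiu (Function.update (Function.update (Function.update s i
      (List.replicate (a - c) x)) u (List.replicate c x)) y (List.replicate c x ++ s y)) x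
      (List.replicate b x) (by simp [hiy, hiu, hb, List.replicate_succ])
    refine (m1.seq (does_push (E := E) y x _)).cast ?_ le_rfl
    funext k
    simp only [Function.update_apply, hb']
    split_ifs <;> simp_all [List.replicate_succ]
  · simp [hiy, hiu]

/-- Writing a copy of the top symbol of stack `i`, which must be in `L`, on top of stack `y`. -/
def dupTop (i y : Fin K) : List S → StackProgram K S
  | [] => skip i
  | x :: L => open scoped Classical in
      .ite i (fun o => decide (o = some x)) (.push y x) (dupTop i y L)

/-- Tests see a symbol but a push needs it as a constant, so the top symbol is compared with all
members of a finite list. -/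
theorem does_dupTop {i y : ι} (L : List S) (s : ι → List S) (x : S) (hx : x ∈ L)
    (h : (s i).head? = some x) :
    Does E (dupTop (E i) (E y) L) s (Function.update s y (x :: s y)) (L.length + 1) := by
  induction L with
  | nil => simp at hx
  | cons a L ih =>
    by_cases ha : x = a
    · subst ha
      exact (does_ite_true (by simp [h]) (does_push y x s)).mono (by simp)
    · exact (does_ite_false (by simp [h, ha]) (ih (by simpa [ha] using hx))).mono (by simp)

end

/-! ### Space bounds and relabelling of stacks -/

/-- Every elementary step lengthens a stack by at most one symbol. Thus bounds on running time also
bound the texts that later stages must copy or move. -/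
theorem Runs.length_le {k : ℕ} {S : Type} {p : StackProgram k S} {σ τ : Fin k → List S} {t : ℕ}
    (h : p.Runs σ τ t) (B : ℕ) (hB : ∀ i, (σ i).length ≤ B) : ∀ i, (τ i).length ≤ B + t := by
  have upd (σ : Fin k → List S) (B B' : ℕ) (hB : ∀ i, (σ i).length ≤ B) (hBB : B ≤ B') (i : Fin k)
      (l : List S) (hl : l.length ≤ B') : ∀ j, (Function.update σ i l j).length ≤ B' := by
    intro j
    rw [Function.update_apply]
    split_ifs
    · exact hl
    · exact (hB j).trans hBB
  induction h generalizing B with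
  | push i s σ => exact upd σ B _ hB (by omega) i _ (by simpa using hB i)
  | pop i σ => exact upd σ B _ hB (by omega) i _ (by have := hB i; simp; omega)
  | move_nil i j σ h => exact fun i => (hB i).trans (by omega)
  | move_cons i j σ τ s l h hτ =>
    have h1 : ∀ j, (τ j).length ≤ B := by
      rw [hτ]
      refine upd σ B _ hB le_rfl i _ ?_
      have := hB i
      rw [h] at this
      simp at this
      omega
    exact upd τ B _ h1 (by omega) j _ (by simpa using h1 j)
  | seq p q σ τ υ m n hp hq ihp ihq =>
    intro i
    have := ihq (B + m) (ihp B hB) i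
    omega
  | ite_true i t p q σ τ n h hp ih => intro i; have := ih B hB i; omega
  | ite_false i t p q σ τ n h hp ih => intro i; have := ih B hB i; omega
  | loop_stop i t p σ h => exact fun i => (hB i).trans (by omega)
  | loop_step i t p σ τ υ m n h hp hl ihp ihl =>
    intro i
    have := ihl (B + m) (ihp B hB) i
    omega

/-- A frame rule: a program touches only the stacks that it names, so it can run on the left summand
while the additional stacks `r` keep their contents. -/
theorem Runs.does_map {k K : ℕ} {S R : Type} [DecidableEq R] {E : Fin k ⊕ R ≃ Fin K}
    {p : StackProgram k S} {σ τ : Fin k → List S} {t : ℕ} (h : p.Runs σ τ t) (r : R → List S) :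
    (p.map (E ∘ Sum.inl)).Runs (Sum.elim σ r ∘ E.symm) (Sum.elim τ r ∘ E.symm) t := by
  induction h with
  | push i s σ =>
    have := Runs.push (E (Sum.inl i)) s (Sum.elim σ r ∘ E.symm)
    rwa [update_comp_symm, Function.comp_apply, E.symm_apply_apply, Sum.elim_inl,
      Sum.update_elim_inl] at this
  | pop i σ =>
    have := Runs.pop (E (Sum.inl i)) (Sum.elim σ r ∘ E.symm)
    rwa [update_comp_symm, Function.comp_apply, E.symm_apply_apply, Sum.elim_inl,
      Sum.update_elim_inl] at this
  | move_nil i j σ h => exact .move_nil _ _ _ (by simp [h])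
  | move_cons i j σ τ s l h hτ =>
    have := Runs.move_cons (E (Sum.inl i)) (E (Sum.inl j)) (Sum.elim σ r ∘ E.symm)
      (Sum.elim τ r ∘ E.symm) s l (by simp [h])
      (by rw [update_comp_symm, Sum.update_elim_inl, hτ])
    rwa [update_comp_symm, Function.comp_apply, E.symm_apply_apply, Sum.elim_inl,
      Sum.update_elim_inl] at this
  | seq p q σ τ υ m n hp hq ihp ihq => exact .seq _ _ _ _ _ _ _ ihp ihq
  | ite_true i t p q σ τ n h hp ih => exact .ite_true _ _ _ _ _ _ _ (by simpa using h) ih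
  | ite_false i t p q σ τ n h hp ih => exact .ite_false _ _ _ _ _ _ _ (by simpa using h) ih
  | loop_stop i t p σ h => exact loop_stop _ _ _ _ (by simpa using h)
  | loop_step i t p σ τ υ m n h hp hl ihp ihl =>
    exact .loop_step _ _ _ _ _ _ _ _ (by simpa using h) ihp ihl

end StackProgram

/-! ### Printing descriptions of circuits -/

/-- A symbol, or a numeral: `0` is the size parameter, `1` the number of qubits of a given circuit,
and `2` the loop counter. -/
inductive Atom (S : Type) : Type
  | sym (s : S) : Atom S
  | num (v : Fin 3) : Atom S

/-- A piece of text: a line, a line for each value of the loop counter, or a copy of the gates of a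
given circuit, with a line added after each symbol that is not a mark. -/
inductive Stage (S : Type) : Type
  | line (l : List (Atom S)) : Stage S
  | loop (l : List (Atom S)) : Stage S
  | scan (l : List (Atom S)) : Stage S

/-- The text of a line. -/
def evalLine {S : Type} (x : S) (env : Fin 3 → ℕ) (l : List (Atom S)) : List S :=
  l.flatMap fun
    | .sym s => [s]
    | .num v => List.replicate (env v) x

/-- The text of a stage. -/
def Stage.eval {S : Type} (x : S) (n w : ℕ) (D : List S) : Stage S → List S
  | .line l => evalLine x ![n, w, 0] l
  | .loop l => (List.range n).flatMap fun j => evalLine x ![n, w, j] l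
  | .scan l => open scoped Classical in
      D.flatMap fun s => s :: if s = x then [] else evalLine x ![n, w, 0] l

/-- The stacks used for printing. -/
inductive Reg : Type
  | out | back | tmp | cnt
  | var (v : Fin 3)
  deriving DecidableEq, Fintype

namespace StackProgram

section
variable {k K : ℕ} {S : Type} (x : S) (E : Fin (k + 1) ⊕ Reg ≃ Fin K)

/-- The program for a line. -/
def lineProg : List (Atom S) → StackProgram K S
  | [] => skip (E (.inr .out))
  | .sym s :: l => .seq (.push (E (.inr .out)) s) (lineProg l)
  | .num v :: l =>
      .seq (copy x (E (.inr (.var v))) (E (.inr .tmp)) (E (.inr .out))) (lineProg l)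

/-- The stacks `s` hold the numerals `env` and the text `D`. -/
structure Holds (s : Fin (k + 1) ⊕ Reg → List S) (env : Fin 3 → ℕ) (D : List S) : Prop where
  var : ∀ v, s (.inr (.var v)) = List.replicate (env v) x
  tmp : s (.inr .tmp) = []
  cnt : s (.inr .cnt) = []
  back : s (.inr .back) = []
  text : s (.inl 0) = D

variable {x E}

theorem Holds.update {s : Fin (k + 1) ⊕ Reg → List S} {env : Fin 3 → ℕ} {D : List S}
    (h : Holds x s env D) (l : List S) : Holds x (Function.update s (.inr .out) l) env D where
  var v := by simpa using h.var v
  tmp := by simpa using h.tmp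
  cnt := by simpa using h.cnt
  back := by simpa using h.back
  text := by simpa using h.text

/-- The text is pushed symbol by symbol and therefore appears reversed on the output stack; a single
`moveAll` at the very end restores the order. -/
theorem does_lineProg (l : List (Atom S)) {M : ℕ} (s : Fin (k + 1) ⊕ Reg → List S)
    (env : Fin 3 → ℕ) (hv : ∀ v, s (.inr (.var v)) = List.replicate (env v) x)
    (ht : s (.inr .tmp) = []) (hM : ∀ v, env v ≤ M) :
    Does E (lineProg x E l) s
      (Function.update s (.inr .out) ((evalLine x env l).reverse ++ s (.inr .out)))
      (l.length * (5 * M + 2) + 1) := by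
  induction l generalizing s with
  | nil =>
    have := does_skip (E := E) (.inr .out) s
    simpa [evalLine, lineProg] using this
  | cons a l ih =>
    cases a with
    | sym b =>
      have h := (does_push (E := E) (.inr .out) b s).seq (ih _ (by simpa using hv) (by simpa using ht))
      refine Does.mono (T := 1 + (l.length * (5 * M + 2) + 1)) ?_ ?_
      · simpa [evalLine, lineProg] using h
      · simp only [List.length_cons, Nat.succ_mul]; omega
    | num v =>
      have h := (does_copy (E := E) (x := x) (i := .inr (.var v)) (u := .inr .tmp) (y := .inr .out)
        (by simp) (by simp) (by simp) s (env v) (hv v) ht).seq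
          (ih _ (by simpa using hv) (by simpa using ht))
      refine Does.mono (T := 5 * env v + 2 + (l.length * (5 * M + 2) + 1)) ?_ ?_
      · simpa [evalLine, lineProg] using h
      · have := hM v
        simp only [List.length_cons, Nat.succ_mul]; omega

/-- The program for a stage; `L` is a list of all symbols. -/
def stageProg (x : S) (E : Fin (k + 1) ⊕ Reg ≃ Fin K) (L : List S) : Stage S → StackProgram K S
  | .line l => lineProg x E l
  | .loop l =>
      .seq (copy x (E (.inr (.var 0))) (E (.inr .tmp)) (E (.inr .cnt)))
        (.seq (.loop (E (.inr .cnt)) Option.isSome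
          (.seq (lineProg x E l)
            (.seq (.pop (E (.inr .cnt))) (.push (E (.inr (.var 2))) x))))
          (clear (E (.inr (.var 2)))))
  | .scan l => open scoped Classical in
      .seq (.loop (E (.inl 0)) Option.isSome
          (.seq (dupTop (E (.inl 0)) (E (.inr .out)) L)
            (.seq (.ite (E (.inl 0)) (fun o => decide (o = some x)) (skip (E (.inr .out)))
                (lineProg x E l))
              (.move (E (.inl 0)) (E (.inr .back))))))
        (moveAll (E (.inr .back)) (E (.inl 0)))

/-- The constant is chosen before the sizes, which gives a polynomial bound: a stage makes at most
`M` rounds, each linear in `M`, so quadratic time suffices. -/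
theorem does_stageProg (L : List S) (hL : ∀ s, s ∈ L) (st : Stage S) :
    ∃ c, ∀ (M n w : ℕ) (D : List S) (s : Fin (k + 1) ⊕ Reg → List S), n ≤ M → w ≤ M →
      D.length ≤ M → Holds x s ![n, w, 0] D →
      Does E (stageProg x E L st) s
        (Function.update s (.inr .out) ((st.eval x n w D).reverse ++ s (.inr .out)))
        (c * (M + 1) ^ 2) := by
  cases st with
  | line l =>
    refine ⟨l.length * 5 + 1, fun M n w D s hn hw hD hs => ?_⟩
    refine (does_lineProg l s _ hs.var hs.tmp (M := M) ?_).mono ?_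
    · intro v; fin_cases v <;> simp [hn, hw]
    · nlinarith [Nat.zero_le M, Nat.zero_le l.length, Nat.zero_le (M * l.length),
        Nat.zero_le (M * M * l.length)]
  | loop l =>
    refine ⟨l.length * 5 + 20, fun M n w D s hn hw hD hs => ?_⟩
    have h1 := does_copy (E := E) (x := x) (i := .inr (.var 0)) (u := .inr .tmp) (y := .inr .cnt)
        (by simp) (by simp) (by simp) s n (hs.var 0) hs.tmp
    rw [hs.cnt, List.append_nil] at h1
    set o := s (.inr .out) with ho
    -- Invariant: after `c` rounds the remaining count is n - c, the variable `2` holds the numeral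
    -- `c`, and the lines for the smaller counters have been written.
    let text (c : ℕ) : List S := (List.range c).flatMap fun j => evalLine x ![n, w, j] l
    have h2 := does_loop (E := E) (i := .inr .cnt) (t := Option.isSome)
      (p := .seq (lineProg x E l) (.seq (.pop (E (.inr .cnt))) (.push (E (.inr (.var 2))) x)))
      (T := l.length * (5 * M + 2) + 1 + (1 + 1)) n
      (fun c => Function.update (Function.update (Function.update s (.inr .cnt)
        (List.replicate (n - c) x)) (.inr (.var 2)) (List.replicate c x)) (.inr .out)
        ((text c).reverse ++ o)) ?_ ?_
    · have h3 := does_clear (E := E) (.inr (.var 2)) (Function.update (Function.update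
        (Function.update s (.inr .cnt)
        (List.replicate (n - n) x)) (.inr (.var 2)) (List.replicate n x)) (.inr .out)
        ((text n).reverse ++ o))
      have e1 : Function.update (Function.update (Function.update s (.inr .cnt)
        (List.replicate (n - 0) x)) (.inr (.var 2)) (List.replicate 0 x)) (.inr .out)
        ((text 0).reverse ++ o) = Function.update s (.inr .cnt) (List.replicate n x) := by
        have hv2 := hs.var 2
        funext r
        simp only [Function.update_apply, text]
        split_ifs <;> simp_all
      rw [e1] at h2
      refine (h1.seq (h2.seq h3)).cast ?_ ?_
      · have hv2 := hs.var 2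
        have hc := hs.cnt
        funext r
        simp only [Function.update_apply, text, Stage.eval]
        split_ifs <;> simp_all
      · have hl : ((Function.update (Function.update
        (Function.update s (.inr .cnt)
        (List.replicate (n - n) x)) (.inr (.var 2)) (List.replicate n x)) (.inr .out)
        ((text n).reverse ++ o)) (.inr (.var 2))).length = n := by simp
        rw [hl]
        have e2 : n * (l.length * (5 * M + 2) + 1 + (1 + 1) + 1) ≤
            M * (l.length * (5 * M + 2) + 1 + (1 + 1) + 1) := Nat.mul_le_mul_right _ hn
        nlinarith [Nat.zero_le M, Nat.zero_le l.length, Nat.zero_le (M * l.length),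
          Nat.zero_le (M * M * l.length)]
    · intro c hc
      obtain ⟨b, hb⟩ : ∃ b, n - c = b + 1 := ⟨n - c - 1, by omega⟩
      have hb' : n - (c + 1) = b := by omega
      refine ⟨by simp [hb, List.replicate_succ], ?_⟩
      have h3 := does_lineProg (E := E) (x := x) l (M := M) (Function.update (Function.update
        (Function.update s (.inr .cnt)
        (List.replicate (n - c) x)) (.inr (.var 2)) (List.replicate c x)) (.inr .out)
        ((text c).reverse ++ o)) ![n, w, c] ?_ (by simpa using hs.tmp) ?_
      · refine (h3.seq ((does_pop (E := E) (.inr .cnt) _).seq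
          (does_push (E := E) (.inr (.var 2)) x _))).cast ?_ le_rfl
        have e : text (c + 1) = text c ++ evalLine x ![n, w, c] l := by
          simp [text, List.range_succ]
        have ec : Function.update (Function.update (Function.update s (.inr .cnt)
            (List.replicate (n - c) x)) (.inr (.var 2)) (List.replicate c x)) (.inr .out)
            ((text c).reverse ++ o) (.inr .cnt) = x :: List.replicate b x := by
          simp [hb, List.replicate_succ]
        have ev : Function.update (Function.update (Function.update s (.inr .cnt)
            (List.replicate (n - c) x)) (.inr (.var 2)) (List.replicate c x)) (.inr .out)
            ((text c).reverse ++ o) (.inr (.var 2)) = List.replicate c x := by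
          simp
        rw [hb', e]
        funext r
        by_cases h0 : r = .inr .out
        · subst h0; simp
        by_cases h1 : r = .inr (.var 2)
        · subst h1; simp [List.replicate_succ]
        by_cases h2 : r = .inr .cnt
        · subst h2; simp [hb, List.replicate_succ]
        simp [h0, h1, h2]
      · intro v
        have h0 := hs.var 0
        have h1 := hs.var 1
        fin_cases v <;> simp_all
      · intro v
        have : c ≤ M := by omega
        fin_cases v <;> simp [hn, hw, this]
    · simp
  | scan l =>
    classical
    refine ⟨l.length * 5 + L.length + 20, fun M n w D s hn hw hD hs => ?_⟩
    set o := s (.inr .out) with ho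
    -- Invariant: after `c` rounds the first `c` symbols of `D` lie reversed on the stack `back`,
    -- and their annotated copy has been written; the final `moveAll` restores `D` for further
    -- stages.
    let text (D : List S) : List S :=
      D.flatMap fun s => s :: if s = x then [] else evalLine x ![n, w, 0] l
    have h2 := does_loop (E := E) (i := .inl 0) (t := Option.isSome)
      (p := .seq (dupTop (E (.inl 0)) (E (.inr .out)) L)
            (.seq (.ite (E (.inl 0)) (fun o => decide (o = some x)) (skip (E (.inr .out)))
                (lineProg x E l))
              (.move (E (.inl 0)) (E (.inr .back)))))
      (T := L.length + 1 + (l.length * (5 * M + 2) + 1 + 1 + 1)) D.length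
      (fun c => Function.update (Function.update (Function.update s (.inl 0) (D.drop c))
        (.inr .back) (D.take c).reverse) (.inr .out) ((text (D.take c)).reverse ++ o)) ?_ ?_
    · have h3 := does_moveAll (E := E) (i := .inr .back) (j := .inl 0) (by simp)
        (Function.update (Function.update (Function.update s (.inl 0) (D.drop D.length))
        (.inr .back) (D.take D.length).reverse) (.inr .out) ((text (D.take D.length)).reverse ++ o))
      have e1 : Function.update (Function.update (Function.update s (.inl 0) (D.drop 0))
        (.inr .back) (D.take 0).reverse) (.inr .out) ((text (D.take 0)).reverse ++ o) = s := by
        have hb := hs.back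
        have hd := hs.text
        funext r
        simp only [Function.update_apply, text]
        split_ifs <;> simp_all
      rw [e1] at h2
      refine (h2.seq h3).cast ?_ ?_
      · have hb := hs.back
        have hd := hs.text
        funext r
        simp only [Function.update_apply, text, Stage.eval]
        split_ifs <;> simp_all
      · have hl : ((Function.update (Function.update (Function.update s (.inl 0) (D.drop D.length))
          (.inr .back) (D.take D.length).reverse) (.inr .out)
          ((text (D.take D.length)).reverse ++ o)) (.inr .back)).length = D.length := by simp
        rw [hl]
        have e2 : D.length * (L.length + 1 + (l.length * (5 * M + 2) + 1 + 1 + 1) + 1) ≤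
            M * (L.length + 1 + (l.length * (5 * M + 2) + 1 + 1 + 1) + 1) :=
          Nat.mul_le_mul_right _ hD
        nlinarith [Nat.zero_le M, Nat.zero_le l.length, Nat.zero_le (M * l.length),
          Nat.zero_le (M * M * l.length), Nat.zero_le L.length, Nat.zero_le (M * L.length),
          Nat.zero_le (M * M * L.length)]
    · intro c hc
      obtain ⟨a, hd, hta⟩ := exists_drop_eq_cons hc
      refine ⟨by simp [hd], ?_⟩
      have h3 := does_dupTop (E := E) (i := .inl 0) (y := .inr .out) L
        (Function.update (Function.update (Function.update s (.inl 0) (D.drop c))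
        (.inr .back) (D.take c).reverse) (.inr .out) ((text (D.take c)).reverse ++ o)) a (hL _)
        (by simp [hd])
      have h4 : Does E (.ite (E (.inl 0)) (fun o => decide (o = some x)) (skip (E (.inr .out)))
          (lineProg x E l)) (Function.update (Function.update (Function.update s (.inl 0) (D.drop c))
            (.inr .back) (D.take c).reverse) (.inr .out) (a :: ((text (D.take c)).reverse ++ o)))
          (Function.update (Function.update (Function.update s (.inl 0) (D.drop c))
            (.inr .back) (D.take c).reverse) (.inr .out) ((text (D.take (c + 1))).reverse ++ o))
          (l.length * (5 * M + 2) + 1 + 1) := by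
        have e : text (D.take (c + 1)) = text (D.take c) ++
            (a :: if a = x then [] else evalLine x ![n, w, 0] l) := by
          simp [text, hta]
        by_cases hx : a = x
        · refine (does_ite_true (by simp [hd, hx]) ?_).mono (?_ : 1 + 1 ≤ _)
          · refine (does_skip (E := E) (.inr .out) _).cast ?_ le_rfl
            rw [e]
            simp [hx]
          · omega
        · refine does_ite_false (by simp [hd, hx]) ?_
          refine (does_lineProg (E := E) (x := x) l (M := M) _ ![n, w, 0] ?_ ?_ ?_).cast ?_ le_rfl
          · intro v
            simpa using hs.var v
          · simpa using hs.tmp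
          · intro v
            fin_cases v <;> simp [hn, hw]
          · rw [e]
            simp [hx]
      have h5 := does_move (E := E) (i := .inl 0) (j := .inr .back) (by simp)
        (Function.update (Function.update (Function.update s (.inl 0) (D.drop c))
            (.inr .back) (D.take c).reverse) (.inr .out) ((text (D.take (c + 1))).reverse ++ o))
        a (D.drop (c + 1)) (by simp [hd])
      rw [Function.update_idem, Function.update_self] at h3
      refine (h3.seq (h4.seq h5)).cast ?_ le_rfl
      funext r
      simp only [Function.update_apply]
      split_ifs <;> simp_all
    · simp

/-- The program for a list of stages. -/
def stagesProg (x : S) (E : Fin (k + 1) ⊕ Reg ≃ Fin K) (L : List S) :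
    List (Stage S) → StackProgram K S
  | [] => skip (E (.inr .out))
  | st :: l => .seq (stageProg x E L st) (stagesProg x E L l)

theorem does_stagesProg (L : List S) (hL : ∀ s, s ∈ L) (sts : List (Stage S)) :
    ∃ c, ∀ (M n w : ℕ) (D : List S) (s : Fin (k + 1) ⊕ Reg → List S), n ≤ M → w ≤ M →
      D.length ≤ M → Holds x s ![n, w, 0] D →
      Does E (stagesProg x E L sts) s
        (Function.update s (.inr .out)
          ((sts.flatMap (Stage.eval x n w D)).reverse ++ s (.inr .out)))
        (c * (M + 1) ^ 2) := by
  induction sts with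
  | nil =>
    refine ⟨1, fun M n w D s _ _ _ _ => ?_⟩
    have := does_skip (E := E) (.inr .out) s
    exact Does.mono (by simpa [stagesProg] using this) (by nlinarith)
  | cons st l ih =>
    obtain ⟨c, hc⟩ := ih
    obtain ⟨c', hc'⟩ := does_stageProg (E := E) (x := x) L hL st
    refine ⟨c' + c, fun M n w D s hn hw hD hs => ?_⟩
    have h := (hc' M n w D s hn hw hD hs).seq (hc M n w D _ hn hw hD (hs.update _))
    rw [add_mul]
    simpa [stagesProg] using h

end

end StackProgram

open StackProgram in
/-- Texts made from a polynomial-time text are polynomial-time. -/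
theorem PolyTimeFromUnary.stages {S : Type} [Finite S] {x : S} {w : ℕ → ℕ} {D : ℕ → List S}
    (hD : ∀ n, (D n).head? ≠ some x)
    (h : PolyTimeFromUnary x fun n => List.replicate (w n) x ++ D n) (sts : List (Stage S)) :
    PolyTimeFromUnary x fun n => sts.flatMap (Stage.eval x n (w n) (D n)) := by
  classical
  obtain ⟨k, P, q, hP⟩ := h
  have := Fintype.ofFinite S
  obtain ⟨K, hK⟩ := Nat.exists_eq_succ_of_ne_zero
    (Fintype.card_ne_zero (α := Fin (k + 1) ⊕ Reg))
  -- Stack `0` serves as the register of the size parameter: the unary input is already there, and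
  -- the final text must end up there. The given program gets its own stacks and a copy of the
  -- input.
  obtain ⟨E, hE⟩ : ∃ E : Fin (k + 1) ⊕ Reg ≃ Fin (K + 1), E (.inr (.var 0)) = 0 :=
    ⟨(Fintype.equivFinOfCardEq hK).trans (Equiv.swap (Fintype.equivFinOfCardEq hK (.inr (.var 0))) 0), by simp⟩
  obtain ⟨c, hc⟩ := does_stagesProg (E := E) (x := x) Finset.univ.toList (by simp) sts
  let prog : StackProgram (K + 1) S :=
    .seq (copy x (E (.inr (.var 0))) (E (.inr .tmp)) (E (.inl 0)))
      (.seq (P.map (E ∘ Sum.inl))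
        (.seq (.loop (E (.inl 0)) (fun o => decide (o = some x))
            (.move (E (.inl 0)) (E (.inr (.var 1)))))
          (.seq (stagesProg x E Finset.univ.toList sts)
            (.seq (clear (E (.inr (.var 0))))
              (moveAll (E (.inr .out)) (E (.inr (.var 0))))))))
  -- When the given program halts, no stack is longer than its initial length, at most `n`, plus the
  -- running time. So `M` bounds the size, the width and the text at once.
  let M : Polynomial ℕ := Polynomial.X + q
  let Tc : Polynomial ℕ := Polynomial.C c * (M + 1) ^ 2
  let T5 : Polynomial ℕ := 5 * Polynomial.X + 2 + (q + ((M * 2 + 1) + (Tc +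
    ((Polynomial.X * 2 + 1) + ((M + Tc) * 2 + 1)))))
  refine ⟨K, prog, T5, fun n => ?_⟩
  obtain ⟨τ, t, hrun, hτ, ht⟩ := hP n
  simp only at hτ
  have hlen : (τ 0).length ≤ M.eval n := by
    have := hrun.length_le n (fun i => by split_ifs <;> simp) 0
    simp [M]
    omega
  rw [hτ] at hlen
  simp only [List.length_append, List.length_replicate] at hlen
  let s₀ : Fin (k + 1) ⊕ Reg → List S :=
    Function.update (fun _ => []) (.inr (.var 0)) (List.replicate n x)
  have h1 := does_copy (E := E) (x := x) (i := .inr (.var 0)) (u := .inr .tmp) (y := .inl 0)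
    (by simp) (by simp) (by simp) s₀ n (by simp [s₀]) (by simp [s₀])
  have e1 : Function.update s₀ (.inl 0) (List.replicate n x ++ s₀ (.inl 0)) =
      Sum.elim (fun i => if i = 0 then List.replicate n x else []) (s₀ ∘ Sum.inr) := by
    funext i
    rcases i with i | i
    · by_cases hi : i = 0
      · subst hi; simp [s₀]
      · simp [s₀, hi]
    · simp
  rw [e1] at h1
  have h2 : Does E (P.map (E ∘ Sum.inl)) _ (Sum.elim τ (s₀ ∘ Sum.inr)) (q.eval n) :=
    ⟨t, ht, hrun.does_map _⟩
  obtain ⟨s₁, hs₁⟩ : ∃ s₁ : Fin (k + 1) ⊕ Reg → List S, s₁ = Sum.elim τ (s₀ ∘ Sum.inr) := ⟨_, rfl⟩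
  rw [← hs₁] at h2
  have hl₁ : s₁ (.inl 0) = List.replicate (w n) x ++ D n := by rw [hs₁, ← hτ]; rfl
  have hr₁ (r : Reg) : s₁ (.inr r) = if r = .var 0 then List.replicate n x else [] := by
    rw [hs₁]
    simp [s₀, Function.update_apply]
  have hb₁ (i) : (s₁ i).length ≤ M.eval n := by
    rcases i with i | r
    · have := hrun.length_le n (fun i => by split_ifs <;> simp) i
      rw [hs₁]
      simp [M]
      omega
    · rw [hr₁]
      split_ifs <;> simp [M]
  clear hs₁
  let s₂ (a : ℕ) : Fin (k + 1) ⊕ Reg → List S := Function.update (Function.update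
    s₁ (.inl 0) (List.replicate (w n - a) x ++ D n)) (.inr (.var 1)) (List.replicate a x)
  have h3 := does_loop (E := E) (i := .inl 0) (t := fun o => decide (o = some x))
    (p := .move (E (.inl 0)) (E (.inr (.var 1)))) (T := 1) (w n) s₂ ?_ ?_
  · have e2 : s₂ 0 = s₁ := by
      funext i
      simp only [s₂, Function.update_apply]
      split_ifs with h h'
      · subst h; simp [hr₁]
      · subst h'; simp [hl₁]
      · rfl
    rw [e2] at h3
    have hs : Holds x (s₂ (w n)) ![n, w n, 0] (D n) := by
      refine ⟨fun v => ?_, ?_, ?_, ?_, ?_⟩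
      · fin_cases v <;> simp [s₂, hr₁]
      all_goals simp [s₂, hr₁]
    have hn : n ≤ M.eval n := by simp [M]
    have h4 := hc (M.eval n) n (w n) (D n) (s₂ (w n)) hn (by omega) (by omega) hs
    have ho : s₂ (w n) (.inr .out) = [] := by simp [s₂, hr₁]
    rw [ho, List.append_nil] at h4
    set R := sts.flatMap (Stage.eval x n (w n) (D n)) with hR
    have e : Tc.eval n = c * (M.eval n + 1) ^ 2 := by simp [Tc]
    rw [← e] at h4
    -- The length of the new text, needed for the cost of the last move, is read off from the time
    -- spent printing it.
    have hRl : R.length ≤ M.eval n + Tc.eval n := by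
      obtain ⟨t', ht', hr'⟩ := h4
      have := hr'.length_le (M.eval n) (fun i => by
        simp only [s₂, Function.comp_apply, Function.update_apply]
        split_ifs
        · simp; omega
        · simp; omega
        · exact hb₁ _) (E (.inr .out))
      simp at this
      omega
    have h5 := does_clear (E := E) (.inr (.var 0)) (Function.update (s₂ (w n)) (.inr .out) R.reverse)
    have h6 := does_moveAll (E := E) (i := .inr .out) (j := .inr (.var 0)) (by simp) (Function.update
      (Function.update (s₂ (w n)) (.inr .out) R.reverse) (.inr (.var 0)) [])
    obtain ⟨t', ht', hr'⟩ := h1.seq (h2.seq (h3.seq (h4.seq (h5.seq h6))))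
    refine ⟨Function.update (Function.update (Function.update (Function.update (s₂ (w n))
      (.inr .out) R.reverse) (.inr (.var 0)) []) (.inr .out) []) (.inr (.var 0)) R ∘ E.symm, t',
      ?_, ?_, ?_⟩
    · convert hr' using 1
      · funext i
        obtain ⟨i, rfl⟩ := E.surjective i
        simp only [s₀, Function.comp_apply, E.symm_apply_apply, Function.update_apply, ← hE,
          E.injective.eq_iff]
      · simp
    · have : E.symm 0 = .inr (.var 0) := by rw [← hE, E.symm_apply_apply]
      simp [this, hR]
    · refine ht'.trans ?_
      have l1 : (Function.update (s₂ (w n)) (.inr .out) R.reverse (.inr (.var 0))).length = n := by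
        simp [s₂, hr₁]
      have l2 : (Function.update (Function.update (s₂ (w n)) (.inr .out) R.reverse)
          (.inr (.var 0)) [] (.inr .out)).length = R.length := by simp
      rw [l1, l2]
      simp only [T5, Polynomial.eval_add, Polynomial.eval_mul, Polynomial.eval_X,
        Polynomial.eval_ofNat, Polynomial.eval_one]
      omega
  · intro a ha
    obtain ⟨b, hb⟩ : ∃ b, w n - a = b + 1 := ⟨w n - a - 1, by omega⟩
    have hb' : w n - (a + 1) = b := by omega
    refine ⟨by simp [s₂, hb, List.replicate_succ], ?_⟩
    refine (does_move (E := E) (by simp) (s₂ a) x (List.replicate b x ++ D n)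
      (by simp [s₂, hb, List.replicate_succ])).cast ?_ le_rfl
    funext i
    by_cases h0 : i = .inr (.var 1)
    · subst h0; simp [s₂, List.replicate_succ]
    by_cases h1 : i = .inl 0
    · subst h1; simp [s₂, hb']
    simp [s₂, h0, h1]
  -- The loop that strips off the leading marks stops exactly after `w n` rounds, because the
  -- remaining text does not begin with a mark.
  · simpa [s₂] using hD n

/-! ### Uniform families from symbolic lists of gates -/

/-- A position that depends linearly on the size parameter, the number of qubits of a given
circuit, and the loop counter. -/
structure Pos where
  const : ℕ
  size : ℕ := 0
  width : ℕ := 0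
  count : ℕ := 0

/-- The value of a position. -/
def Pos.eval (n w j : ℕ) (p : Pos) : ℕ := p.const + p.size * n + p.width * w + p.count * j

/-- The position plus the loop counter. -/
def Pos.step (p : Pos) : Pos := { p with count := 1 }

/-- The following position. -/
def Pos.succ (p : Pos) : Pos := { p with const := p.const + 1 }

theorem Pos.eval_step (n w j : ℕ) (p : Pos) :
    p.step.eval n w j = p.eval n w 0 + j := by
  simp [Pos.eval, Pos.step]

theorem Pos.eval_succ (n w j : ℕ) (p : Pos) : p.succ.eval n w j = 1 + p.eval n w j := by
  simp only [Pos.eval, Pos.succ]; omega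

/-- A part of a circuit: a list of gates, a list of gates for each value of the loop counter, or a
copy of a given circuit. -/
inductive CircuitPart (𝒢 : GateSet) : Type
  | line (l : List (PGate 𝒢 Pos)) : CircuitPart 𝒢
  | loop (l : List (PGate 𝒢 Pos)) : CircuitPart 𝒢
  | block (p : Pos) : CircuitPart 𝒢

section parts

variable {𝒢 : GateSet}

/-- The gates of a part. -/
def CircuitPart.wires {inp out : ℕ} (C : QCircuit 𝒢 inp out) (n : ℕ) : CircuitPart 𝒢 → List (PGate 𝒢 ℕ)
  | line l => l.map (PGate.map (Pos.eval n C.width 0))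
  | loop l => (List.range n).flatMap fun j => l.map (PGate.map (Pos.eval n C.width j))
  | block p => C.gates.map (Gate.wire (p.eval n C.width 0))

/-- The part with all positions increased by one. -/
def CircuitPart.succ : CircuitPart 𝒢 → CircuitPart 𝒢
  | line l => line (l.map (PGate.map Pos.succ))
  | loop l => loop (l.map (PGate.map Pos.succ))
  | block p => block p.succ

theorem PGate.map_map {P Q R : Type} (e : P → Q) (e' : Q → R) (g : PGate 𝒢 P) :
    (g.map e).map e' = g.map (e' ∘ e) := by
  cases g <;> rfl

theorem PGate.map_wire {m : ℕ} (s : ℕ) (g : Gate 𝒢 m) :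
    (g.wire s).map (fun i => 1 + i) = g.wire (1 + s) := by
  cases g <;> simp [Gate.wire, PGate.map, add_assoc]

/-- A shift by one frees position `0` for the committed qubit beside a classical circuit. -/
theorem CircuitPart.wires_succ {inp out : ℕ} (C : QCircuit 𝒢 inp out) (n : ℕ) (p : CircuitPart 𝒢) :
    p.succ.wires C n = (p.wires C n).map (PGate.map fun i => 1 + i) := by
  have h (j : ℕ) (g : PGate 𝒢 Pos) : (g.map Pos.succ).map (Pos.eval n C.width j) =
      (g.map (Pos.eval n C.width j)).map fun i => 1 + i := by
    rw [PGate.map_map, PGate.map_map]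
    congr 1
    funext q
    exact Pos.eval_succ n C.width j q
  cases p with
  | line l => simp [succ, wires, h]
  | loop l => simp [succ, wires, Function.comp_def, h, List.map_flatMap]
  | block p => simp [succ, wires, PGate.map_wire, Pos.eval_succ]

theorem wires_succ {inp out : ℕ} (C : QCircuit 𝒢 inp out) (n : ℕ) (ps : List (CircuitPart 𝒢)) :
    (ps.map CircuitPart.succ).flatMap (CircuitPart.wires C n) =
      (ps.flatMap (CircuitPart.wires C n)).map (PGate.map fun i => 1 + i) := by
  simp [List.flatMap_map, CircuitPart.wires_succ, List.map_flatMap]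

/-- The description of a gate. -/
def PGate.describe : PGate 𝒢 ℕ → List (CircuitSymbol 𝒢)
  | one a i => .one a :: List.replicate i .tick
  | two b i j => .two b :: (List.replicate i .tick ++ .sep :: List.replicate j .tick)

theorem QCircuit.describe_ofWires {inp out : ℕ} (W : ℕ) (h₁ : inp ≤ W) (h₂ : out ≤ W)
    (l : List (PGate 𝒢 ℕ)) (hl : ∀ g ∈ l, g.Valid W) :
    (ofWires W h₁ h₂ l hl : QCircuit 𝒢 inp out).describe =
      List.replicate W .tick ++ l.flatMap PGate.describe := by
  simp only [describe, ofWires]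
  congr 1
  induction l with
  | nil => rfl
  | cons g l ih =>
    rw [List.pmap_cons, List.flatMap_cons, List.flatMap_cons, ih fun g hg => hl g (by simp [hg])]
    cases g <;> rfl

/-- The numeral for a position. -/
def Pos.atoms (p : Pos) : List (Atom (CircuitSymbol 𝒢)) :=
  List.replicate p.const (.sym .tick) ++ List.replicate p.size (.num 0) ++
    List.replicate p.width (.num 1) ++ List.replicate p.count (.num 2)

theorem evalLine_append {S : Type} (x : S) (env : Fin 3 → ℕ) (l l' : List (Atom S)) :
    evalLine x env (l ++ l') = evalLine x env l ++ evalLine x env l' := by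
  simp [evalLine]

theorem evalLine_replicate_num {S : Type} (x : S) (env : Fin 3 → ℕ) (k : ℕ) (v : Fin 3) :
    evalLine x env (List.replicate k (.num v)) = List.replicate (k * env v) x := by
  induction k with
  | zero => simp [evalLine]
  | succ k ih =>
    rw [List.replicate_succ', evalLine_append, ih, Nat.succ_mul, List.replicate_add]
    simp [evalLine]

theorem evalLine_replicate_sym {S : Type} (x : S) (env : Fin 3 → ℕ) (k : ℕ) :
    evalLine x env (List.replicate k (.sym x)) = List.replicate k x := by
  induction k with
  | zero => simp [evalLine]
  | succ k ih =>
    rw [List.replicate_succ', evalLine_append, ih, List.replicate_succ']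
    simp [evalLine]

theorem Pos.evalLine_atoms (n w j : ℕ) (p : Pos) :
    evalLine .tick ![n, w, j] (p.atoms : List (Atom (CircuitSymbol 𝒢))) =
      List.replicate (p.eval n w j) .tick := by
  rw [atoms, evalLine_append, evalLine_append, evalLine_append, evalLine_replicate_num,
    evalLine_replicate_num, evalLine_replicate_num, evalLine_replicate_sym, eval,
    List.replicate_add, List.replicate_add, List.replicate_add]
  rfl

/-- The description of a gate at symbolic positions. -/
def PGate.atoms : PGate 𝒢 Pos → List (Atom (CircuitSymbol 𝒢))
  | one a p => .sym (.one a) :: p.atoms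
  | two b p q => .sym (.two b) :: (p.atoms ++ .sym .sep :: q.atoms)

theorem PGate.evalLine_atoms (n w j : ℕ) (g : PGate 𝒢 Pos) :
    evalLine .tick ![n, w, j] g.atoms = (g.map (Pos.eval n w j)).describe := by
  have hc (s : CircuitSymbol 𝒢) (l : List (Atom (CircuitSymbol 𝒢))) :
      evalLine .tick ![n, w, j] (.sym s :: l) = s :: evalLine .tick ![n, w, j] l := by
    simp [evalLine]
  cases g <;> simp [atoms, hc, evalLine_append, Pos.evalLine_atoms, describe, map]

/-- The text of a part. -/
def CircuitPart.stage : CircuitPart 𝒢 → Stage (CircuitSymbol 𝒢)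
  | line l => .line (l.flatMap PGate.atoms)
  | loop l => .loop (l.flatMap PGate.atoms)
  | block p => .scan p.atoms

/-- In a description each qubit index is a unary numeral standing directly after a symbol other than
`tick`. Adding the numeral of `p` after every such symbol therefore shifts all gates of a block by
`p`. -/
theorem CircuitPart.eval_stage {inp out : ℕ} (C : QCircuit 𝒢 inp out) (n : ℕ) (p : CircuitPart 𝒢) :
    p.stage.eval .tick n C.width (C.gates.flatMap Gate.describe) =
      (p.wires C n).flatMap PGate.describe := by
  have h (j : ℕ) (l : List (PGate 𝒢 Pos)) :
      evalLine .tick ![n, C.width, j] (l.flatMap PGate.atoms) =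
        (l.map (PGate.map (Pos.eval n C.width j))).flatMap PGate.describe := by
    induction l with
    | nil => rfl
    | cons g l ih =>
      rw [List.flatMap_cons, evalLine_append, ih, PGate.evalLine_atoms]
      simp
  cases p with
  | line l => exact h 0 l
  | loop l => simp [stage, Stage.eval, wires, h, List.flatMap_assoc]
  | block p =>
    simp only [stage, Stage.eval, wires, Pos.evalLine_atoms, List.flatMap_assoc, List.flatMap_map]
    congr 1
    funext g
    have ht (k : ℕ) (F : CircuitSymbol 𝒢 → List (CircuitSymbol 𝒢)) (hF : F .tick = [.tick]) :
        (List.replicate k .tick).flatMap F = List.replicate k .tick := by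
      induction k with
      | zero => rfl
      | succ k ih => rw [List.replicate_succ, List.flatMap_cons, ih, hF]; rfl
    cases g
    · simp [Gate.describe, Gate.wire, PGate.describe, ht]
    · simp only [Gate.describe, Gate.wire, PGate.describe, List.replicate_add, List.append_assoc]
      simp [ht]

instance [Finite 𝒢.One] [Finite 𝒢.Two] : Finite (CircuitSymbol 𝒢) := by
  have : Function.Injective fun s : CircuitSymbol 𝒢 =>
      (match s with
        | .one a => .inl (.inl a)
        | .two b => .inl (.inr b)
        | .tick => .inr true
        | .sep => .inr false : (𝒢.One ⊕ 𝒢.Two) ⊕ Bool) := by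
    intro s t h
    cases s <;> cases t <;> simp_all
  exact Finite.of_injective _ this

/-- A single symbolic list `ps` must serve all `n`; only then is the printing program independent of
`n`. Finiteness of the gate set makes the alphabet finite, as `dupTop` requires. -/
theorem IsUniformFamily.ofWires [Finite 𝒢.One] [Finite 𝒢.Two] {inp out inp' out' : ℕ → ℕ}
    {C : ∀ n, QCircuit 𝒢 (inp n) (out n)} (hC : IsUniformFamily C) (ps : List (CircuitPart 𝒢)) (W : Pos)
    (D : ∀ n, QCircuit 𝒢 (inp' n) (out' n))
    (hD : ∀ n, ∃ h₁ h₂ hl, D n = QCircuit.ofWires (W.eval n (C n).width 0) h₁ h₂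
      (ps.flatMap (CircuitPart.wires (C n) n)) hl) : IsUniformFamily D := by
  have h := PolyTimeFromUnary.stages (w := fun n => (C n).width)
    (D := fun n => (C n).gates.flatMap Gate.describe) (fun n => ?_) hC
    (.line W.atoms :: ps.map CircuitPart.stage)
  · unfold IsUniformFamily
    convert h using 1
    funext n
    obtain ⟨h₁, h₂, hl, e⟩ := hD n
    rw [e, QCircuit.describe_ofWires]
    rw [List.flatMap_cons, Stage.eval, Pos.evalLine_atoms, List.flatMap_map, List.flatMap_assoc]
    simp only [CircuitPart.eval_stage]
  · cases (C n).gates with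
    | nil => simp
    | cons g l => cases g <;> simp [Gate.describe]

end parts

/-! ### Slices of bit strings -/

theorem fst_sliceBits (a b s : ℕ) (z : ℕ → Bool) :
    (sliceBits (a + b) s z).fst = sliceBits a s z := rfl

theorem snd_sliceBits (a b s : ℕ) (z : ℕ → Bool) :
    (sliceBits (a + b) s z).snd = sliceBits b (s + a) z := by
  funext i; simp [BitString.snd, sliceBits, add_assoc]

theorem sliceBits_add (a b s : ℕ) (z : ℕ → Bool) :
    sliceBits (a + b) s z = Fin.append (sliceBits a s z) (sliceBits b (s + a) z) := by
  funext i
  refine Fin.addCases (fun i => ?_) (fun i => ?_) i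
  · simp [sliceBits]
  · simp [sliceBits, add_assoc]

theorem sliceBits_one (s : ℕ) (z : ℕ → Bool) : sliceBits 1 s z = ![z s] := by
  funext i; fin_cases i; simp [sliceBits]

theorem sliceBits_congr {m s : ℕ} {z z' : ℕ → Bool} (h : ∀ i, s ≤ i → i < s + m → z i = z' i) :
    sliceBits m s z = sliceBits m s z' := by
  funext i; exact h _ (by omega) (by omega)

theorem sliceBits_eq_iff {m s s' : ℕ} {z z' : ℕ → Bool} :
    sliceBits m s z = sliceBits m s' z' ↔ ∀ j < m, z (s + j) = z' (s' + j) :=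
  ⟨fun h j hj => congrFun h ⟨j, hj⟩, fun h => funext fun j => h j j.2⟩

/-! ### A qubit beside a classical computation -/

namespace QCircuit

variable {𝒢 : GateSet}

theorem initial_qubitKet {k out out' : ℕ} (C : QCircuit 𝒢 (k + 1) out) (D : QCircuit 𝒢 k out')
    (hW : C.width = D.width + 1) (ψ : Bool → ℂ) (x : BitString k) (z : ℕ → Bool) :
    C.initial (qubitKet ψ x) (takeBits C.width z) =
      ψ (z 0) * D.initial (ket x) (sliceBits D.width 1 z) := by
  have e : sliceBits D.width 1 z = takeBits D.width fun i => z (1 + i) := rfl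
  rw [e, initial_takeBits, initial_takeBits]
  have hc : (∀ i, k + 1 ≤ i → i < C.width → z i = false) ↔
      ∀ i, k ≤ i → i < D.width → z (1 + i) = false := by
    constructor
    · intro h i hi hw
      exact h (1 + i) (by omega) (by omega)
    · intro h i hi hw
      obtain ⟨j, rfl⟩ : ∃ j, i = 1 + j := ⟨i - 1, by omega⟩
      exact h j (by omega) (by omega)
  simp only [hc]
  split_ifs
  · simp only [qubitKet, takeBits, Fin.val_zero, Fin.val_succ, add_comm]
    rfl
  · simp

theorem wire_ofWires {inp out : ℕ} (W : ℕ) (h₁ : inp ≤ W) (h₂ : out ≤ W) (l : List (PGate 𝒢 ℕ))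
    (hl : ∀ g ∈ l, g.Valid W) :
    (ofWires W h₁ h₂ l hl : QCircuit 𝒢 inp out).gates.map (Gate.wire 1) =
      l.map (PGate.map fun i => 1 + i) := by
  simp only [ofWires]
  induction l with
  | nil => rfl
  | cons g l ih =>
    rw [List.pmap_cons, List.map_cons, List.map_cons, ih fun g hg => hl g (by simp [hg])]
    cases g <;> rfl

/-- By `hpre` the gates `pre` turn ψ into U x ψ and leave the factor on the other wires as it was,
and `D` then runs beside the qubit. The final state is thus a product, and tracing out the garbage
of `D` leaves the output qubits pure because the output of `D` is certain. -/
theorem computesOnQubit_ofWires {k l : ℕ} (D : QCircuit 𝒢 k l) {g : BitString k → BitString l}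
    (hD : D.Computes g) (pre : List (PGate 𝒢 ℕ)) (U : BitString k → Matrix.unitaryGroup Bool ℂ)
    (hpre : ∀ (x : BitString k) (ψ : Bool → ℂ) (z : ℕ → Bool),
      actAll pre (fun z => ψ (z 0) * D.initial (ket x) (sliceBits D.width 1 z)) z =
        (U x : Matrix Bool Bool ℂ).mulVec ψ (z 0) * D.initial (ket x) (sliceBits D.width 1 z))
    (h₁ : k + 1 ≤ D.width + 1) (h₂ : l + 1 ≤ D.width + 1)
    (hl : ∀ g ∈ pre ++ D.gates.map (Gate.wire 1), g.Valid (D.width + 1)) :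
    (ofWires (D.width + 1) h₁ h₂ (pre ++ D.gates.map (Gate.wire 1)) hl).ComputesOnQubit U g := by
  intro x ψ
  set C : QCircuit 𝒢 (k + 1) (l + 1) :=
    ofWires (D.width + 1) h₁ h₂ (pre ++ D.gates.map (Gate.wire 1)) hl with hC
  have hW : C.width = D.width + 1 := rfl
  have hfin (z : ℕ → Bool) : C.final (qubitKet ψ x) (takeBits (D.width + 1) z) =
      (U x : Matrix Bool Bool ℂ).mulVec ψ (z 0) * D.final (ket x) (sliceBits D.width 1 z) := by
    refine (final_ofWires (D.width + 1) h₁ h₂ _ hl (qubitKet ψ x) z).trans ?_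
    rw [actAll_append]
    have e : (fun z => (ofWires (D.width + 1) h₁ h₂ (pre ++ D.gates.map (Gate.wire 1)) hl :
        QCircuit 𝒢 (k + 1) (l + 1)).initial (qubitKet ψ x) (takeBits (D.width + 1) z)) =
        fun z => ψ (z 0) * D.initial (ket x) (sliceBits D.width 1 z) :=
      funext fun z => C.initial_qubitKet D rfl ψ x z
    rw [e, funext (hpre x ψ)]
    conv_lhs => rw [← glueBits_sliceBits D.width 1 z]
    rw [actAll_wire]
    simp only [sliceBits_glueBits, glueBits_of_lt (i := 0) (s := 1) _ _ Nat.one_pos]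
    rw [runGates_mul]
    rfl
  have hjoin (y : BitString (l + 1)) (w : BitString (D.width - l)) (y₁ : BitString l)
      (hy : y₁ = fun i => y i.succ) :
      C.final (qubitKet ψ x) (joinBits (m := D.width + 1) y
        fun i => w (i.cast (Nat.add_sub_add_right _ _ _))) =
      (U x : Matrix Bool Bool ℂ).mulVec ψ (y 0) * D.final (ket x) (joinBits y₁ w) := by
    rw [← takeBits_padBits (joinBits (m := D.width + 1) y _)]
    refine (hfin _).trans ?_
    congr 2
    funext i
    simp only [sliceBits]
    rw [padBits_of_lt _ (by omega)]
    simp only [joinBits, hy]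
    by_cases hi : (i : ℕ) < l
    · rw [dif_pos hi, dif_pos (by omega)]
      congr 1
      ext
      simp [add_comm]
    · rw [dif_neg hi, dif_neg (by omega)]
      congr 1
      ext
      simp
      omega
  have hcomp := (computes_iff D g).1 hD x
  have hz (y₁ : BitString l) (hy : y₁ ≠ g x) (w) : D.final (ket x) (joinBits y₁ w) = 0 := by
    by_contra h0
    have := hcomp _ h0
    rw [joinBits_castLE] at this
    exact hy this
  ext y y'
  rw [outState, Matrix.of_apply]
  have hsum : ∑ w : BitString (C.width - (l + 1)), C.final (qubitKet ψ x) (joinBits y w) *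
      star (C.final (qubitKet ψ x) (joinBits y' w)) = ∑ w : BitString (D.width - l),
      C.final (qubitKet ψ x) (joinBits (m := D.width + 1) y
        fun i => w (i.cast (Nat.add_sub_add_right _ _ _))) *
      star (C.final (qubitKet ψ x) (joinBits (m := D.width + 1) y'
        fun i => w (i.cast (Nat.add_sub_add_right _ _ _)))) :=
    (Equiv.sum_comp (Equiv.arrowCongr (finCongr (Nat.add_sub_add_right D.width 1 l).symm)
      (Equiv.refl Bool)) _).symm
  rw [hsum]
  simp only [hjoin y _ _ rfl, hjoin y' _ _ rfl, Matrix.vecMulVec_apply, Pi.star_apply, qubitKet]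
  by_cases h1 : (fun i => y (Fin.succ i)) = g x
  · by_cases h2 : (fun i => y' (Fin.succ i)) = g x
    · rw [h1, h2]
      -- Only the output `g x` has nonzero amplitudes, so its garbage vector has norm 1 and
      -- disappears in the partial trace.
      have hp : ∑ w, D.final (ket x) (joinBits (g x) w) * star (D.final (ket x) (joinBits (g x) w)) =
          1 := by
        have := hD x
        rw [prob] at this
        have e (c : ℂ) : c * star c = ((‖c‖ ^ 2 : ℝ) : ℂ) := by
          rw [Complex.star_def, Complex.mul_conj']
          push_cast
          rfl
        simp only [e]
        exact_mod_cast this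
      have hk : ket (g x) (g x) = 1 := by simp [ket]
      rw [hk, mul_one, mul_one, ← mul_one (_ * star _), ← hp, Finset.mul_sum]
      refine Finset.sum_congr rfl fun w _ => ?_
      rw [star_mul]
      ring
    · have hk : ket (g x) (fun i => y' (Fin.succ i)) = 0 := by simp [ket, h2]
      simp only [hz _ h2, hk, mul_zero, star_zero, Finset.sum_const_zero]
  · have hk : ket (g x) (fun i => y (Fin.succ i)) = 0 := by simp [ket, h1]
    simp only [hz _ h1, hk, mul_zero, zero_mul, Finset.sum_const_zero]

end QCircuit

theorem pauliX_pow_mulVec (b : Bool) (ψ : Bool → ℂ) (c : Bool) :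
    ((pauliX ^ b.toNat : Matrix.unitaryGroup Bool ℂ) : Matrix Bool Bool ℂ).mulVec ψ c =
      ψ (xor c b) := by
  cases b <;> cases c <;> simp [pauliX, Matrix.mulVec, dotProduct]

theorem pauliZ_pow_mulVec (b : Bool) (ψ : Bool → ℂ) (c : Bool) :
    ((pauliZ ^ b.toNat : Matrix.unitaryGroup Bool ℂ) : Matrix Bool Bool ℂ).mulVec ψ c =
      (if b && c then -1 else 1) * ψ c := by
  cases b <;> cases c <;> simp [pauliZ, Matrix.mulVec, dotProduct, Matrix.diagonal]

/-! ### Efficiency from symbolic circuits -/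

section parts

variable {𝒢 : GateSet} [Finite 𝒢.One] [Finite 𝒢.Two] {ι o : ℕ → ℕ}
  {C : ∀ n, QCircuit 𝒢 (ι n) (o n)}

theorem EfficientlyComputable.of_parts (hC : IsUniformFamily C) {inp out : ℕ → ℕ}
    {g : ∀ n, BitString (inp n) → BitString (out n)} (ps : List (CircuitPart 𝒢)) (W : Pos)
    (h₁ : ∀ n, inp n ≤ W.eval n (C n).width 0) (h₂ : ∀ n, out n ≤ W.eval n (C n).width 0)
    (hl : ∀ n, ∀ g ∈ ps.flatMap (CircuitPart.wires (C n) n), g.Valid (W.eval n (C n).width 0))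
    (h : ∀ n (v : BitString (inp n)),
      Triple (fun z => ∀ i < W.eval n (C n).width 0, z i = padBits v i)
        (ps.flatMap (CircuitPart.wires (C n) n)) fun z => sliceBits (out n) 0 z = g n v) :
    EfficientlyComputable 𝒢 g := by
  refine ⟨fun n => QCircuit.ofWires _ (h₁ n) (h₂ n) _ (hl n),
    hC.ofWires ps W _ fun n => ⟨h₁ n, h₂ n, hl n, rfl⟩, fun n => ?_⟩
  refine QCircuit.computes_ofWires _ _ _ _ _ _ fun v => (h n v).weaken fun z hz i => ?_
  rw [← hz]
  simp [sliceBits]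

/-- The function `Φ` in `hpre` stands for the state of the classical wires. All that the Pauli
gadgets need to know is that it does not involve qubit `0` and that its string register holds `x`.
-/
theorem EfficientlyComputableOnQubit.of_parts (hC : IsUniformFamily C) {k l : ℕ → ℕ}
    {U : ∀ n, BitString (k n) → Matrix.unitaryGroup Bool ℂ}
    {g : ∀ n, BitString (k n) → BitString (l n)} (pre ps : List (CircuitPart 𝒢)) (W : Pos)
    (h₁ : ∀ n, k n ≤ W.eval n (C n).width 0) (h₂ : ∀ n, l n ≤ W.eval n (C n).width 0)
    (hl : ∀ n, ∀ g ∈ ps.flatMap (CircuitPart.wires (C n) n), g.Valid (W.eval n (C n).width 0))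
    (h : ∀ n (v : BitString (k n)),
      Triple (fun z => ∀ i < W.eval n (C n).width 0, z i = padBits v i)
        (ps.flatMap (CircuitPart.wires (C n) n)) fun z => sliceBits (l n) 0 z = g n v)
    (hl' : ∀ n, ∀ g ∈ pre.flatMap (CircuitPart.wires (C n) n),
      g.Valid (W.eval n (C n).width 0 + 1))
    (hpre : ∀ n (x : BitString (k n)) (ψ : Bool → ℂ) (Φ : (ℕ → Bool) → ℂ),
      (∀ z b, Φ (Function.update z 0 b) = Φ z) → (∀ z, Φ z ≠ 0 → sliceBits (k n) 1 z = x) →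
      ∀ z, actAll (pre.flatMap (CircuitPart.wires (C n) n)) (fun z => ψ (z 0) * Φ z) z =
        (U n x : Matrix Bool Bool ℂ).mulVec ψ (z 0) * Φ z) :
    EfficientlyComputableOnQubit 𝒢 U g := by
  let D (n : ℕ) : QCircuit 𝒢 (k n) (l n) := QCircuit.ofWires _ (h₁ n) (h₂ n) _ (hl n)
  have hD (n : ℕ) : (D n).Computes (g n) := by
    refine QCircuit.computes_ofWires _ _ _ _ _ _ fun v => (h n v).weaken fun z hz i => ?_
    rw [← hz]
    simp [sliceBits]
  have hw (n : ℕ) : W.succ.eval n (C n).width 0 = (D n).width + 1 := by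
    rw [Pos.eval_succ, add_comm]; rfl
  have hgates (n : ℕ) : (pre ++ ps.map CircuitPart.succ).flatMap (CircuitPart.wires (C n) n) =
      pre.flatMap (CircuitPart.wires (C n) n) ++ (D n).gates.map (Gate.wire 1) := by
    rw [List.flatMap_append, wires_succ, QCircuit.wire_ofWires]
  have hv (n : ℕ) : ∀ g ∈ pre.flatMap (CircuitPart.wires (C n) n) ++
      (D n).gates.map (Gate.wire 1), g.Valid ((D n).width + 1) := by
    refine CliffordT.valid_append (hl' n) fun g hg => ?_
    obtain ⟨g', _, rfl⟩ := List.mem_map.1 hg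
    exact g'.valid_wire 1 _ (by omega)
  refine ⟨fun n => QCircuit.ofWires ((D n).width + 1) (Nat.succ_le_succ (h₁ n))
    (Nat.succ_le_succ (h₂ n)) _ (hv n), ?_, fun n => ?_⟩
  · refine hC.ofWires (pre ++ ps.map CircuitPart.succ) W.succ _ fun n => ?_
    rw [hw, hgates]
    exact ⟨_, _, hv n, rfl⟩
  · refine QCircuit.computesOnQubit_ofWires (D n) (hD n) _ (U n) (fun x ψ z => ?_) _ _ (hv n)
    refine hpre n x ψ (fun z => (D n).initial (ket x) (sliceBits (D n).width 1 z))
      (fun z b => ?_) (fun z hz => ?_) z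
    · congr 1
      exact sliceBits_congr fun i hi _ => Function.update_of_ne (by omega) _ _
    · have e : sliceBits (D n).width 1 z = takeBits (D n).width fun i => z (1 + i) := rfl
      simp only [e, QCircuit.initial_takeBits] at hz
      by_contra hne
      apply hz
      split_ifs
      · exact Pi.single_eq_of_ne hne 1
      · rfl

end parts

namespace CliffordT

variable {𝒢 : GateSet} (K : CliffordT 𝒢)

/-- The symbolic form of `dotLoop`. -/
def dotPart (p q t : Pos) : CircuitPart 𝒢 := .loop (K.toffoli p.step q.step t)

/-- The symbolic form of `dotPhaseLoop`. -/
def dotPhasePart (p q t : Pos) : CircuitPart 𝒢 := .loop (K.ccz p.step q.step t)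

/-- The symbolic form of `swapLoop`. -/
def swapPart (p q : Pos) : CircuitPart 𝒢 := .loop (K.swap p.step q.step)

/-- The symbolic form of `cmpLoop`. -/
def cmpPart (p q t : Pos) : CircuitPart 𝒢 :=
  .loop (K.cx q.step p.step ++ K.neg p.step ++ K.toffoli p.step t.step t.step.succ)

/-- The symbolic form of `applyAt`. -/
def applyParts (p s : Pos) : List (CircuitPart 𝒢) := [K.swapPart p s, .block s, K.swapPart p s]

section
variable {inp out : ℕ} (C : QCircuit 𝒢 inp out) (n : ℕ) {p q t s : Pos}

theorem eval_const (ht : t.count = 0) (w j : ℕ) : t.eval n w j = t.eval n w 0 := by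
  simp [Pos.eval, ht]

theorem wires_dotPart (ht : t.count = 0) :
    (K.dotPart p q t).wires C n =
      K.dotLoop n (p.eval n C.width 0) (q.eval n C.width 0) (t.eval n C.width 0) := by
  simp [dotPart, CircuitPart.wires, dotLoop, Pos.eval_step, eval_const n ht]

theorem wires_dotPhasePart (ht : t.count = 0) :
    (K.dotPhasePart p q t).wires C n =
      K.dotPhaseLoop n (p.eval n C.width 0) (q.eval n C.width 0) (t.eval n C.width 0) := by
  simp [dotPhasePart, CircuitPart.wires, dotPhaseLoop, Pos.eval_step, eval_const n ht]

theorem wires_swapPart : (K.swapPart p q).wires C n =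
    K.swapLoop n (p.eval n C.width 0) (q.eval n C.width 0) := by
  simp [swapPart, CircuitPart.wires, swapLoop, Pos.eval_step]

theorem wires_cmpPart : (K.cmpPart p q t).wires C n =
    K.cmpLoop n (p.eval n C.width 0) (q.eval n C.width 0) (t.eval n C.width 0) := by
  simp [cmpPart, CircuitPart.wires, cmpLoop, Pos.eval_step, Pos.eval_succ, add_comm]

theorem wires_applyParts : (K.applyParts p s).flatMap (CircuitPart.wires C n) =
    K.applyAt C n (p.eval n C.width 0) (s.eval n C.width 0) := by
  rw [applyParts, List.flatMap_cons, List.flatMap_cons, List.flatMap_singleton, wires_swapPart,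
    applyAt, List.append_assoc]
  rfl

end

end CliffordT

open CliffordT (dotBits dotBits_congr innerMod2_sliceBits)

/-! ### The honest parties are efficient -/

/-- The first gates in the list act first, so the Z power comes before the X power. Flipping qubit
`0` does not disturb the inner products, whose bits lie at positions from 1 on. -/
theorem CliffordT.actAll_encrypt {𝒢 : GateSet} (K : CliffordT 𝒢) {m p q p' q' : ℕ} (hp : 1 ≤ p)
    (hpq : p + m ≤ q) (hp' : 1 ≤ p') (hpq' : p' + m ≤ q') (ψ : Bool → ℂ) {Φ : (ℕ → Bool) → ℂ}
    (hΦ : ∀ z b, Φ (Function.update z 0 b) = Φ z) (z : ℕ → Bool) :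
    actAll (K.dotPhaseLoop m p q 0 ++ K.dotLoop m p' q' 0) (fun z => ψ (z 0) * Φ z) z =
      ((pauliX ^ (dotBits z m p' q').toNat * pauliZ ^ (dotBits z m p q).toNat :
        Matrix.unitaryGroup Bool ℂ) : Matrix Bool Bool ℂ).mulVec ψ (z 0) * Φ z := by
  rw [actAll_append, K.actAll_dotLoop (.inl hpq') (.inl hp') (.inl (by omega)),
    K.actAll_dotPhaseLoop (.inl hpq) (.inl hp) (.inl (by omega)), Submonoid.coe_mul,
    ← Matrix.mulVec_mulVec, pauliX_pow_mulVec, pauliZ_pow_mulVec, hΦ, Function.update_self,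
    dotBits_congr (z' := z) (fun j _ => Function.update_of_ne (by omega) _ _)
      (fun j _ => Function.update_of_ne (by omega) _ _), mul_assoc]

theorem CliffordT.actAll_decrypt {𝒢 : GateSet} (K : CliffordT 𝒢) {m p q p' q' : ℕ} (hq : 1 ≤ q)
    (hpq : q + m ≤ p) (hq' : 1 ≤ q') (hpq' : q' + m ≤ p') (ψ : Bool → ℂ) {Φ : (ℕ → Bool) → ℂ}
    (hΦ : ∀ z b, Φ (Function.update z 0 b) = Φ z) (z : ℕ → Bool) :
    actAll (K.dotLoop m p' q' 0 ++ K.dotPhaseLoop m p q 0) (fun z => ψ (z 0) * Φ z) z =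
      ((pauliZ ^ (dotBits z m p q).toNat * pauliX ^ (dotBits z m p' q').toNat :
        Matrix.unitaryGroup Bool ℂ) : Matrix Bool Bool ℂ).mulVec ψ (z 0) * Φ z := by
  rw [actAll_append, K.actAll_dotPhaseLoop (.inr hpq) (.inl (by omega)) (.inl hq),
    K.actAll_dotLoop (.inr hpq') (.inl (by omega)) (.inl hq'), Submonoid.coe_mul,
    ← Matrix.mulVec_mulVec, pauliZ_pow_mulVec, pauliX_pow_mulVec, hΦ, Function.update_self,
    mul_assoc]

section efficient

variable {𝒢 : GateSet} [Finite 𝒢.One] [Finite 𝒢.Two]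
  {f : ∀ n, Equiv.Perm (BitString n)} {C : ∀ n, QCircuit 𝒢 n n}

theorem sliceBits_two (s : ℕ) (z : ℕ → Bool) : sliceBits 2 s z = ![z s, z (s + 1)] := by
  funext i; fin_cases i <;> rfl

/-- No gates are needed: the output is an initial part of the input. The family `C` enters only as
the uniform family from which widths are printed. -/
theorem efficient_prefix (hC : IsUniformFamily C) {inp out : ℕ → ℕ} (a b : ℕ)
    (ha : ∀ n, inp n = a + b * n) (hout : ∀ n, out n ≤ inp n)
    {g : ∀ n, BitString (inp n) → BitString (out n)}
    (hg : ∀ n (z : ℕ → Bool), g n (sliceBits (inp n) 0 z) = sliceBits (out n) 0 z) :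
    EfficientlyComputable 𝒢 g := by
  have hW (n : ℕ) : Pos.eval n (C n).width 0 ⟨a, b, 0, 0⟩ = inp n := by simp [Pos.eval, ha]
  refine EfficientlyComputable.of_parts hC [] ⟨a, b, 0, 0⟩ (fun n => (hW n).ge)
    (fun n => (hout n).trans (hW n).ge) (by simp) fun n v Ψ hΨ z hz => ?_
  have hz' := hΨ z hz
  rw [hW] at hz'
  change sliceBits (out n) 0 z = g n v
  rw [← hg]
  congr 1
  funext i
  have := hz' i i.2
  rw [padBits_of_lt v i.2] at this
  simpa [sliceBits] using this

theorem efficient_bit_commit (K : CliffordT 𝒢) (hC : IsUniformFamily C) (hf : ∀ n, (C n).Computes (f n)) :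
    EfficientlyComputable 𝒢 (inp := fun n => n + n + 1) (out := fun n => n + n + 1)
      (fun n w => (glBitCommitment f).commit n (w.snd 0) w.fst) := by
  have e0 (n w : ℕ) : Pos.eval n w 0 ⟨0, 0, 0, 0⟩ = 0 := by simp [Pos.eval]
  have e1 (n w : ℕ) : Pos.eval n w 0 ⟨0, 1, 0, 0⟩ = n := by simp [Pos.eval]
  have e2 (n w : ℕ) : Pos.eval n w 0 ⟨0, 2, 0, 0⟩ = n + n := by simp [Pos.eval]; omega
  have e3 (n w : ℕ) : Pos.eval n w 0 ⟨1, 2, 0, 0⟩ = n + n + 1 := by simp [Pos.eval]; omega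
  have e4 (n w : ℕ) : Pos.eval n w 0 ⟨1, 2, 1, 0⟩ = n + n + 1 + w := by simp [Pos.eval]; omega
  -- Layout: a at 0, x at n, z at 2n, workspace from 2n + 1 on. The inner product is added to z
  -- first, because the evaluation of f overwrites a.
  let ps : List (CircuitPart 𝒢) := K.dotPart ⟨0, 0, 0, 0⟩ ⟨0, 1, 0, 0⟩ ⟨0, 2, 0, 0⟩ ::
      K.applyParts ⟨0, 0, 0, 0⟩ ⟨1, 2, 0, 0⟩
  have hwires (n : ℕ) : ps.flatMap (CircuitPart.wires (C n) n) =
      K.dotLoop n 0 n (n + n) ++ K.applyAt (C n) n 0 (n + n + 1) := by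
    rw [List.flatMap_cons, K.wires_applyParts, K.wires_dotPart _ _ rfl, e0, e1, e2, e3]
  have hnw (n : ℕ) : n ≤ (C n).width := (C n).inp_le
  refine EfficientlyComputable.of_parts hC ps ⟨1, 2, 1, 0⟩ (fun n => ?_) (fun n => ?_) (fun n => ?_)
    fun n v => ?_
  · rw [e4]; omega
  · rw [e4]; omega
  · have := hnw n
    rw [hwires, e4]
    exact CliffordT.valid_append (K.valid_dotLoop (by omega) (by omega) (by omega) (by omega)
      (by omega) (by omega)) (K.valid_applyAt _ (by omega) (by omega) (by omega))
  · have hw := hnw n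
    rw [hwires, e4]
    refine (((K.realizes_dotLoop (m := n) (p := 0) (q := n) (t := n + n) (by omega) (by omega)
      (by omega)).triple _).append (K.triple_applyAt (hf n) (p := 0) (s := n + n + 1) (by omega) _
        ?_)).weaken ?_
    · rintro z ⟨z₀, h₀, rfl⟩ i hi hiw
      rw [Function.update_of_ne (by omega), h₀ i (by omega), padBits_of_le _ (by omega)]
    · rintro z ⟨z₁, ⟨z₀, h₀, rfl⟩, hr, hfz⟩
      have hv : v = sliceBits (n + n + 1) 0 z₀ := by
        funext i
        have := h₀ i (by omega)
        rw [padBits_of_lt v i.2] at this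
        simpa [sliceBits] using this.symm
      simp only [glBitCommitment]
      rw [hv, fst_sliceBits, fst_sliceBits, snd_sliceBits, snd_sliceBits, sliceBits_add,
        sliceBits_add]
      simp only [zero_add, sliceBits_one]
      congr 2
      · rw [hfz]
        congr 1
        exact sliceBits_congr fun i _ _ => Function.update_of_ne (by omega) _ _
      · exact sliceBits_congr fun i _ _ => by
          rw [hr i (by omega), Function.update_of_ne (by omega)]
      · rw [hr _ (by omega), Function.update_self, innerMod2_sliceBits]
        rfl

theorem efficient_bit_verify (K : CliffordT 𝒢) (hC : IsUniformFamily C) (hf : ∀ n, (C n).Computes (f n)) :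
    EfficientlyComputable 𝒢 (inp := fun n => (n + n + 1) + n) (out := fun _ => 2)
      (fun n w => ![(glBitCommitment f).accept n w.fst w.snd,
        (glBitCommitment f).value n w.fst w.snd]) := by
  have e0 (n w : ℕ) : Pos.eval n w 0 ⟨0, 0, 0, 0⟩ = 0 := by simp [Pos.eval]
  have e1 (n w : ℕ) : Pos.eval n w 0 ⟨0, 1, 0, 0⟩ = n := by simp [Pos.eval]
  have e1' (n w : ℕ) : Pos.eval n w 0 ⟨1, 0, 0, 0⟩ = 1 := by simp [Pos.eval]
  have e2 (n w : ℕ) : Pos.eval n w 0 ⟨0, 2, 0, 0⟩ = n + n := by simp [Pos.eval]; omega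
  have e3 (n w : ℕ) : Pos.eval n w 0 ⟨1, 2, 0, 0⟩ = n + n + 1 := by simp [Pos.eval]; omega
  have e4 (n w : ℕ) : Pos.eval n w 0 ⟨1, 3, 0, 0⟩ = n + n + 1 + n := by simp [Pos.eval]; omega
  have e5 (n w : ℕ) : Pos.eval n w 0 ⟨1, 3, 1, 0⟩ = n + n + 1 + n + w := by
    simp [Pos.eval]; omega
  have e6 (n w : ℕ) : Pos.eval n w 0 ⟨1, 4, 1, 0⟩ = n + n + 1 + n + w + n := by
    simp [Pos.eval]; omega
  have e7 (n w : ℕ) : Pos.eval n w 0 ⟨2, 4, 1, 0⟩ = n + n + 1 + n + w + n + 1 := by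
    simp [Pos.eval]; omega
  have e8 (n w : ℕ) : Pos.eval n w 0 ⟨3, 4, 1, 0⟩ = n + n + 1 + n + w + n + 2 := by
    simp [Pos.eval]; omega
  -- Layout: b, x, c at 0, n, 2n; a at 2n + 1; workspace from 3n + 1 on; then the chain of the
  -- comparison, whose start is set to 1 by a negation, and one spare qubit. The value at 2n is
  -- parked in the spare qubit before the verdict is moved to 0, which is needed for n = 0, where
  -- both positions coincide.
  let ps : List (CircuitPart 𝒢) := (K.dotPart ⟨1, 2, 0, 0⟩ ⟨0, 1, 0, 0⟩ ⟨0, 2, 0, 0⟩ ::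
      K.applyParts ⟨1, 2, 0, 0⟩ ⟨1, 3, 0, 0⟩) ++ [.line (K.neg ⟨1, 3, 1, 0⟩),
      K.cmpPart ⟨0, 0, 0, 0⟩ ⟨1, 2, 0, 0⟩ ⟨1, 3, 1, 0⟩,
      .line (K.swap ⟨0, 2, 0, 0⟩ ⟨2, 4, 1, 0⟩ ++ K.swap ⟨0, 0, 0, 0⟩ ⟨1, 4, 1, 0⟩ ++
        K.swap ⟨1, 0, 0, 0⟩ ⟨2, 4, 1, 0⟩)]
  have hwires (n : ℕ) (t : ℕ) (ht : t = n + n + 1 + n + (C n).width) :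
      ps.flatMap (CircuitPart.wires (C n) n) =
      (K.dotLoop n (n + n + 1) n (n + n) ++ K.applyAt (C n) n (n + n + 1) (n + n + 1 + n)) ++
      (K.neg t ++ (K.cmpLoop n 0 (n + n + 1) t ++
      (K.swap (n + n) (t + n + 1) ++ K.swap 0 (t + n) ++ K.swap 1 (t + n + 1)))) := by
    simp only [ps]
    rw [List.flatMap_append, List.flatMap_cons, K.wires_applyParts, K.wires_dotPart _ _ rfl,
      List.flatMap_cons, List.flatMap_cons, List.flatMap_singleton, K.wires_cmpPart]
    simp only [CircuitPart.wires, List.map_append, CliffordT.map_neg, CliffordT.map_swap, e0, e1,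
      e1', e2, e3, e4, e5, e6, e7, ht]
  have hnw (n : ℕ) : n ≤ (C n).width := (C n).inp_le
  refine EfficientlyComputable.of_parts hC ps ⟨3, 4, 1, 0⟩ (fun n => ?_) (fun n => ?_) (fun n => ?_)
    fun n v => ?_
  · rw [e8]; omega
  · rw [e8]; omega
  · have := hnw n
    rw [hwires n _ rfl, e8]
    refine CliffordT.valid_append (CliffordT.valid_append (K.valid_dotLoop (by omega) (by omega)
      (by omega) (by omega) (by omega) (by omega)) (K.valid_applyAt _ (by omega) (by omega)
      (by omega))) (CliffordT.valid_append (K.valid_neg (by omega)) (CliffordT.valid_append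
      (K.valid_cmpLoop (by omega) (by omega) (by omega)) (CliffordT.valid_append
      (CliffordT.valid_append (K.valid_swap (by omega) (by omega) (by omega)) (K.valid_swap
      (by omega) (by omega) (by omega))) (K.valid_swap (by omega) (by omega) (by omega)))))
  · have hw := hnw n
    obtain ⟨t, ht⟩ : ∃ t, t = n + n + 1 + n + (C n).width := ⟨_, rfl⟩
    rw [hwires n t ht, e8, ← ht]
    obtain ⟨F, hF, hFr, hFt⟩ := K.realizes_cmpLoop (m := n) (p := 0) (q := n + n + 1) (t := t)
      (by omega) (by omega)
    refine ((((K.realizes_dotLoop (m := n) (p := n + n + 1) (q := n) (t := n + n) (by omega)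
      (by omega) (by omega)).triple _).append (K.triple_applyAt (hf n) (p := n + n + 1)
        (s := n + n + 1 + n) (by omega) _ ?_)).append (((K.realizes_neg t).append (hF.append
        (((K.realizes_swap (i := n + n) (j := t + n + 1) (by omega)).append
        (K.realizes_swap (i := 0) (j := t + n) (by omega))).append
        (K.realizes_swap (i := 1) (j := t + n + 1) (by omega))))).triple _)).weaken ?_
    · rintro z ⟨z₀, h₀, rfl⟩ i hi hiw
      rw [Function.update_of_ne (by omega), h₀ i (by omega), padBits_of_le _ (by omega)]
    · rintro z' ⟨z, ⟨z₁, ⟨z₀, h₀, rfl⟩, hr, hfz⟩, rfl⟩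
      have hv : v = sliceBits (n + n + 1 + n) 0 z₀ := by
        funext i
        have := h₀ i (by omega)
        rw [padBits_of_lt v i.2] at this
        simpa [sliceBits] using this.symm
      have hz0 (i : ℕ) (hi : t ≤ i) (hi' : i < t + n + 2) : z i = false := by
        rw [hr i (by omega), Function.update_of_ne (by omega), h₀ i hi', padBits_of_le _ (by omega)]
      set y := F (Function.update z t (!z t)) with hy
      have hyt : y (t + n) = decide (∀ j < n, z (n + n + 1 + j) = z (0 + j)) := by
        rw [hy, hFt _ fun j hj => ?_]
        · rw [Function.update_self, hz0 t le_rfl (by omega)]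
          simp only [Bool.not_false, Bool.true_and]
          refine decide_eq_decide.2 (forall₂_congr fun j hj => ?_)
          rw [Function.update_of_ne (by omega), Function.update_of_ne (by omega)]
        · rw [Function.update_of_ne (by omega), hz0 _ (by omega) (by omega)]
      have hyc : y (n + n) = xor (z₀ (n + n)) (dotBits z₀ n (n + n + 1) n) := by
        rw [hy, hFr _ _ (by omega) (by omega), Function.update_of_ne (by omega), hr _ (by omega),
          Function.update_self]
      simp only [Function.comp_apply, ← hy]
      rw [sliceBits_two]
      rw [Function.update_of_ne (a := 0) (by omega), Function.update_of_ne (a := 0) (by omega),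
        Function.update_of_ne (a := 0) (by omega), Function.update_self,
        Function.update_of_ne (a := t + n) (by omega),
        Function.update_of_ne (a := t + n) (by omega), Function.update_of_ne (a := 1) (by omega),
        Function.update_self, Function.update_of_ne (a := t + n + 1) (by omega),
        Function.update_of_ne (a := t + n + 1) (by omega), Function.update_self, hyt, hyc]
      simp only [glBitCommitment]
      rw [hv, fst_sliceBits, fst_sliceBits, fst_sliceBits, snd_sliceBits, snd_sliceBits,
        snd_sliceBits]
      simp only [zero_add, sliceBits_one, innerMod2_sliceBits]
      funext i
      have hcond : (∀ j < n, z (n + n + 1 + j) = z j) ↔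
          f n (sliceBits n (n + n + 1) z₀) = sliceBits n 0 z₀ := by
        have e : sliceBits n (n + n + 1) (Function.update z₀ (n + n)
            (xor (z₀ (n + n)) (dotBits z₀ n (n + n + 1) n))) = sliceBits n (n + n + 1) z₀ :=
          sliceBits_congr fun i _ _ => Function.update_of_ne (by omega) _ _
        rw [e] at hfz
        rw [← hfz, sliceBits_eq_iff]
        refine forall₂_congr fun j hj => ?_
        rw [zero_add, hr j (by omega), Function.update_of_ne (by omega)]
      simp only [hcond]
      fin_cases i <;> rfl

theorem efficient_qubit_commit (K : CliffordT 𝒢) (hC : IsUniformFamily C)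
    (hf : ∀ n, (C n).Computes (f n)) :
    EfficientlyComputableOnQubit 𝒢 (k := fun n => (n + n) + (n + n))
      (l := fun n => (n + n) + (n + n)) (glQubitCommitment f).enc (glQubitCommitment f).commit := by
  have e0 (n w : ℕ) : Pos.eval n w 0 ⟨0, 0, 0, 0⟩ = 0 := by simp [Pos.eval]
  have e1 (n w : ℕ) : Pos.eval n w 0 ⟨0, 1, 0, 0⟩ = n := by simp [Pos.eval]
  have e2 (n w : ℕ) : Pos.eval n w 0 ⟨0, 4, 0, 0⟩ = n + n + (n + n) := by
    simp [Pos.eval]; omega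
  have e3 (n w : ℕ) : Pos.eval n w 0 ⟨0, 4, 1, 0⟩ = n + n + (n + n) + w := by
    simp [Pos.eval]; omega
  have e4 (n w : ℕ) : Pos.eval n w 0 ⟨0, 4, 2, 0⟩ = n + n + (n + n) + w + w := by
    simp [Pos.eval]; omega
  have e5 (n w : ℕ) : Pos.eval n w 0 ⟨1, 0, 0, 0⟩ = 1 := by simp [Pos.eval]
  have e6 (n w : ℕ) : Pos.eval n w 0 ⟨1, 1, 0, 0⟩ = 1 + n := by simp [Pos.eval]
  have e7 (n w : ℕ) : Pos.eval n w 0 ⟨1, 2, 0, 0⟩ = 1 + (n + n) := by simp [Pos.eval]; omega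
  have e8 (n w : ℕ) : Pos.eval n w 0 ⟨1, 3, 0, 0⟩ = 1 + (n + n + n) := by
    simp [Pos.eval]; omega
  -- The committed qubit occupies position 0, so in `pre` the strings a₁, a₂, x₁, x₂ start at 1, 1 +
  -- n, 1 + 2n, 1 + 3n. In `ps` they start at 0, because the shift is added later; the two
  -- evaluations of f have separate workspaces.
  let pre : List (CircuitPart 𝒢) := [K.dotPhasePart ⟨1, 1, 0, 0⟩ ⟨1, 3, 0, 0⟩ ⟨0, 0, 0, 0⟩,
    K.dotPart ⟨1, 0, 0, 0⟩ ⟨1, 2, 0, 0⟩ ⟨0, 0, 0, 0⟩]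
  let ps : List (CircuitPart 𝒢) := K.applyParts ⟨0, 0, 0, 0⟩ ⟨0, 4, 0, 0⟩ ++
    K.applyParts ⟨0, 1, 0, 0⟩ ⟨0, 4, 1, 0⟩
  have hpre (n : ℕ) : pre.flatMap (CircuitPart.wires (C n) n) =
      K.dotPhaseLoop n (1 + n) (1 + (n + n + n)) 0 ++ K.dotLoop n 1 (1 + (n + n)) 0 := by
    simp only [pre]
    rw [List.flatMap_cons, List.flatMap_singleton, K.wires_dotPart _ _ rfl,
      K.wires_dotPhasePart _ _ rfl, e0, e5, e6, e7, e8]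
  have hps (n : ℕ) : ps.flatMap (CircuitPart.wires (C n) n) =
      K.applyAt (C n) n 0 (n + n + (n + n)) ++
        K.applyAt (C n) n n (n + n + (n + n) + (C n).width) := by
    simp only [ps]
    rw [List.flatMap_append, K.wires_applyParts, K.wires_applyParts, e0, e1, e2, e3]
  refine EfficientlyComputableOnQubit.of_parts hC pre ps ⟨0, 4, 2, 0⟩ (fun n => ?_) (fun n => ?_)
    (fun n => ?_) (fun n v => ?_) (fun n => ?_) fun n x ψ Φ hΦ hx z => ?_
  · rw [e4]; omega
  · rw [e4]; omega
  · have hw : n ≤ (C n).width := (C n).inp_le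
    rw [hps, e4]
    exact CliffordT.valid_append (K.valid_applyAt _ (by omega) (by omega) (by omega))
      (K.valid_applyAt _ (by omega) (by omega) (by omega))
  · have hw : n ≤ (C n).width := (C n).inp_le
    rw [hps, e4]
    refine ((K.triple_applyAt (hf n) (p := 0) (s := n + n + (n + n)) (by omega) _ ?_).append
      (K.triple_applyAt (hf n) (p := n) (s := n + n + (n + n) + (C n).width) (by omega) _
        ?_)).weaken ?_
    · rintro z h₀ i hi hiw
      rw [h₀ i (by omega), padBits_of_le _ (by omega)]
    · rintro z ⟨z₀, h₀, hr, -⟩ i hi hiw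
      rw [hr i (by omega), h₀ i (by omega), padBits_of_le _ (by omega)]
    · rintro z ⟨z₁, ⟨z₀, h₀, hr, hfz⟩, hr', hfz'⟩
      have hv : v = sliceBits (n + n + (n + n)) 0 z₀ := by
        funext i
        have := h₀ i (by omega)
        rw [padBits_of_lt v i.2] at this
        simpa [sliceBits] using this.symm
      simp only [glQubitCommitment]
      rw [hv, fst_sliceBits, fst_sliceBits, snd_sliceBits, snd_sliceBits, sliceBits_add,
        sliceBits_add n n 0]
      simp only [zero_add]
      refine congrArg₂ Fin.append (congrArg₂ Fin.append ?_ ?_) ?_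
      · rw [← hfz]
        exact sliceBits_congr fun i _ _ => hr' i (by omega)
      · rw [hfz']
        exact congrArg _ (sliceBits_congr fun i _ _ => hr i (by omega))
      · exact sliceBits_congr fun i _ _ => by rw [hr' i (by omega), hr i (by omega)]
  · rw [hpre, e4]
    exact CliffordT.valid_append (K.valid_dotPhaseLoop (by omega) (by omega) (by omega) (by omega)
      (by omega) (by omega)) (K.valid_dotLoop (by omega) (by omega) (by omega) (by omega)
      (by omega) (by omega))
  · rw [hpre, K.actAll_encrypt (by omega) (by omega) (by omega) (by omega) ψ hΦ]
    by_cases h : Φ z = 0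
    · rw [h, mul_zero, mul_zero]
    · rw [← hx z h]
      simp only [glQubitCommitment]
      rw [fst_sliceBits, snd_sliceBits, fst_sliceBits, fst_sliceBits, snd_sliceBits, snd_sliceBits,
        innerMod2_sliceBits, innerMod2_sliceBits, add_assoc 1 (n + n) n]

theorem efficient_qubit_verify (K : CliffordT 𝒢) (hC : IsUniformFamily C)
    (hf : ∀ n, (C n).Computes (f n)) :
    EfficientlyComputableOnQubit 𝒢 (k := fun n => ((n + n) + (n + n)) + (n + n))
      (l := fun _ => 1) (fun n w => (glQubitCommitment f).dec n w.fst w.snd)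
      (fun n w => ![(glQubitCommitment f).accept n w.fst w.snd]) := by
  have e0 (n w : ℕ) : Pos.eval n w 0 ⟨0, 0, 0, 0⟩ = 0 := by simp [Pos.eval]
  have e1 (n w : ℕ) : Pos.eval n w 0 ⟨0, 1, 0, 0⟩ = n := by simp [Pos.eval]
  have e2 (n w : ℕ) : Pos.eval n w 0 ⟨0, 4, 0, 0⟩ = n + n + (n + n) := by
    simp [Pos.eval]; omega
  have e3 (n w : ℕ) : Pos.eval n w 0 ⟨0, 5, 0, 0⟩ = n + n + (n + n) + n := by
    simp [Pos.eval]; omega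
  have e4 (n w : ℕ) : Pos.eval n w 0 ⟨0, 6, 0, 0⟩ = n + n + (n + n) + (n + n) := by
    simp [Pos.eval]; omega
  have e5 (n w : ℕ) : Pos.eval n w 0 ⟨0, 6, 1, 0⟩ = n + n + (n + n) + (n + n) + w := by
    simp [Pos.eval]; omega
  have e6 (n w : ℕ) : Pos.eval n w 0 ⟨1, 6, 2, 0⟩ = n + n + (n + n) + (n + n) + w + w + 1 := by
    simp [Pos.eval]; omega
  have e7 (n w : ℕ) : Pos.eval n w 0 ⟨1, 7, 2, 0⟩ =
      n + n + (n + n) + (n + n) + w + w + 1 + n := by simp [Pos.eval]; omega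
  have e8 (n w : ℕ) : Pos.eval n w 0 ⟨1, 8, 2, 0⟩ =
      n + n + (n + n) + (n + n) + w + w + 1 + n + n := by simp [Pos.eval]; omega
  have e9 (n w : ℕ) : Pos.eval n w 0 ⟨2, 8, 2, 0⟩ =
      n + n + (n + n) + (n + n) + w + w + 1 + n + n + 1 := by simp [Pos.eval]; omega
  have e10 (n w : ℕ) : Pos.eval n w 0 ⟨1, 4, 0, 0⟩ = 1 + (n + n + (n + n)) := by
    simp [Pos.eval]; omega
  have e11 (n w : ℕ) : Pos.eval n w 0 ⟨1, 2, 0, 0⟩ = 1 + (n + n) := by simp [Pos.eval]; omega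
  have e12 (n w : ℕ) : Pos.eval n w 0 ⟨1, 5, 0, 0⟩ = 1 + (n + n + (n + n)) + n := by
    simp [Pos.eval]; omega
  have e13 (n w : ℕ) : Pos.eval n w 0 ⟨1, 3, 0, 0⟩ = 1 + (n + n) + n := by
    simp [Pos.eval]; omega
  let pre : List (CircuitPart 𝒢) := [K.dotPart ⟨1, 4, 0, 0⟩ ⟨1, 2, 0, 0⟩ ⟨0, 0, 0, 0⟩,
    K.dotPhasePart ⟨1, 5, 0, 0⟩ ⟨1, 3, 0, 0⟩ ⟨0, 0, 0, 0⟩]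
  -- The second comparison starts from the result of the first, so it yields the conjunction. The
  -- chain begins one position after the workspaces, so that the final exchange with position 0 is
  -- between distinct qubits even if n and the width are 0.
  let ps : List (CircuitPart 𝒢) := (K.applyParts ⟨0, 4, 0, 0⟩ ⟨0, 6, 0, 0⟩ ++
    K.applyParts ⟨0, 5, 0, 0⟩ ⟨0, 6, 1, 0⟩) ++ [.line (K.neg ⟨1, 6, 2, 0⟩),
      K.cmpPart ⟨0, 0, 0, 0⟩ ⟨0, 4, 0, 0⟩ ⟨1, 6, 2, 0⟩,
      K.cmpPart ⟨0, 1, 0, 0⟩ ⟨0, 5, 0, 0⟩ ⟨1, 7, 2, 0⟩,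
      .line (K.swap ⟨0, 0, 0, 0⟩ ⟨1, 8, 2, 0⟩)]
  have hpre (n : ℕ) : pre.flatMap (CircuitPart.wires (C n) n) =
      K.dotLoop n (1 + (n + n + (n + n))) (1 + (n + n)) 0 ++
        K.dotPhaseLoop n (1 + (n + n + (n + n)) + n) (1 + (n + n) + n) 0 := by
    simp only [pre]
    rw [List.flatMap_cons, List.flatMap_singleton, K.wires_dotPart _ _ rfl,
      K.wires_dotPhasePart _ _ rfl, e0, e10, e11, e12, e13]
  have hps (n t : ℕ) (ht : t = n + n + (n + n) + (n + n) + (C n).width + (C n).width + 1) :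
      ps.flatMap (CircuitPart.wires (C n) n) =
      (K.applyAt (C n) n (n + n + (n + n)) (n + n + (n + n) + (n + n)) ++
        K.applyAt (C n) n (n + n + (n + n) + n) (n + n + (n + n) + (n + n) + (C n).width)) ++
      (K.neg t ++ (K.cmpLoop n 0 (n + n + (n + n)) t ++
        (K.cmpLoop n n (n + n + (n + n) + n) (t + n) ++ K.swap 0 (t + n + n)))) := by
    simp only [ps]
    rw [List.flatMap_append, List.flatMap_append, K.wires_applyParts, K.wires_applyParts,
      List.flatMap_cons, List.flatMap_cons, List.flatMap_cons, List.flatMap_singleton,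
      K.wires_cmpPart, K.wires_cmpPart]
    simp only [CircuitPart.wires, CliffordT.map_neg, CliffordT.map_swap, e0, e1, e2, e3, e4, e5,
      e6, e7, e8, ht]
  refine EfficientlyComputableOnQubit.of_parts hC pre ps ⟨2, 8, 2, 0⟩ (fun n => ?_) (fun n => ?_)
    (fun n => ?_) (fun n v => ?_) (fun n => ?_) fun n x ψ Φ hΦ hx z => ?_
  · rw [e9]; omega
  · rw [e9]; omega
  · have hw : n ≤ (C n).width := (C n).inp_le
    rw [hps n _ rfl, e9]
    exact CliffordT.valid_append (CliffordT.valid_append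
      (K.valid_applyAt _ (by omega) (by omega) (by omega))
      (K.valid_applyAt _ (by omega) (by omega) (by omega)))
      (CliffordT.valid_append (K.valid_neg (by omega)) (CliffordT.valid_append
      (K.valid_cmpLoop (by omega) (by omega) (by omega)) (CliffordT.valid_append
      (K.valid_cmpLoop (by omega) (by omega) (by omega))
      (K.valid_swap (by omega) (by omega) (by omega)))))
  · have hw : n ≤ (C n).width := (C n).inp_le
    obtain ⟨t, ht⟩ : ∃ t, t = n + n + (n + n) + (n + n) + (C n).width + (C n).width + 1 := ⟨_, rfl⟩
    rw [hps n t ht, e9, ← ht]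
    obtain ⟨F, hF, hFr, hFt⟩ := K.realizes_cmpLoop (m := n) (p := 0) (q := n + n + (n + n)) (t := t)
      (by omega) (by omega)
    obtain ⟨G, hG, hGr, hGt⟩ := K.realizes_cmpLoop (m := n) (p := n) (q := n + n + (n + n) + n)
      (t := t + n) (by omega) (by omega)
    refine (((K.triple_applyAt (hf n) (p := n + n + (n + n)) (s := n + n + (n + n) + (n + n))
      (by omega) _ ?_).append (K.triple_applyAt (hf n) (p := n + n + (n + n) + n)
        (s := n + n + (n + n) + (n + n) + (C n).width) (by omega) _ ?_)).append
      (((K.realizes_neg t).append (hF.append (hG.append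
        (K.realizes_swap (i := 0) (j := t + n + n) (by omega))))).triple _)).weaken ?_
    · rintro z h₀ i hi hiw
      rw [h₀ i (by omega), padBits_of_le _ (by omega)]
    · rintro z ⟨z₀, h₀, hr, -⟩ i hi hiw
      rw [hr i (by omega), h₀ i (by omega), padBits_of_le _ (by omega)]
    · rintro z' ⟨z, ⟨z₁, ⟨z₀, h₀, hr, hfz⟩, hr', hfz'⟩, rfl⟩
      have hv : v = sliceBits (n + n + (n + n) + (n + n)) 0 z₀ := by
        funext i
        have := h₀ i (by omega)
        rw [padBits_of_lt v i.2] at this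
        simpa [sliceBits] using this.symm
      have hz0 (i : ℕ) (hi : t ≤ i) (hi' : i < t + n + n + 1) : z i = false := by
        rw [hr' i (by omega), hr i (by omega), h₀ i hi', padBits_of_le _ (by omega)]
      set y := F (Function.update z t (!z t)) with hy
      have hyt : y (t + n) = decide (∀ j < n, z (n + n + (n + n) + j) = z (0 + j)) := by
        rw [hy, hFt _ fun j hj => ?_]
        · rw [Function.update_self, hz0 t le_rfl (by omega)]
          simp only [Bool.not_false, Bool.true_and]
          refine decide_eq_decide.2 (forall₂_congr fun j hj => ?_)
          rw [Function.update_of_ne (by omega), Function.update_of_ne (by omega)]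
        · rw [Function.update_of_ne (by omega), hz0 _ (by omega) (by omega)]
      have hyr (i : ℕ) (hi : n ≤ i) (hit : i < t ∨ t + n < i) : y i = z i := by
        rw [hy, hFr _ _ (by omega) (by omega), Function.update_of_ne (by omega)]
      have hx : G y (t + n + n) = (decide (∀ j < n, z (n + n + (n + n) + j) = z (0 + j)) &&
          decide (∀ j < n, z (n + n + (n + n) + n + j) = z (n + j))) := by
        rw [hGt _ fun j hj => ?_, hyt]
        · congr 1
          refine decide_eq_decide.2 (forall₂_congr fun j hj => ?_)
          rw [hyr _ (by omega) (by omega), hyr _ (by omega) (by omega)]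
        · rw [hyr _ (by omega) (by omega), hz0 _ (by omega) (by omega)]
      simp only [Function.comp_apply, ← hy]
      rw [sliceBits_one, Function.update_of_ne (by omega), Function.update_self, hx, hv]
      simp only [glQubitCommitment]
      simp only [fst_sliceBits, snd_sliceBits, zero_add]
      have h₁ : (∀ j < n, z (n + n + (n + n) + j) = z j) ↔
          f n (sliceBits n (n + n + (n + n)) z₀) = sliceBits n 0 z₀ := by
        rw [← hfz, sliceBits_eq_iff]
        refine forall₂_congr fun j hj => ?_
        rw [zero_add, hr' _ (by omega), hr' j (by omega), hr j (by omega)]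
      have e : sliceBits n (n + n + (n + n) + n) z₁ = sliceBits n (n + n + (n + n) + n) z₀ :=
        sliceBits_congr fun i _ _ => hr i (by omega)
      have h₂ : (∀ j < n, z (n + n + (n + n) + n + j) = z (n + j)) ↔
          f n (sliceBits n (n + n + (n + n) + n) z₀) = sliceBits n n z₀ := by
        rw [e] at hfz'
        rw [← hfz', sliceBits_eq_iff]
        refine forall₂_congr fun j hj => ?_
        rw [hr' (n + j) (by omega), hr (n + j) (by omega)]
      rw [← Bool.decide_and]
      simp only [h₁, h₂]
  · rw [hpre, e9]
    exact CliffordT.valid_append (K.valid_dotLoop (by omega) (by omega) (by omega) (by omega)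
      (by omega) (by omega)) (K.valid_dotPhaseLoop (by omega) (by omega) (by omega) (by omega)
      (by omega) (by omega))
  · rw [hpre, K.actAll_decrypt (by omega) (by omega) (by omega) (by omega) ψ hΦ]
    by_cases h : Φ z = 0
    · rw [h, mul_zero, mul_zero]
    · rw [← hx z h]
      simp only [glQubitCommitment]
      simp only [fst_sliceBits, snd_sliceBits, innerMod2_sliceBits]

end efficient

/-! ### The quantum Goldreich–Levin theorem of Adcock and Cleve -/

/-- The sign `(-1) ^ b`. -/
def sgn (b : Bool) : ℝ := if b then -1 else 1

/-- The product form matches the amplitudes of Hadamard gates, which factor over the qubits. -/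
theorem sgn_innerMod2 {n : ℕ} (y x : BitString n) :
    sgn (innerMod2 y x) = ∏ i, sgn (y i && x i) := by
  simp only [sgn, Finset.prod_ite, Finset.prod_const, one_pow, mul_one, innerMod2, Bool.and_eq_true,
    decide_eq_true_eq]
  split_ifs with h
  · rw [h.neg_one_pow]
  · rw [(Nat.not_odd_iff_even.1 h).neg_one_pow]

/-- The inverse gate. -/
def Gate.inv {m : ℕ} : Gate allGates m → Gate allGates m
  | .one a i => .one (a⁻¹ : Matrix.unitaryGroup Bool ℂ) i
  | .two b i j h => .two (b⁻¹ : Matrix.unitaryGroup (Bool × Bool) ℂ) i j h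

theorem unitary_mul_inv_apply {ι : Type} [Fintype ι] [DecidableEq ι]
    (U : Matrix.unitaryGroup ι ℂ) (v : ι → ℂ) (x : ι) :
    ∑ b, (U : Matrix ι ι ℂ) x b * ∑ c, ((U⁻¹ : Matrix.unitaryGroup ι ℂ) : Matrix ι ι ℂ) b c * v c =
      v x := by
  have h : ((U : Matrix ι ι ℂ) * ((U⁻¹ : Matrix.unitaryGroup ι ℂ) : Matrix ι ι ℂ)).mulVec v = v := by
    rw [← Submonoid.coe_mul, mul_inv_cancel, Submonoid.coe_one, Matrix.one_mulVec]
  rw [← Matrix.mulVec_mulVec] at h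
  exact congrFun h x

theorem Gate.apply_inv {m : ℕ} (g : Gate allGates m) (ψ : QState m) :
    g.apply (g.inv.apply ψ) = ψ := by
  cases g with
  | one a i =>
    funext x
    have h := unitary_mul_inv_apply a (fun b => ψ (Function.update x i b)) (x i)
    rw [Function.update_eq_self] at h
    simp only [Gate.apply, Gate.inv, allGates, id_eq, Function.update_self, Function.update_idem]
    exact h
  | two b i j hij =>
    funext x
    have h := unitary_mul_inv_apply b
      (fun p => ψ (Function.update (Function.update x i p.1) j p.2)) (x i, x j)
    simp only [Function.update_eq_self, Fintype.sum_prod_type] at h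
    have e (b c b' c' : Bool) : Function.update (Function.update (Function.update
        (Function.update x i b) j c) i b') j c' = Function.update (Function.update x i b') j c' := by
      rw [Function.update_comm hij, Function.update_idem, Function.update_comm hij.symm,
        Function.update_idem, Function.update_comm hij]
    simp only [Gate.apply, Gate.inv, allGates, id_eq, e, Function.update_self,
      Function.update_of_ne hij]
    exact h

theorem runGates_append {𝒢 : GateSet} {m : ℕ} (l l' : List (Gate 𝒢 m)) (ψ : QState m) :
    runGates (l ++ l') ψ = runGates l' (runGates l ψ) := by
  simp [runGates, List.foldl_append]

theorem runGates_inv {m : ℕ} (l : List (Gate allGates m)) (ψ : QState m) :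
    runGates l (runGates (l.map Gate.inv).reverse ψ) = ψ := by
  induction l with
  | nil => rfl
  | cons g l ih =>
    rw [List.map_cons, List.reverse_cons, runGates_append]
    change runGates l (g.apply (g.inv.apply _)) = ψ
    rw [Gate.apply_inv, ih]

theorem runGates_apply {𝒢 : GateSet} {m : ℕ} (l : List (PGate 𝒢 ℕ)) (hl : ∀ g ∈ l, g.Valid m)
    (ψ : QState m) (x : BitString m) :
    runGates (l.pmap (PGate.toGate m) hl) ψ x =
      actAll l (fun x => ψ (takeBits m x)) (padBits x) := by
  rw [← runGates_toGate, takeBits_padBits]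

theorem sum_append {M : Type*} [AddCommMonoid M] {k l : ℕ} (F : BitString (k + l) → M) :
    ∑ z, F z = ∑ y : BitString k, ∑ u : BitString l, F (Fin.append y u) := by
  rw [← (Fin.appendEquiv k l).sum_comp, Fintype.sum_prod_type]
  rfl

/-- The reduction controls a single amplitude of its final state, with the workspace restored; the
remaining amplitudes with the same output can only help. -/
theorem QCircuit.norm_sq_final_le_prob {𝒢 : GateSet} {inp out : ℕ} (C : QCircuit 𝒢 inp out)
    (φ : QState inp) (z : BitString C.width) :
    ‖C.final φ z‖ ^ 2 ≤ C.prob φ fun i => z (Fin.castLE C.out_le i) := by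
  obtain ⟨⟨y, w⟩, rfl⟩ := (joinEquiv C.out_le).surjective z
  have e : (fun i => joinEquiv C.out_le (y, w) (Fin.castLE C.out_le i)) = y :=
    joinBits_castLE C.out_le y w
  rw [e]
  exact Finset.single_le_sum (f := fun w => ‖C.final φ (joinBits y w)‖ ^ 2)
    (fun _ _ => by positivity) (Finset.mem_univ w)

/-! ### Hadamard and copying layers -/

namespace CliffordT

variable {𝒢 : GateSet} (K : CliffordT 𝒢)

/-- Hadamard gates on the first `n` qubits. -/
def hadLoop (n : ℕ) : List (PGate 𝒢 ℕ) := (List.range n).flatMap fun j => K.had j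

/-- The `n` bits from position `t` on are replaced by their sums with the first `n` bits. -/
def copyLoop (n t : ℕ) : List (PGate 𝒢 ℕ) := (List.range n).flatMap fun j => K.cx j (t + j)

theorem length_hadLoop (n : ℕ) : (K.hadLoop n).length = n := by
  simp [hadLoop, had, List.length_flatMap]

theorem length_copyLoop (n t : ℕ) : (K.copyLoop n t).length = n := by
  simp [copyLoop, cx, List.length_flatMap]

theorem length_swapLoop (n p q : ℕ) : (K.swapLoop n p q).length = 3 * n := by
  simp [swapLoop, swap, cx, List.length_flatMap, mul_comm]

/-- Induction on the number of Hadamard gates: the first `k` qubits already carry the factors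
(-1)^(aⱼ zⱼ)/√2, while the others are still pinned to `a`. The factor `Φ` is a spectator, since it
ignores the first `n` bits. -/
theorem actAll_hadLoop (n k : ℕ) (hk : k ≤ n) (a : ℕ → Bool) {Φ : (ℕ → Bool) → ℂ}
    (hΦ : ∀ z i b, i < n → Φ (Function.update z i b) = Φ z) (z : ℕ → Bool) :
    actAll (K.hadLoop k) (fun z => (if ∀ j < n, z j = a j then 1 else 0) * Φ z) z =
      (∏ j ∈ Finset.range k, ((sgn (a j && z j) : ℂ) / (Real.sqrt 2 : ℂ))) *
        ((if ∀ j < n, k ≤ j → z j = a j then 1 else 0) * Φ z) := by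
  induction k generalizing z with
  | zero => simp [hadLoop]
  | succ k ih =>
    have e : K.hadLoop (k + 1) = K.hadLoop k ++ K.had k := by
      simp [hadLoop, List.range_succ]
    rw [e, actAll_append, funext (ih (by omega))]
    simp only [had, actAll_cons, actAll_nil, K.act_H]
    have hp (b : Bool) : ∏ j ∈ Finset.range k,
        ((sgn (a j && Function.update z k b j) : ℂ) / (Real.sqrt 2 : ℂ)) =
          ∏ j ∈ Finset.range k, ((sgn (a j && z j) : ℂ) / (Real.sqrt 2 : ℂ)) :=
      Finset.prod_congr rfl fun j hj => by
        rw [Function.update_of_ne (Finset.mem_range.1 hj).ne]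
    have hc (b : Bool) : (∀ j < n, k ≤ j → Function.update z k b j = a j) ↔
        b = a k ∧ ∀ j < n, k + 1 ≤ j → z j = a j := by
      constructor
      · intro h
        refine ⟨by simpa using h k (by omega) le_rfl, fun j hj hkj => ?_⟩
        simpa [show j ≠ k by omega] using h j hj (by omega)
      · rintro ⟨rfl, h⟩ j hj hkj
        obtain rfl | hjk := eq_or_ne j k
        · simp
        · rw [Function.update_of_ne hjk]
          exact h j hj (by omega)
    rw [hp, hp, hΦ z k _ (by omega), hΦ z k _ (by omega), Finset.prod_range_succ]
    simp only [hc]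
    by_cases h : ∀ j < n, k + 1 ≤ j → z j = a j
    · simp only [if_pos h, and_iff_left h]
      cases a k <;> cases z k <;> simp [sgn] <;> ring
    · simp only [h, and_false, if_false]
      simp

theorem actAll_copyLoop (n t : ℕ) (ht : n ≤ t) (Ψ : (ℕ → Bool) → ℂ) (z : ℕ → Bool) :
    actAll (K.copyLoop n t) Ψ z =
      Ψ fun i => if t ≤ i ∧ i < t + n then xor (z (i - t)) (z i) else z i := by
  induction n generalizing Ψ z with
  | zero =>
    simp only [copyLoop, List.range_zero, List.flatMap_nil, actAll_nil]
    congr 1; funext i; rw [if_neg (by omega)]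
  | succ n ih =>
    have e : K.copyLoop (n + 1) t = K.copyLoop n t ++ K.cx n (t + n) := by
      simp [copyLoop, List.range_succ]
    rw [e, actAll_append, K.actAll_cx, ih (by omega)]
    congr 1
    funext i
    by_cases h1 : t ≤ i ∧ i < t + n
    · rw [if_pos h1, if_pos (by omega), Function.update_of_ne (by omega),
        Function.update_of_ne (by omega)]
    · rw [if_neg h1]
      by_cases h2 : i = t + n
      · subst h2
        rw [if_pos (by omega), Function.update_self, Nat.add_sub_cancel_left]
      · rw [if_neg (by omega), Function.update_of_ne h2]

theorem valid_hadLoop {n W : ℕ} (h : n ≤ W) : ∀ g ∈ K.hadLoop n, g.Valid W :=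
  valid_loop fun j hj => K.valid_had (by omega)

theorem valid_copyLoop {n t W : ℕ} (h : n ≤ t) (hW : t + n ≤ W) :
    ∀ g ∈ K.copyLoop n t, g.Valid W :=
  valid_loop fun j hj => K.valid_cx (by omega) (by omega) (by omega)

end CliffordT

/-- The average value of `(-1) ^ (z o)` when the qubits are measured after the gates `L`. -/
def bias {W : ℕ} (L : List (Gate allGates W)) (o : Fin W) (ψ : QState W) : ℝ :=
  ∑ u, sgn (u o) * ‖runGates L ψ u‖ ^ 2

/-- The sequence `e` with `b` in the positions from `p` on and `x` in those from `q` on. -/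
def plant {n : ℕ} (p q : ℕ) (e : ℕ → Bool) (b x : BitString n) : ℕ → Bool :=
  glueBits q (glueBits p e b) x

theorem ket_takeBits {m : ℕ} (z z' : ℕ → Bool) [Decidable (∀ i < m, z i = z' i)] :
    ket (takeBits m z') (takeBits m z) = if ∀ i < m, z i = z' i then 1 else 0 := by
  rw [ket, Pi.single_apply]
  refine if_congr ⟨fun h i hi => congrFun h ⟨i, hi⟩, fun h => funext fun i => h i i.2⟩ rfl rfl

theorem padBits_append {k l : ℕ} (y : BitString k) (u : BitString l) :
    padBits (Fin.append y u) = glueBits k (padBits y) u := by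
  funext i
  by_cases h : i < k
  · rw [glueBits_of_lt _ _ h, padBits_of_lt _ h, padBits_of_lt _ (by omega)]
    exact Fin.append_left y u ⟨i, h⟩
  · obtain ⟨j, rfl⟩ := Nat.exists_eq_add_of_le (not_lt.1 h)
    by_cases hj : j < l
    · rw [glueBits_add _ _ _ hj, padBits_of_lt _ (by omega)]
      exact Fin.append_right y u ⟨j, hj⟩
    · rw [glueBits_of_ge _ _ (by omega), padBits_of_le _ (by omega), padBits_of_le _ (by omega)]

/-! ### The inverter built from a predictor -/

section goldreichLevin

variable {n W p q : ℕ} (L : List (Gate allGates W))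

/-- A superposition of all `x`, the gates `L` with a copy of `x` as part of their input. -/
def queryGates (K : CliffordT allGates) (n q : ℕ) : List (PGate allGates ℕ) :=
  K.hadLoop n ++ K.copyLoop n (n + q) ++ L.map (Gate.wire n)

theorem valid_queryGates (K : CliffordT allGates) (hqW : q + n ≤ W) : ∀ g ∈ queryGates L K n q, g.Valid (n + W) := by
  refine CliffordT.valid_append (CliffordT.valid_append (K.valid_hadLoop (by omega))
    (K.valid_copyLoop (by omega) (by omega))) fun g hg => ?_
  obtain ⟨g', _, rfl⟩ := List.mem_map.1 hg
  exact g'.valid_wire n _ le_rfl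

/-- Once the string `y` in the first register has been copied, that register is never touched again.
Hence its component is the Hadamard amplitude of `a` at `y` times a run of `L` with `y` planted. The
cases of a general `a` and of the zero string are the two sides of the inner product in the
reduction. -/
theorem runGates_queryGates (K : CliffordT allGates) (hqW : q + n ≤ W) (hpq : p + n ≤ q ∨ q + n ≤ p)
    (a b y : BitString n) (u : BitString W) :
    runGates ((queryGates L K n q).pmap (PGate.toGate (n + W)) (valid_queryGates L K hqW))
        (ket (takeBits (n + W) (glueBits (n + p) (padBits a) b))) (Fin.append y u) =
      ((sgn (innerMod2 a y) : ℂ) / (Real.sqrt 2 : ℂ) ^ n) *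
        runGates L (ket (takeBits W (plant p q (fun _ => false) b y))) u := by
  classical
  rw [runGates_apply, queryGates, actAll_append, actAll_append, padBits_append, actAll_wire,
    ← congrFun (runGates_mul L _ _) u]
  refine congrFun (congrArg _ ?_) u
  funext u'
  let Φ : (ℕ → Bool) → ℂ := fun z =>
    if ∀ i < W, z (n + i) = glueBits p (fun _ => false) b i then 1 else 0
  have hΨ : (fun z => ket (takeBits (n + W) (glueBits (n + p) (padBits a) b))
      (takeBits (n + W) z)) = fun z => (if ∀ j < n, z j = padBits a j then 1 else 0) * Φ z := by
    funext z
    have e₁ (i : ℕ) (hi : i < n) : glueBits (n + p) (padBits a) b i = padBits a i :=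
      glueBits_of_lt _ _ (by omega)
    have e₂ (i : ℕ) : glueBits (n + p) (padBits a) b (n + i) =
        glueBits p (fun _ => false) b i := by
      unfold glueBits
      by_cases h : p ≤ i ∧ i - p < n
      · rw [dif_pos h, dif_pos (by omega)]
        congr 2
        omega
      · rw [dif_neg h, dif_neg (by omega), padBits_of_le _ (by omega)]
    rw [ket_takeBits, ite_zero_mul_ite_zero, mul_one]
    refine if_congr ⟨fun h => ⟨fun j hj => ?_, fun i hi => ?_⟩, fun h i hi => ?_⟩ rfl rfl
    · rw [h j (by omega), e₁ j hj]
    · rw [h (n + i) (by omega), e₂]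
    · by_cases hin : i < n
      · rw [h.1 i hin, e₁ i hin]
      · obtain ⟨j, rfl⟩ := Nat.exists_eq_add_of_le (not_lt.1 hin)
        rw [h.2 j (by omega), e₂]
  have hΦ (z : ℕ → Bool) (i : ℕ) (c : Bool) (hi : i < n) : Φ (Function.update z i c) = Φ z := by
    simp only [Φ]
    refine if_congr (forall₂_congr fun j _ => ?_) rfl rfl
    rw [Function.update_of_ne (by omega)]
  rw [K.actAll_copyLoop n (n + q) (by omega), hΨ, K.actAll_hadLoop n n le_rfl _ hΦ]
  congr 1
  · rw [Finset.prod_div_distrib, Finset.prod_const, Finset.card_range, sgn_innerMod2,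
      Complex.ofReal_prod, Finset.prod_range]
    congr 1
    refine Finset.prod_congr rfl fun i _ => ?_
    rw [if_neg (by omega), glueBits_of_lt _ _ i.2, padBits_of_lt _ i.2, padBits_of_lt _ i.2]
  · rw [if_pos fun j hj hj' => absurd hj (by omega), one_mul]
    have hu : u' = takeBits W (padBits u') := (takeBits_padBits u').symm
    conv_rhs => rw [hu, ket_takeBits]
    refine if_congr (forall₂_congr fun i hi => ?_) rfl rfl
    beta_reduce
    rw [glueBits_add _ _ _ hi, padBits_of_lt _ hi, plant]
    by_cases h : q ≤ i ∧ i < q + n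
    · obtain ⟨j, rfl⟩ := Nat.exists_eq_add_of_le h.1
      rw [if_pos (by omega), glueBits_add _ _ _ (by omega), show n + (q + j) - (n + q) = j by omega,
        glueBits_of_lt _ _ (by omega), padBits_of_lt _ (by omega)]
      -- The slots of b and x are disjoint and the slot of x starts at zero, so the sum modulo 2 is
      -- a true copy.
      have : glueBits p (fun _ => false) b (q + j) = false := by
        rcases hpq with h' | h'
        · exact glueBits_of_ge _ _ (by omega)
        · exact glueBits_of_lt _ _ (by omega)
      rw [this]
      cases y ⟨j, _⟩ <;> cases u' ⟨q + j, _⟩ <;> simp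
    · rw [if_neg (by omega)]
      have : glueBits q (glueBits p (fun _ => false) b) y i = glueBits p (fun _ => false) b i := by
        unfold glueBits
        rw [dif_neg (by omega)]
      rw [this]

/-- The input string arrives in the first register, which must be zero for the uniform
superposition; it is exchanged with the slot from which `L` reads it. -/
theorem runGates_swapGates (K : CliffordT allGates) (hpW : p + n ≤ W)
    (hl : ∀ g ∈ K.swapLoop n 0 (n + p), g.Valid (n + W)) (b : BitString n) :
    runGates ((K.swapLoop n 0 (n + p)).pmap (PGate.toGate (n + W)) hl)
        (ket (takeBits (n + W) (padBits b))) =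
      ket (takeBits (n + W) (glueBits (n + p) (fun _ => false) b)) := by
  classical
  obtain ⟨F, ⟨G, hFG, hG⟩, hF₁, hF₂, hF₃⟩ := K.realizes_swapLoop (m := n) (p := 0) (q := n + p)
    (by omega)
  funext x
  conv_rhs => rw [← takeBits_padBits x]
  rw [runGates_apply, hG, ket_takeBits, ket_takeBits]
  refine if_congr ?_ rfl rfl
  generalize padBits x = z
  have hz := hFG z
  generalize G z = z₀ at hz ⊢
  subst hz
  constructor
  · intro h i hi
    by_cases hin : i < n
    · have := hF₁ z₀ i hin
      rw [zero_add] at this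
      rw [this, h _ (by omega), padBits_of_le _ (by omega), glueBits_of_lt _ _ (by omega)]
    · by_cases hip : n + p ≤ i ∧ i < n + p + n
      · obtain ⟨j, rfl⟩ := Nat.exists_eq_add_of_le hip.1
        rw [hF₂ z₀ j (by omega), zero_add, h j (by omega), padBits_of_lt _ (by omega),
          glueBits_add _ _ _ (by omega)]
      · rw [hF₃ z₀ i (by omega), h i hi, padBits_of_le _ (by omega), glueBits, dif_neg (by omega)]
  · intro h i hi
    by_cases hin : i < n
    · rw [← zero_add i, ← hF₂ z₀ i hin, h _ (by omega), glueBits_add _ _ _ hin, zero_add,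
        padBits_of_lt _ hin]
    · by_cases hip : n + p ≤ i ∧ i < n + p + n
      · obtain ⟨j, rfl⟩ := Nat.exists_eq_add_of_le hip.1
        rw [← hF₁ z₀ j (by omega), h _ (by omega), glueBits_of_lt _ _ (by omega),
          padBits_of_le _ (by omega)]
      · rw [← hF₃ z₀ i (by omega), h i hi, padBits_of_le _ (by omega), glueBits, dif_neg (by omega)]

theorem exists_circuit_bias_sq_le_prob (K : CliffordT allGates) (hpW : p + n ≤ W) (hqW : q + n ≤ W)
    (hpq : p + n ≤ q ∨ q + n ≤ p) (o : Fin W) :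
    ∃ A : QCircuit allGates n n, A.size = 7 * n + 2 * L.length + 1 ∧ ∀ a b : BitString n,
      (uniformAvg fun x => sgn (innerMod2 a x) *
        bias L o (ket (takeBits W (plant p q (fun _ => false) b x)))) ^ 2 ≤
          A.prob (ket b) a := by
  classical
  have hs : ∀ g ∈ K.swapLoop n 0 (n + p), g.Valid (n + W) :=
    K.valid_swapLoop (by omega) (by omega) (by omega)
  let G : List (Gate allGates (n + W)) :=
    (queryGates L K n q).pmap (PGate.toGate (n + W)) (valid_queryGates L K hqW)
  -- With Z between `G` and its inverse, measurement of the output qubit is replaced by a sign, so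
  -- the expectation of that sign appears as an amplitude.
  let Z : Gate allGates (n + W) := .one pauliZ (Fin.natAdd n o)
  let A : QCircuit allGates n n :=
    { width := n + W
      inp_le := by omega
      out_le := by omega
      gates := (K.swapLoop n 0 (n + p)).pmap (PGate.toGate (n + W)) hs ++
        (G ++ Z :: (G.map Gate.inv).reverse) }
  refine ⟨A, ?_, fun a b => ?_⟩
  · simp only [QCircuit.size, A, G, queryGates, List.length_append, List.length_pmap,
      List.length_cons, List.length_reverse, List.length_map, K.length_hadLoop, K.length_copyLoop,
      K.length_swapLoop]
    omega
  let t : BitString (n + W) := takeBits (n + W) (glueBits (n + p) (padBits a) b)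
  have hta : (fun i => t (Fin.castLE A.out_le i)) = a := by
    funext i
    have : glueBits (n + p) (padBits a) b i = a i := by
      rw [glueBits_of_lt _ _ (by omega), padBits_of_lt _ i.2]
    exact this
  have hp := A.norm_sq_final_le_prob (ket b) t
  rw [hta] at hp
  refine le_trans (le_of_eq ?_) hp
  have hpad : (fun _ => false : ℕ → Bool) = padBits (fun _ => false : BitString n) := by
    funext i; simp [padBits]
  have hinit : A.initial (ket b) = ket (takeBits (n + W) (padBits b)) := by
    funext z
    rw [← takeBits_padBits z]
    exact (A.initial_ket_takeBits b _).trans (ket_takeBits _ _).symm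
  have hfinal : A.final (ket b) = runGates (G.map Gate.inv).reverse (Z.apply (runGates G
      (ket (takeBits (n + W) (glueBits (n + p) (fun _ => false) b))))) := by
    rw [A.final_eq, hinit]
    simp only [A, runGates_append]
    rw [runGates_swapGates K hpW]
    rfl
  -- The inverse is never evaluated: `G` is applied to both sides of the inner product, giving ⟨G t,
  -- Z G s⟩ with `s` the state after the exchange.
  have hinner : A.final (ket b) t =
      ∑ z, star (runGates G (ket t) z) * Z.apply (runGates G
        (ket (takeBits (n + W) (glueBits (n + p) (fun _ => false) b)))) z := by
    have h := inner_runGates G (ket t) (A.final (ket b))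
    rw [hfinal, runGates_inv, ← hfinal] at h
    rw [h, Finset.sum_eq_single t]
    · simp [ket]
    · intro z _ hz; simp [ket, hz]
    · simp
  have hZ (ψ : QState (n + W)) (z) : Z.apply ψ z = (sgn (z (Fin.natAdd n o)) : ℂ) * ψ z := by
    have e := Function.update_eq_self (Fin.natAdd n o) z
    simp only [Z, Gate.apply, allGates, id_eq, pauliZ, Fintype.sum_bool, Matrix.diagonal_apply, sgn]
    cases h : z (Fin.natAdd n o) <;> rw [h] at e <;> simp [e]
  have h₂ : ((Real.sqrt 2 : ℂ) ^ n) * (Real.sqrt 2 : ℂ) ^ n = 2 ^ n := by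
    rw [← mul_pow, ← Complex.ofReal_mul, Real.mul_self_sqrt (by norm_num)]
    norm_num
  have key : A.final (ket b) t = ((uniformAvg fun x => sgn (innerMod2 a x) *
      bias L o (ket (takeBits W (plant p q (fun _ => false) b x))) : ℝ) : ℂ) := by
    rw [hinner, sum_append, uniformAvg, Complex.ofReal_div, Complex.ofReal_sum, Finset.sum_div]
    refine Finset.sum_congr rfl fun y _ => ?_
    simp only [bias, Finset.mul_sum, Complex.ofReal_sum, Finset.sum_div]
    refine Finset.sum_congr rfl fun u _ => ?_
    -- The initial state has the zero string in the first register, so only the sign (-1)^(a·y) from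
    -- `t` survives, and the two normalizations multiply to 1/2ⁿ.
    have h0 : sgn (innerMod2 (fun _ => false) y) = 1 := by
      rw [sgn_innerMod2]
      simp [sgn]
    rw [hZ, runGates_queryGates L K hqW hpq, hpad, runGates_queryGates L K hqW hpq, h0,
      Fin.append_right, ← hpad]
    generalize runGates L (ket (takeBits W (plant p q (fun _ => false) b y))) u = φ
    have hφ : (‖φ‖ : ℂ) ^ 2 = star φ * φ := by rw [Complex.star_def, Complex.conj_mul']
    push_cast
    rw [hφ, ← h₂]
    simp only [star_mul', star_div₀, star_pow, Complex.star_def, Complex.conj_ofReal]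
    field_simp
  rw [key, Complex.norm_real, Real.norm_eq_abs, sq_abs]

end goldreichLevin

theorem sgn_true : sgn true = -1 := rfl

theorem sgn_false : sgn false = 1 := rfl

/-! ### Averages -/

theorem uniformAvg_append {k l : ℕ} (g : BitString (k + l) → ℝ) :
    uniformAvg g = uniformAvg fun a => uniformAvg fun x => g (Fin.append a x) := by
  simp only [uniformAvg]
  rw [sum_append, ← Finset.sum_div, div_div, pow_add, mul_comm]

theorem uniformAvg_comm {k l : ℕ} (g : BitString k → BitString l → ℝ) :
    (uniformAvg fun a => uniformAvg fun x => g a x) =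
      uniformAvg fun x => uniformAvg fun a => g a x := by
  simp only [uniformAvg]
  rw [← Finset.sum_div, ← Finset.sum_div, Finset.sum_comm, div_div, div_div, mul_comm]

theorem uniformAvg_add {n : ℕ} (g h : BitString n → ℝ) :
    (uniformAvg fun a => g a + h a) = uniformAvg g + uniformAvg h := by
  simp only [uniformAvg]
  rw [Finset.sum_add_distrib, add_div]

theorem uniformAvg_sub {n : ℕ} (g h : BitString n → ℝ) :
    (uniformAvg fun a => g a - h a) = uniformAvg g - uniformAvg h := by
  simp only [uniformAvg]
  rw [Finset.sum_sub_distrib, sub_div]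

theorem uniformAvg_mul {n : ℕ} (c : ℝ) (g : BitString n → ℝ) :
    (uniformAvg fun a => c * g a) = c * uniformAvg g := by
  simp only [uniformAvg]
  rw [← Finset.mul_sum, mul_div_assoc]

theorem uniformAvg_const (n : ℕ) (c : ℝ) : (uniformAvg fun _ : BitString n => c) = c := by
  simp [uniformAvg]

theorem uniformAvg_mono {n : ℕ} {g h : BitString n → ℝ} (hgh : ∀ a, g a ≤ h a) :
    uniformAvg g ≤ uniformAvg h := by
  unfold uniformAvg
  gcongr with a
  exact hgh a

theorem abs_uniformAvg_lt {n : ℕ} {g : BitString n → ℝ} {δ : ℝ} (h : ∀ a, |g a| < δ) :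
    |uniformAvg g| < δ := by
  have hp : (0 : ℝ) < 2 ^ n := by positivity
  rw [uniformAvg, abs_div, abs_of_pos hp, div_lt_iff₀ hp]
  calc |∑ a, g a| ≤ ∑ a, |g a| := Finset.abs_sum_le_sum_abs _ _
    _ < ∑ _a : BitString n, δ := Finset.sum_lt_sum_of_nonempty Finset.univ_nonempty fun a _ => h a
    _ = δ * 2 ^ n := by simp [mul_comm]

/-- The difference of the two sides is the variance of `g`. -/
theorem sq_uniformAvg_le {n : ℕ} (g : BitString n → ℝ) :
    uniformAvg g ^ 2 ≤ uniformAvg fun a => g a ^ 2 := by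
  have h : 0 ≤ uniformAvg fun a => (g a - uniformAvg g) ^ 2 := by
    rw [← uniformAvg_const n 0]
    exact uniformAvg_mono fun a => by positivity
  have e : (uniformAvg fun a => (g a - uniformAvg g) ^ 2) =
      (uniformAvg fun a => g a ^ 2) - uniformAvg g ^ 2 := by
    have : (fun a => (g a - uniformAvg g) ^ 2) =
        fun a => (g a ^ 2 + uniformAvg g ^ 2) - (2 * uniformAvg g) * g a := by funext a; ring
    rw [this, uniformAvg_sub, uniformAvg_add, uniformAvg_const, uniformAvg_mul]
    ring
  linarith

@[simp] theorem BitString.fst_append {k l : ℕ} (a : BitString k) (x : BitString l) :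
    BitString.fst (Fin.append a x) = a := by
  funext i; simp [BitString.fst]

@[simp] theorem BitString.snd_append {k l : ℕ} (a : BitString k) (x : BitString l) :
    BitString.snd (Fin.append a x) = x := by
  funext i; simp [BitString.snd]

/-! ### The bias of a circuit on a one-way permutation -/

/-- Negations of the qubits `i` with `e i`. -/
def flipGates (W : ℕ) (e : ℕ → Bool) : (N : ℕ) → N ≤ W → List (Gate allGates W)
  | 0, _ => []
  | N + 1, h => flipGates W e N (by omega) ++ if e N then [.one pauliX ⟨N, h⟩] else []

theorem length_flipGates_le (W : ℕ) (e : ℕ → Bool) (N : ℕ) (h : N ≤ W) :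
    (flipGates W e N h).length ≤ N := by
  induction N with
  | zero => simp [flipGates]
  | succ N ih =>
    have := ih (by omega)
    rw [flipGates, List.length_append]
    split_ifs <;> simp <;> omega

theorem runGates_flipGates {W : ℕ} (e : ℕ → Bool) (N : ℕ) (h : N ≤ W) (s : BitString W) :
    runGates (flipGates W e N h) (ket s) =
      ket fun i => if (i : ℕ) < N then xor (s i) (e i) else s i := by
  induction N with
  | zero => simp [flipGates, runGates]
  | succ N ih =>
    rw [flipGates, runGates_append, ih (by omega)]
    split_ifs with he
    · funext z
      simp only [runGates, List.foldl_cons, List.foldl_nil, Gate.apply, allGates, id_eq, pauliX,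
        Fintype.sum_bool, Matrix.of_apply]
      have : (if z ⟨N, h⟩ = true then (0 : ℂ) else 1) *
          ket (fun i => if (i : ℕ) < N then xor (s i) (e i) else s i)
            (Function.update z ⟨N, h⟩ true) +
          (if z ⟨N, h⟩ = false then (0 : ℂ) else 1) *
          ket (fun i => if (i : ℕ) < N then xor (s i) (e i) else s i)
            (Function.update z ⟨N, h⟩ false) =
          ket (fun i => if (i : ℕ) < N then xor (s i) (e i) else s i)
            (Function.update z ⟨N, h⟩ (!z ⟨N, h⟩)) := by
        cases z ⟨N, h⟩ <;> simp
      rw [this]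
      simp only [ket, Pi.single_apply]
      refine if_congr ?_ rfl rfl
      rw [funext_iff, funext_iff]
      refine forall_congr' fun i => ?_
      by_cases hi : (i : ℕ) = N
      · obtain rfl : i = ⟨N, h⟩ := Fin.ext hi
        simp only [Function.update_self, lt_irrefl, if_false, Nat.lt_succ_self, if_true, he]
        cases z ⟨N, h⟩ <;> cases s ⟨N, h⟩ <;> simp
      · rw [Function.update_of_ne fun h' => hi (congrArg Fin.val h')]
        simp only [show ((i : ℕ) < N + 1) ↔ (i : ℕ) < N by omega]
    · change ket _ = ket _
      congr 1
      funext i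
      by_cases hi : (i : ℕ) = N
      · simp [hi, he]
      · simp only [show ((i : ℕ) < N + 1) ↔ (i : ℕ) < N by omega]

theorem bias_append {W : ℕ} (L L' : List (Gate allGates W)) (o : Fin W) (ψ : QState W) :
    bias (L ++ L') o ψ = bias L' o (runGates L ψ) := by
  simp only [bias, runGates_append]

/-- A correlation of at least δ would make the inverter succeed with average probability at least
δ², by convexity of the square. The string `e` holds the remaining input and may be arbitrary, since
it is built into the circuit by at most `N` negations. -/
theorem abs_avg_bias_lt {n W p q T N : ℕ} {f : Equiv.Perm (BitString n)} {δ : ℝ} (hδ : 0 ≤ δ)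
    (hf : HardToInvert f (δ ^ 2) T) (K : CliffordT allGates) (L : List (Gate allGates W))
    (hpq : p + n ≤ q ∨ q + n ≤ p) (hpN : p + n ≤ N) (hqN : q + n ≤ N) (hNW : N ≤ W) (o : Fin W)
    (e : ℕ → Bool) (he : ∀ i, N ≤ i → e i = false) (hT : 7 * n + 2 * (N + L.length) + 1 ≤ T) :
    |uniformAvg fun a => uniformAvg fun x => sgn (innerMod2 a x) *
      bias L o (ket (takeBits W (plant p q e (f a) x)))| < δ := by
  -- In the two slots `plant` overrides `e`, so no bit may be flipped there.
  let e' : ℕ → Bool := fun i =>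
    if (p ≤ i ∧ i - p < n) ∨ (q ≤ i ∧ i - q < n) then false else e i
  have hflip (b x : BitString n) : runGates (flipGates W e' N hNW)
      (ket (takeBits W (plant p q (fun _ => false) b x))) =
        ket (takeBits W (plant p q e b x)) := by
    rw [runGates_flipGates]
    congr 1
    funext i
    simp only [takeBits, plant, glueBits, e']
    by_cases h₁ : q ≤ (i : ℕ) ∧ (i : ℕ) - q < n
    · simp [h₁]
    · by_cases h₂ : p ≤ (i : ℕ) ∧ (i : ℕ) - p < n
      · simp [h₁, h₂]
      · by_cases hi : (i : ℕ) < N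
        · simp [h₁, h₂, hi]
        · simp [h₁, h₂, hi, he i (by omega)]
  obtain ⟨A, hA, hAp⟩ := exists_circuit_bias_sq_le_prob (flipGates W e' N hNW ++ L) K
    (by omega) (by omega) hpq o
  by_contra hlt
  rw [not_lt] at hlt
  refine hf ⟨A, ?_, ?_⟩
  · have := length_flipGates_le W e' N hNW
    rw [hA, List.length_append]
    omega
  · refine le_trans ?_ (uniformAvg_mono fun a => hAp a (f a))
    refine le_trans ?_ (sq_uniformAvg_le _)
    simp only [bias_append, hflip]
    rw [← sq_abs (uniformAvg _)]
    gcongr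

/-- One choice of parameters for both schemes: 15n + 2n^d + 5 is the size of the inverter for the
qubit scheme, with 4n + 1 negations and one gate for the state, and it exceeds what the bit scheme
needs. Two extra powers of n absorb it, and the exponent 2c accounts for the squared correlation. -/
theorem eventually_hardToInvert {𝒢 : GateSet} {f : ∀ n, Equiv.Perm (BitString n)}
    (hf : IsQuantumOneWayPermutation 𝒢 f) (c d : ℕ) :
    ∀ᶠ n : ℕ in atTop, HardToInvert (f n) ((1 / (n : ℝ) ^ c) ^ 2) (n ^ (d + 2)) ∧
      15 * n + 2 * n ^ d + 5 ≤ n ^ (d + 2) ∧ 0 < 1 / (n : ℝ) ^ c := by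
  filter_upwards [hf.hard (c * 2) (d + 2), eventually_ge_atTop 17] with n hn h17
  refine ⟨?_, ?_, by positivity⟩
  · rwa [div_pow, one_pow, ← pow_mul]
  · have h1 : 1 ≤ n ^ d := Nat.one_le_pow _ _ (by omega)
    have h2 : 15 * n + 7 ≤ n ^ 2 := by nlinarith
    rw [pow_add]
    nlinarith [Nat.mul_le_mul_left (n ^ d) h2, Nat.mul_le_mul_left (15 * n) h1]

/-! ### The bit commitment is concealing -/

theorem QCircuit.initial_ket {𝒢 : GateSet} {inp out : ℕ} (C : QCircuit 𝒢 inp out)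
    (y : BitString inp) : C.initial (ket y) = ket (takeBits C.width (padBits y)) := by
  classical
  funext z
  rw [← takeBits_padBits z, C.initial_ket_takeBits, ket_takeBits]

/-- The first qubit of a circuit with one output qubit. -/
def QCircuit.outQubit {inp : ℕ} (C : QCircuit allGates inp 1) : Fin C.width := ⟨0, C.out_le⟩

theorem QCircuit.prob_eq {inp : ℕ} (C : QCircuit allGates inp 1) {φ : QState inp}
    (hφ : ∑ y, ‖φ y‖ ^ 2 = 1) (c : Bool) :
    C.prob φ ![c] = (1 + sgn c * bias C.gates C.outQubit (C.initial φ)) / 2 := by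
  have h₁ : ∑ y, C.prob φ y = 1 := by rw [C.sum_prob, hφ]
  have h₂ : bias C.gates C.outQubit (C.initial φ) = ∑ y : BitString 1, sgn (y 0) * C.prob φ y := by
    rw [bias, ← sum_joinBits C.out_le]
    refine Finset.sum_congr rfl fun y _ => ?_
    rw [QCircuit.prob, Finset.mul_sum]
    refine Finset.sum_congr rfl fun w _ => ?_
    congr 2
  have h₃ (F : BitString 1 → ℝ) : ∑ y, F y = F ![true] + F ![false] := by
    rw [← (Equiv.funUnique (Fin 1) Bool).symm.sum_comp, Fintype.sum_bool]
    congr 2 <;> (funext i; fin_cases i; rfl)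
  rw [h₃] at h₁ h₂
  rw [h₂]
  cases c <;> simp [sgn] <;> linarith

theorem glBitCommitment_concealing {𝒢 : GateSet} {f : ∀ n, Equiv.Perm (BitString n)}
    (hf : IsQuantumOneWayPermutation 𝒢 f) (K : CliffordT allGates) :
    (glBitCommitment f).IsComputationallyConcealing := by
  intro c d
  filter_upwards [eventually_hardToInvert hf c d] with n ⟨hn, hT, hδ⟩
  rintro ⟨C, hC, hsucc⟩
  change QCircuit allGates (n + n + 1) 1 at C
  let com (z : Bool) (r : BitString (n + n)) : BitString (n + n + 1) :=
    Fin.append (Fin.append (f n r.fst) r.snd) ![xor z (innerMod2 r.fst r.snd)]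
  change 1 / 2 + 1 / (n : ℝ) ^ c ≤
    (∑ z : Bool, uniformAvg fun r => C.prob (ket (com z r)) ![z]) / 2 at hsucc
  set δ : ℝ := 1 / (n : ℝ) ^ c
  have hw : n + n + 1 ≤ C.width := C.inp_le
  let β (b x : BitString n) (c : Bool) : ℝ :=
    bias C.gates C.outQubit (C.initial (ket (Fin.append (Fin.append b x) ![c])))
  have hβ (c : Bool) :
      |uniformAvg fun a => uniformAvg fun x => sgn (innerMod2 a x) * β (f n a) x c| < δ := by
    have hk (b x : BitString n) : C.initial (ket (Fin.append (Fin.append b x) ![c])) =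
        ket (takeBits C.width
          (plant 0 n (Function.update (fun _ => false) (n + n) c) b x)) := by
      refine (C.initial_ket _).trans (congrArg (fun z => ket (takeBits C.width z)) ?_)
      rw [padBits_append, padBits_append, plant]
      funext i
      unfold glueBits padBits
      by_cases h₁ : i = n + n
      · subst h₁; simp
      · by_cases h₂ : i < n
        · simp [h₂, show ¬ n + n ≤ i by omega, show ¬ n ≤ i by omega]
        · by_cases h₃ : i - n < n
          · simp [h₃, show ¬ n + n ≤ i by omega, show n ≤ i by omega]
          · simp [h₁, h₂, h₃, show ¬ i - (n + n) = 0 by omega]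
    simp only [β, hk]
    refine abs_avg_bias_lt (N := n + n + 1) hδ.le hn K C.gates (.inl (by omega)) (by omega)
      (by omega) hw C.outQubit _ (fun i hi => Function.update_of_ne (by omega) _ _) ?_
    have : C.gates.length ≤ n ^ d := hC
    omega
  have hsum : (∑ z : Bool, uniformAvg fun r => C.prob (ket (com z r)) ![z])
      -- For a given masked bit c the committed bit is c ⊕ a·x, with sign `sgn c` times (-1)^(a·x).
      -- Hence success minus 1/2 is a quarter of a signed sum of two correlations, each below δ.
      / 2 = 1 / 2 + (∑ c : Bool, sgn c * uniformAvg fun a => uniformAvg fun x =>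
        sgn (innerMod2 a x) * β (f n a) x c) / 4 := by
    have hpt (a x : BitString n) :
        C.prob (ket (com true (Fin.append a x))) ![true] +
          C.prob (ket (com false (Fin.append a x))) ![false] =
        1 + 1 / 2 * (sgn (innerMod2 a x) * β (f n a) x false -
          sgn (innerMod2 a x) * β (f n a) x true) := by
      rw [C.prob_eq (QCircuit.normSq_ket _), C.prob_eq (QCircuit.normSq_ket _)]
      simp only [com, BitString.fst_append, BitString.snd_append, β]
      cases innerMod2 a x <;> simp [sgn] <;> ring
    rw [Fintype.sum_bool, Fintype.sum_bool, ← uniformAvg_add]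
    refine (congrArg (· / 2) ((uniformAvg_append (k := n) (l := n) _).trans
      (congrArg uniformAvg (funext fun a => congrArg uniformAvg (funext (hpt a)))))).trans ?_
    simp only [uniformAvg_add, uniformAvg_const, uniformAvg_mul, uniformAvg_sub]
    simp only [sgn_true, sgn_false]
    ring
  rw [hsum] at hsucc
  have h₁ := abs_lt.1 (hβ true)
  have h₂ := abs_lt.1 (hβ false)
  simp only [Fintype.sum_bool, sgn_true, sgn_false] at hsucc
  linarith

/-! ### The qubit commitment is concealing -/

theorem glueBits_append {k l : ℕ} (s : ℕ) (z : ℕ → Bool) (y : BitString k) (u : BitString l) :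
    glueBits s z (Fin.append y u) = glueBits (s + k) (glueBits s z y) u := by
  funext i
  by_cases h : i < s
  · rw [glueBits_of_lt _ _ h, glueBits_of_lt _ _ (by omega), glueBits_of_lt _ _ h]
  · obtain ⟨j, rfl⟩ := Nat.exists_eq_add_of_le (not_lt.1 h)
    by_cases hk : j < k
    · rw [glueBits_add _ _ _ (by omega), glueBits_of_lt _ _ (by omega), glueBits_add _ _ _ hk]
      exact Fin.append_left y u ⟨j, hk⟩
    · obtain ⟨m, rfl⟩ := Nat.exists_eq_add_of_le (not_lt.1 hk)
      by_cases hl : m < l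
      · rw [glueBits_add _ _ _ (by omega), ← add_assoc, glueBits_add _ _ _ hl]
        exact Fin.append_right y u ⟨m, hl⟩
      · rw [glueBits_of_ge _ _ (by omega), glueBits_of_ge _ _ (by omega),
          glueBits_of_ge _ _ (by omega)]

theorem glueBits_comm {k l : ℕ} {s t : ℕ} (h : s + k ≤ t) (z : ℕ → Bool) (y : BitString k)
    (u : BitString l) : glueBits s (glueBits t z u) y = glueBits t (glueBits s z y) u := by
  funext i
  by_cases hi : i < t
  · rw [glueBits_of_lt _ u hi]
    unfold glueBits
    rw [dif_neg (c := t ≤ i ∧ i - t < l) (by omega)]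
  · rw [glueBits_of_ge _ y (by omega)]
    unfold glueBits
    rw [dif_neg (c := s ≤ i ∧ i - s < k) (by omega)]

/-- A unitary matrix that maps `|0⟩` to `φ`. -/
theorem exists_unitary_apply_false {φ : Bool → ℂ} (hφ : ∑ b, ‖φ b‖ ^ 2 = 1) :
    ∃ U : Matrix.unitaryGroup Bool ℂ, ∀ b, (U : Matrix Bool Bool ℂ) b false = φ b := by
  have h : (‖φ true‖ : ℂ) ^ 2 + (‖φ false‖ : ℂ) ^ 2 = 1 := by
    rw [Fintype.sum_bool] at hφ
    exact_mod_cast hφ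
  rw [← Complex.mul_conj', ← Complex.mul_conj'] at h
  -- The second column is the standard unit vector orthogonal to φ.
  refine ⟨⟨Matrix.of fun x y => if y then (if x then star (φ false) else - star (φ true)) else φ x,
    ?_⟩, fun b => rfl⟩
  rw [Matrix.mem_unitaryGroup_iff]
  ext x y
  cases x <;> cases y <;> simp [Matrix.mul_apply, Matrix.star_apply] <;>
    first | ring1 | linear_combination h

theorem normSq_qubitKet {k : ℕ} (φ : Bool → ℂ) (y : BitString k) :
    ∑ z, ‖qubitKet φ y z‖ ^ 2 = ∑ b, ‖φ b‖ ^ 2 := by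
  rw [← (Fin.consEquiv fun _ : Fin (k + 1) => Bool).sum_comp, Fintype.sum_prod_type]
  refine Finset.sum_congr rfl fun b _ => ?_
  have := QCircuit.normSq_ket y
  simp only [qubitKet, Fin.consEquiv, Equiv.coe_fn_mk, Fin.cons_zero, Fin.cons_succ, norm_mul,
    mul_pow]
  rw [← Finset.mul_sum, this, mul_one]

/-- The committed qubit is at position 0, which is also the output qubit of `C`. One gate there
prepares φ, so the reduction for classical inputs covers quantum ones. -/
theorem apply_ket_eq_initial {k : ℕ} (C : QCircuit allGates (k + 1) 1) {φ : Bool → ℂ}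
    {U : Matrix.unitaryGroup Bool ℂ} (hU : ∀ b, (U : Matrix Bool Bool ℂ) b false = φ b)
    (y : BitString k) :
    (Gate.one U C.outQubit : Gate allGates C.width).apply
        (ket (takeBits C.width (glueBits 1 (fun _ => false) y))) = C.initial (qubitKet φ y) := by
  classical
  funext z
  obtain ⟨x, rfl⟩ : ∃ x, z = takeBits C.width x := ⟨padBits z, (takeBits_padBits z).symm⟩
  have hw := C.inp_le
  rw [C.initial_takeBits]
  have e (b : Bool) : Function.update (takeBits C.width x) C.outQubit b =
      takeBits C.width (Function.update x 0 b) := (takeBits_update C.width x C.outQubit b).symm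
  simp only [Gate.apply, allGates, id_eq, Fintype.sum_bool, e, ket_takeBits]
  -- Qubit 0 starts as zero, so only the column of `U` at `false` contributes.
  rw [if_neg (c := ∀ i < C.width, Function.update x 0 true i = _), mul_zero, zero_add, hU]
  · have hiff : (∀ i < C.width, Function.update x 0 false i = glueBits 1 (fun _ => false) y i) ↔
        (∀ i, k + 1 ≤ i → i < C.width → x i = false) ∧ (fun i : Fin k => x (i + 1)) = y := by
      constructor
      · intro h
        refine ⟨fun i hi hiw => ?_, funext fun i => ?_⟩
        · have := h i hiw
          rwa [Function.update_of_ne (by omega), glueBits_of_ge _ _ (by omega)] at this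
        · have := h (1 + i) (by omega)
          rwa [Function.update_of_ne (by omega), glueBits_add _ _ _ i.2, add_comm] at this
      · rintro ⟨h, rfl⟩ i hi
        rcases Nat.eq_zero_or_pos i with rfl | h0
        · rw [Function.update_self, glueBits_of_lt _ _ (by omega)]
        · rw [Function.update_of_ne (by omega)]
          by_cases hk : i < 1 + k
          · obtain ⟨j, rfl⟩ := Nat.exists_eq_add_of_le h0
            rw [glueBits_add _ _ _ (by omega), add_comm]
          · rw [glueBits_of_ge _ _ (by omega), h i (by omega) hi]
    simp only [hiff]
    have hq : qubitKet φ y (takeBits (k + 1) x) =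
        φ (x 0) * if (fun i : Fin k => x (i + 1)) = y then 1 else 0 := by
      simp only [qubitKet, ket, Pi.single_apply]
      rfl
    rw [hq]
    by_cases h₁ : ∀ i, k + 1 ≤ i → i < C.width → x i = false
    · rw [if_pos h₁]
      simp only [and_iff_right h₁]
      rfl
    · simp only [h₁, false_and, if_false, mul_zero]
  · intro h
    have := h 0 (by omega)
    rw [Function.update_self, glueBits_of_lt _ _ (by omega)] at this
    exact Bool.noConfusion this

theorem final_qubitKet {k out : ℕ} {𝒢 : GateSet} (C : QCircuit 𝒢 (k + 1) out) (φ : Bool → ℂ)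
    (y : BitString k) (z : BitString C.width) :
    C.final (qubitKet φ y) z = ∑ b, φ b * C.final (qubitKet (Pi.single b 1) y) z := by
  have h : C.initial (qubitKet φ y) =
      fun z => ∑ b, φ b * C.initial (qubitKet (Pi.single b 1) y) z := by
    funext z
    simp only [QCircuit.initial]
    split_ifs
    · simp only [qubitKet, Fintype.sum_bool]
      cases z _ <;> simp
    · simp
  rw [C.final_eq, h, runGates_sum]
  rfl

/-- Up to sign the four Pauli states have coordinates (p, q), (p, -q), (q, p), (q, -p). The
parallelogram law for each pair removes the cross terms. -/
theorem sum_norm_sq_pauli {A B p q : ℂ} (h : ‖p‖ ^ 2 + ‖q‖ ^ 2 = 1) :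
    ‖p * A + q * B‖ ^ 2 + ‖p * A - q * B‖ ^ 2 + (‖q * A + p * B‖ ^ 2 + ‖q * A - p * B‖ ^ 2) =
      2 * (‖A‖ ^ 2 + ‖B‖ ^ 2) := by
  have h₁ := parallelogram_law_with_norm ℝ (p * A) (q * B)
  have h₂ := parallelogram_law_with_norm ℝ (q * A) (p * B)
  simp only [norm_mul] at h₁ h₂
  linear_combination h₁ + h₂ + 2 * (‖A‖ ^ 2 + ‖B‖ ^ 2) * h

/-- The state `X ^ c Z ^ d ψ`. -/
def pauliState (ψ : Bool → ℂ) (c d : Bool) : Bool → ℂ :=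
  ((pauliX ^ c.toNat * pauliZ ^ d.toNat : Matrix.unitaryGroup Bool ℂ) : Matrix Bool Bool ℂ).mulVec ψ

theorem pauliState_apply (ψ : Bool → ℂ) (c d t : Bool) :
    pauliState ψ c d t = (if d && xor t c then -1 else 1) * ψ (xor t c) := by
  rw [pauliState, Submonoid.coe_mul, ← Matrix.mulVec_mulVec, pauliX_pow_mulVec, pauliZ_pow_mulVec]

theorem normSq_pauliState {ψ : Bool → ℂ} (hψ : ∑ b, ‖ψ b‖ ^ 2 = 1) (c d : Bool) :
    ∑ b, ‖pauliState ψ c d b‖ ^ 2 = 1 := by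
  simp only [Fintype.sum_bool, pauliState_apply] at hψ ⊢
  cases c <;> cases d <;> simp <;> linarith

/-- The four Pauli images of any pure state average to the totally mixed state. By linearity of the
circuit this is checked separately for each final amplitude. -/
theorem sum_prob_pauliState {k out : ℕ} {𝒢 : GateSet} (C : QCircuit 𝒢 (k + 1) out) {ψ : Bool → ℂ}
    (hψ : ∑ b, ‖ψ b‖ ^ 2 = 1) (y : BitString k) (v : BitString out) :
    ∑ c, ∑ d, C.prob (qubitKet (pauliState ψ c d) y) v =
      2 * ∑ b : Bool, C.prob (qubitKet (Pi.single b 1) y) v := by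
  simp only [Fintype.sum_bool, QCircuit.prob, ← Finset.sum_add_distrib, Finset.mul_sum]
  refine Finset.sum_congr rfl fun w _ => ?_
  simp only [final_qubitKet C (pauliState ψ _ _), Fintype.sum_bool, pauliState_apply]
  rw [Fintype.sum_bool] at hψ
  rw [← sum_norm_sq_pauli hψ]
  have e (u v : ℂ) : ‖-u + v‖ = ‖u - v‖ := by
    rw [← norm_neg]
    congr 1
    ring
  simp [e, ← sub_eq_add_neg]
  ring

/-- Averages commute, so a₂ and x₂ can be moved outside; a bound for every fixed choice of them then
passes to the average. -/
theorem abs_uniformAvg_lt_left {n : ℕ} {δ : ℝ}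
    {G : BitString n → BitString n → BitString n → BitString n → ℝ}
    (h : ∀ a₂ x₂, |uniformAvg fun a₁ => uniformAvg fun x₁ => G a₁ a₂ x₁ x₂| < δ) :
    |uniformAvg fun a₁ => uniformAvg fun a₂ => uniformAvg fun x₁ => uniformAvg fun x₂ =>
      G a₁ a₂ x₁ x₂| < δ := by
  rw [uniformAvg_comm]
  refine abs_uniformAvg_lt fun a₂ => ?_
  have e : (uniformAvg fun a₁ => uniformAvg fun x₁ => uniformAvg fun x₂ => G a₁ a₂ x₁ x₂) =
      uniformAvg fun x₂ => uniformAvg fun a₁ => uniformAvg fun x₁ => G a₁ a₂ x₁ x₂ := by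
    rw [uniformAvg_comm fun x₂ a₁ => uniformAvg fun x₁ => G a₁ a₂ x₁ x₂]
    exact congrArg uniformAvg (funext fun a₁ => uniformAvg_comm _)
  rw [e]
  exact abs_uniformAvg_lt fun x₂ => h a₂ x₂

theorem abs_uniformAvg_lt_right {n : ℕ} {δ : ℝ}
    {G : BitString n → BitString n → BitString n → BitString n → ℝ}
    (h : ∀ a₁ x₁, |uniformAvg fun a₂ => uniformAvg fun x₂ => G a₁ a₂ x₁ x₂| < δ) :
    |uniformAvg fun a₁ => uniformAvg fun a₂ => uniformAvg fun x₁ => uniformAvg fun x₂ =>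
      G a₁ a₂ x₁ x₂| < δ := by
  refine abs_uniformAvg_lt fun a₁ => ?_
  rw [uniformAvg_comm]
  exact abs_uniformAvg_lt fun x₁ => h a₁ x₁

theorem glQubitCommitment_concealing {𝒢 : GateSet} {f : ∀ n, Equiv.Perm (BitString n)}
    (hf : IsQuantumOneWayPermutation 𝒢 f) (K : CliffordT allGates) :
    (glQubitCommitment f).IsComputationallyConcealing := by
  intro c d
  filter_upwards [eventually_hardToInvert hf c d] with n ⟨hn, hT, hδ⟩
  rintro ψ hψ ⟨C, hC, hdist⟩
  change QCircuit allGates (n + n + (n + n) + 1) 1 at C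
  let com (r : BitString (n + n + (n + n))) : BitString (n + n + (n + n)) :=
    Fin.append (Fin.append (f n r.fst.fst) (f n r.fst.snd)) r.snd
  change 1 / (n : ℝ) ^ c ≤ |(uniformAvg fun r : BitString (n + n + (n + n)) => C.prob (qubitKet
    (pauliState ψ (innerMod2 r.fst.fst r.snd.fst) (innerMod2 r.fst.snd r.snd.snd)) (com r))
      ![true]) - uniformAvg fun r => (∑ b : Bool, C.prob (qubitKet (Pi.single b 1) (com r))
        ![true]) / 2| at hdist
  set δ : ℝ := 1 / (n : ℝ) ^ c
  have hw : n + n + (n + n) + 1 ≤ C.width := C.inp_le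
  have hsize : C.gates.length ≤ n ^ d := hC
  let y (b₁ b₂ x₁ x₂ : BitString n) : BitString (n + n + (n + n)) :=
    Fin.append (Fin.append b₁ b₂) (Fin.append x₁ x₂)
  let β (φ : Bool → ℂ) (b₁ b₂ x₁ x₂ : BitString n) : ℝ :=
    bias C.gates C.outQubit (C.initial (qubitKet φ (y b₁ b₂ x₁ x₂)))
  have hβ {φ : Bool → ℂ} {U : Matrix.unitaryGroup Bool ℂ}
      (hU : ∀ b, (U : Matrix Bool Bool ℂ) b false = φ b) (b₁ b₂ x₁ x₂ : BitString n) :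
      β φ b₁ b₂ x₁ x₂ = bias (.one U C.outQubit :: C.gates) C.outQubit (ket (takeBits C.width
        (glueBits (1 + (n + n) + n) (glueBits (1 + (n + n)) (glueBits (1 + n)
          (glueBits 1 (fun _ => false) b₁) b₂) x₁) x₂))) := by
    rw [← List.singleton_append, bias_append, ← glueBits_append, ← glueBits_append]
    simp only [β]
    rw [← apply_ket_eq_initial C hU]
    simp only [y, glueBits_append]
    rfl
  -- For fixed φ, a₂ and x₂ the data of the second pair are constants, built in through `e`; `h₂`
  -- does the same with the pairs exchanged.
  have h₁ {φ : Bool → ℂ} (hφ : ∑ b, ‖φ b‖ ^ 2 = 1) (b₂ x₂ : BitString n) :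
      |uniformAvg fun a => uniformAvg fun x => sgn (innerMod2 a x) * β φ (f n a) b₂ x x₂| < δ := by
    obtain ⟨U, hU⟩ := exists_unitary_apply_false hφ
    have := abs_avg_bias_lt (p := 1) (q := 1 + (n + n)) (N := n + n + (n + n) + 1) hδ.le hn K
      (.one U C.outQubit :: C.gates) (.inl (by omega)) (by omega) (by omega) hw C.outQubit
      (glueBits (1 + (n + n) + n) (glueBits (1 + n) (fun _ => false) b₂) x₂)
      (fun i hi => by rw [glueBits_of_ge _ _ (by omega), glueBits_of_ge _ _ (by omega)])
      (by rw [List.length_cons]; omega)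
    simp only [hβ hU]
    refine lt_of_eq_of_lt (congrArg abs (congrArg uniformAvg (funext fun a => congrArg uniformAvg
      (funext fun x => ?_)))) this
    rw [plant, glueBits_comm (s := 1) (t := 1 + (n + n) + n) (by omega),
      glueBits_comm (s := 1) (t := 1 + n) (by omega),
      glueBits_comm (s := 1 + (n + n)) (t := 1 + (n + n) + n) (by omega)]
  have h₂ {φ : Bool → ℂ} (hφ : ∑ b, ‖φ b‖ ^ 2 = 1) (b₁ x₁ : BitString n) :
      |uniformAvg fun a => uniformAvg fun x => sgn (innerMod2 a x) * β φ b₁ (f n a) x₁ x| < δ := by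
    obtain ⟨U, hU⟩ := exists_unitary_apply_false hφ
    have := abs_avg_bias_lt (p := 1 + n) (q := 1 + (n + n) + n) (N := n + n + (n + n) + 1) hδ.le hn
      K (.one U C.outQubit :: C.gates) (.inl (by omega)) (by omega) (by omega) hw C.outQubit
      (glueBits (1 + (n + n)) (glueBits 1 (fun _ => false) b₁) x₁)
      (fun i hi => by rw [glueBits_of_ge _ _ (by omega), glueBits_of_ge _ _ (by omega)])
      (by rw [List.length_cons]; omega)
    simp only [hβ hU]
    refine lt_of_eq_of_lt (congrArg abs (congrArg uniformAvg (funext fun a => congrArg uniformAvg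
      (funext fun x => ?_)))) this
    rw [plant, glueBits_comm (s := 1 + n) (t := 1 + (n + n)) (by omega)]
  have hr (g : BitString (n + n + (n + n)) → ℝ) : uniformAvg g =
      uniformAvg fun a₁ => uniformAvg fun a₂ => uniformAvg fun x₁ => uniformAvg fun x₂ =>
        g (y a₁ a₂ x₁ x₂) := by
    simp only [uniformAvg_append]
    rfl
  let avg (G : BitString n → BitString n → BitString n → BitString n → ℝ) : ℝ :=
    uniformAvg fun a₁ => uniformAvg fun a₂ => uniformAvg fun x₁ => uniformAvg fun x₂ =>
      G a₁ a₂ x₁ x₂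
  have hE₁ (c : Bool) : |avg fun a₁ a₂ x₁ x₂ => sgn (innerMod2 a₁ x₁) *
      β (pauliState ψ c (innerMod2 a₂ x₂)) (f n a₁) (f n a₂) x₁ x₂| < δ :=
    abs_uniformAvg_lt_left fun a₂ x₂ => h₁ (normSq_pauliState hψ _ _) _ _
  have hE₂ (c d : Bool) : |avg fun a₁ a₂ x₁ x₂ => sgn (innerMod2 a₂ x₂) *
      β (pauliState ψ c d) (f n a₁) (f n a₂) x₁ x₂| < δ :=
    abs_uniformAvg_lt_right fun a₁ x₁ => h₂ (normSq_pauliState hψ _ _) _ _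
  -- Hybrid argument: the first line replaces the exponent a₁·x₁ of X by a random one, with a₂·x₂
  -- kept; the other two replace a₂·x₂ for each fixed exponent of X. The coefficients 1/4, twice,
  -- and 1/8, four times, add up to 1, so the total stays below δ.
  have hD : (uniformAvg fun r : BitString (n + n + (n + n)) => C.prob (qubitKet
        (pauliState ψ (innerMod2 r.fst.fst r.snd.fst) (innerMod2 r.fst.snd r.snd.snd)) (com r))
          ![true]) - (uniformAvg fun r => (∑ b : Bool, C.prob (qubitKet (Pi.single b 1) (com r))
            ![true]) / 2) =
      avg fun a₁ a₂ x₁ x₂ =>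
        1 / 4 * (sgn (innerMod2 a₁ x₁) *
          β (pauliState ψ true (innerMod2 a₂ x₂)) (f n a₁) (f n a₂) x₁ x₂) -
        1 / 4 * (sgn (innerMod2 a₁ x₁) *
          β (pauliState ψ false (innerMod2 a₂ x₂)) (f n a₁) (f n a₂) x₁ x₂) +
        (1 / 8 * (sgn (innerMod2 a₂ x₂) * β (pauliState ψ true true) (f n a₁) (f n a₂) x₁ x₂) -
        1 / 8 * (sgn (innerMod2 a₂ x₂) * β (pauliState ψ true false) (f n a₁) (f n a₂) x₁ x₂)) +
        (1 / 8 * (sgn (innerMod2 a₂ x₂) * β (pauliState ψ false true) (f n a₁) (f n a₂) x₁ x₂) -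
        1 / 8 * (sgn (innerMod2 a₂ x₂) *
          β (pauliState ψ false false) (f n a₁) (f n a₂) x₁ x₂)) := by
    rw [← uniformAvg_sub]
    refine (hr _).trans (congrArg uniformAvg (funext fun a₁ => congrArg uniformAvg (funext fun a₂ =>
      congrArg uniformAvg (funext fun x₁ => congrArg uniformAvg (funext fun x₂ => ?_)))))
    have hcom : com (y a₁ a₂ x₁ x₂) = y (f n a₁) (f n a₂) x₁ x₂ := by simp [com, y]
    have hmix := sum_prob_pauliState C hψ (y (f n a₁) (f n a₂) x₁ x₂) ![true]
    have hpr (c d : Bool) : C.prob (qubitKet (pauliState ψ c d) (y (f n a₁) (f n a₂) x₁ x₂))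
        ![true] = (1 - β (pauliState ψ c d) (f n a₁) (f n a₂) x₁ x₂) / 2 := by
      rw [C.prob_eq ((normSq_qubitKet _ _).trans (normSq_pauliState hψ c d)), sgn_true]
      simp only [β]
      ring
    rw [hcom, eq_div_of_mul_eq two_ne_zero ((mul_comm _ _).trans hmix.symm)]
    simp only [Fintype.sum_bool, hpr, y, BitString.fst_append, BitString.snd_append]
    cases innerMod2 a₁ x₁ <;> cases innerMod2 a₂ x₂ <;> simp only [sgn_true, sgn_false] <;> ring
  refine absurd hdist (not_le.2 ?_)
  refine lt_of_eq_of_lt (congrArg abs hD) ?_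
  simp only [avg, uniformAvg_add, uniformAvg_sub, uniformAvg_mul]
  have e₁ := abs_lt.1 (hE₁ true)
  have e₂ := abs_lt.1 (hE₁ false)
  have e₃ := abs_lt.1 (hE₂ true true)
  have e₄ := abs_lt.1 (hE₂ true false)
  have e₅ := abs_lt.1 (hE₂ false true)
  have e₆ := abs_lt.1 (hE₂ false false)
  simp only [avg, uniformAvg_mul] at e₁ e₂ e₃ e₄ e₅ e₆
  rw [abs_lt]
  constructor <;> linarith

/-! ### Correctness and perfect binding -/

theorem glBitCommitment_correct (f : ∀ n, Equiv.Perm (BitString n)) :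
    (glBitCommitment f).IsCorrect := by
  intro n z r
  constructor
  · simp [glBitCommitment]
  · simp only [glBitCommitment, BitString.fst_append, BitString.snd_append]
    cases z <;> simp

theorem glBitCommitment_binding (f : ∀ n, Equiv.Perm (BitString n)) :
    (glBitCommitment f).IsPerfectlyBinding := by
  intro n com a a' h h'
  have ha : f n a = f n a' := (of_decide_eq_true h).trans (of_decide_eq_true h').symm
  rw [(f n).injective ha]

theorem pauli_mul_pauli (b c : Bool) :
    pauliZ ^ c.toNat * pauliX ^ b.toNat * (pauliX ^ b.toNat * pauliZ ^ c.toNat) = 1 := by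
  have hX : pauliX * pauliX = 1 := by
    ext x y
    cases x <;> cases y <;> simp [pauliX, Matrix.mul_apply]
  have hZ : pauliZ * pauliZ = 1 := by
    ext x y
    cases x <;> cases y <;> simp [pauliZ, Matrix.mul_apply, Matrix.diagonal]
  cases b <;> cases c <;> simp [hX, hZ, mul_assoc]
  rw [← mul_assoc pauliX, hX, one_mul, hZ]

theorem glQubitCommitment_correct (f : ∀ n, Equiv.Perm (BitString n)) :
    (glQubitCommitment f).IsCorrect := by
  intro n r
  constructor
  · simp [glQubitCommitment]
  · simp only [glQubitCommitment, BitString.snd_append]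
    exact pauli_mul_pauli _ _

/-- Acceptance fixes both images under the injective map `f n`, hence both halves of the opening,
and so the Pauli operator. -/
theorem glQubitCommitment_binding (f : ∀ n, Equiv.Perm (BitString n)) :
    (glQubitCommitment f).IsPerfectlyBinding := by
  intro n com o o' h h'
  have h₁ := of_decide_eq_true h
  have h₂ := of_decide_eq_true h'
  have e₁ := (f n).injective (h₁.1.trans h₂.1.symm)
  have e₂ := (f n).injective (h₁.2.trans h₂.2.symm)
  simp only [glQubitCommitment]
  rw [e₁, e₂]

end

/-! ### The theorem -/

theorem theorem6 (𝒢 : GateSet) [Finite 𝒢.One] [Finite 𝒢.Two] (h𝒢 : 𝒢.ContainsCliffordT)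
    (f : ∀ n, Equiv.Perm (BitString n)) (hf : IsQuantumOneWayPermutation 𝒢 f) :
    ((glBitCommitment f).IsCorrect ∧ (glBitCommitment f).IsEfficient 𝒢 ∧
      (glBitCommitment f).IsPerfectlyBinding ∧
      (glBitCommitment f).IsComputationallyConcealing) ∧
    ((glQubitCommitment f).IsCorrect ∧ (glQubitCommitment f).IsEfficient 𝒢 ∧
      (glQubitCommitment f).IsPerfectlyBinding ∧
      (glQubitCommitment f).IsComputationallyConcealing) := by
  obtain ⟨K⟩ := h𝒢.nonempty
  obtain ⟨C, hC, hCf⟩ := hf.easy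
  refine ⟨⟨glBitCommitment_correct f, ⟨efficient_bit_commit K hC hCf, ?_,
    efficient_bit_verify K hC hCf⟩, glBitCommitment_binding f,
    glBitCommitment_concealing hf K.all⟩, ⟨glQubitCommitment_correct f,
    ⟨efficient_qubit_commit K hC hCf, ?_, efficient_qubit_verify K hC hCf⟩,
    glQubitCommitment_binding f, glQubitCommitment_concealing hf K.all⟩⟩
  -- Both openings are initial parts of the random string, which comes first in the input.
  · refine efficient_prefix (inp := fun n => n + n + 1) (out := fun n => n) hC 1 2
      (fun n => by ring) (fun n => by omega) fun n z => ?_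
    simp only [glBitCommitment]
    rw [fst_sliceBits, fst_sliceBits]
  · refine efficient_prefix (inp := fun n => n + n + (n + n)) (out := fun n => n + n) hC 0 4
      (fun n => by ring) (fun n => by omega) fun n z => ?_
    simp only [glQubitCommitment]
    rw [fst_sliceBits]
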